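/- Conventions. A circle is $S=\{x\in\mathbb{R}^2: q(x)=0\}$ with $q(x)=(x_1-p_1)^2+(x_2-p_2)^2-r^2$, $r>0$; its defining polynomial is $q$ or $-q$. Let $(D,\{f_j\}_{j=1}^{l_1},c,\mu)$ be data consisting of a set $D\subset\mathbb{R}^2$, real polynomials $f_j$ in two variables, and maps $c:\{1,\dots,l_1\}\to\{1,\dots,l_2\}$ and $\mu:\{1,\dots,l_2\}\to\mathbb{N}\cup\{0\}$. The data are admissible if: $D$ is open, connected, non-empty and $\overline D$ is compact; each $S_j=\{f_j=0\}$ is a connected non-singular curve; $D=U\cap\bigcap_j\{f_j>0\}$ for every sufficiently small open neighbourhood $U$ of $\overline D$; the curves $S_j$ meet transversally at the points of $\overline D$; and $c$ is injective on $\{j_1,\dots,j_s\}$ whenever $S_{j_1}\cap\dots\cap S_{j_s}\cap\overline D\neq\emptyset$. Put $$M=\Bigl\{(x,y_1,\dots,y_{l_2})\in \overline D\times\prod_{i=1}^{l_2}\mathbb{R}^{\mu(i)+1} : \prod_{c(j)=i}f_j(x)=\|y_i\|^2\ (1\le i\le l_2)\Bigr\}$$ (an empty product is $1$), of dimension $2+\sum_i\mu(i)$.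 The moment-like map of the data is $f:M\to\mathbb{R}^2$, $(x,y)\mapsto x$, and $f_0:M\to\mathbb{R}$ is its first component. The Reeb space of $f_0$ is the quotient of $M$ whose points are the connected components of the level sets of $f_0$; its vertices are the classes that contain singular points of $f_0$, and its edges are the connected components of the complement of the vertex set. It is the Reeb graph if this makes it a finite graph (multiple edges allowed, no loops). An isomorphism of graphs is a homeomorphism that respects vertices and edges. A graph collapses to a graph $G$ if successive removals of a vertex that is an end of exactly one remaining edge, together with that edge, lead to a subdivision of $G$. A function is Morse-Bott if around each singular point it is the composition of a submersion with a Morse function. Theorem. Let $(D_0,\{f_{0,j}\}_{j=1}^{l_{0,1}},c_0,m_0)$ be admissible data with $l_2=1$ (so $\mu$ is one number $m_0\ge 0$), such that the curves $S_{0,j}=\{f_{0,j}=0\}$ are mutually disjoint circles, $f_{0,j}$ being one of their two defining polynomials, and $\overline{D_0}\setminus D_0=\bigsqcup_j S_{0,j}$. Then the first component of its moment-like map has a Reeb graph $W_0$; let $e_1,\dots,e_{n_e}$ be its edges. For every $\varepsilon>0$ one can choose, for each map $l:\{1,\dots,n_e\}\to\mathbb{N}\cup\{0\}$ and each integer $m>m_0+2$,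 admissible data $(D,\{f_j\}_{j=1}^{l_1},c,\mu)$ with moment-like map $f_{l,m}:M_{l,m}\to\mathbb{R}^2$ such that the following hold. 1. $l_1=l_{0,1}+\sum_i l(i)$ and $l_2=2$; $f_j=f_{0,j}$ for $j\le l_{0,1}$; the sets $S_j$ for $j>l_{0,1}$ are mutually disjoint circles of radius less than $\varepsilon$, and for each $i$ exactly $l(i)$ of them are centred on a boundary arc $L_i$ attached to $e_i$ (a connected component of the set of points of $\bigsqcup_j S_{0,j}$ in the image under the original moment-like map of the preimage of $e_i$ in the original manifold). Each new circle meets exactly one of the circles $S_{0,j}$, and in exactly two points. $D\subset D_0$ is what remains of $D_0$ when the closed discs bounded by the new circles are removed, and $(\overline D\setminus D)\cap S_j\neq\emptyset$ for all $j\le l_1$. Moreover $c(j)=1$ for $j\le l_{0,1}$, $c(j)=2$ for $j>l_{0,1}$, $\mu(1)=m_0$ and $\mu(2)=m-m_0-2$. If $l\neq 0$, then $c$ is surjective and $D\ne D_0$. 2. $M_{l,m}$ is a compact connected non-singular real algebraic manifold without boundary, of dimension $m$, and it is the whole common zero set in $\mathbb{R}^{m+2}$ of its two defining polynomials. 3.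 The first component of $f_{l,m}$ is a Morse-Bott function. It has a Reeb graph $W_{l,m}$, and $W_{l,m}$ collapses to $W_0$. 4. If $l$ and $l'$ differ at exactly one element of $\{1,\dots,n_e\}$ and $m,m'>m_0+2$, then $W_{l,m}$ and $W_{l',m'}$ are not isomorphic. -/

import Mathlib

open Set Topology
open scoped ContDiff

noncomputable section

/-! ### Finite graphs as topological spaces -/

/-- The (open) edges of a space `X` with vertex set `V`: the connected components of the
complement of `V`. -/
def edgeSet {X : Type*} [TopologicalSpace X] (V : Set X) : Set (Set X) :=
  {e | ∃ x ∈ Vᶜ, e = connectedComponentIn Vᶜ x}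

/-- `X` is a finite graph (a finite CW complex of dimension at most one, without loops, multiple
edges being allowed) with vertex set `V`: each open edge is the interior of an arc that is
embedded in `X` and whose two end points are vertices. -/
structure IsFiniteGraph (X : Type*) [TopologicalSpace X] (V : Set X) : Prop where
  t2 : T2Space X
  finite_vertices : V.Finite
  finite_edges : (edgeSet V).Finite
  edge_arc : ∀ e ∈ edgeSet V, ∃ γ : C(unitInterval, X), Function.Injective γ ∧
    γ 0 ∈ V ∧ γ 1 ∈ V ∧ γ '' Ioo 0 1 = e

/-- Isomorphism of graphs: a homeomorphism that maps the vertex set onto the vertex set, hence also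
the edges (the components of the complement of the vertex set) onto the edges. -/
def GraphIso {X Y : Type*} [TopologicalSpace X] [TopologicalSpace Y] (V : Set X) (W : Set Y) :
    Prop :=
  ∃ φ : X ≃ₜ Y, φ '' V = W

/-- An elementary collapse of a subgraph `A` of the graph `(X, V)` onto `B`: the vertex `v` lies at
the end of exactly one edge `e` of `A`, and `v` and `e` are removed. -/
def ElementaryCollapse {X : Type*} [TopologicalSpace X] (V : Set X) (A B : Set X) : Prop :=
  ∃ v ∈ V, ∃ e ∈ edgeSet V, v ∈ A ∧ e ⊆ A ∧ v ∈ closure e ∧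
    (∀ e' ∈ edgeSet V, e' ⊆ A → v ∈ closure e' → e' = e) ∧ B = A \ (e ∪ {v})

/-- The graph `(X, V)` collapses to the graph `(Y, W)`: finitely many elementary collapses lead from
`X` to a subgraph `K` which is a subdivision of `(Y, W)`, that is, there is a homeomorphism from `K`
onto `Y` under which every vertex of `Y` corresponds to a vertex of `X`. -/
def GraphCollapsesTo {X Y : Type*} [TopologicalSpace X] [TopologicalSpace Y]
    (V : Set X) (W : Set Y) : Prop :=
  ∃ K : Set X, Relation.ReflTransGen (ElementaryCollapse V) univ K ∧
    ∃ φ : K ≃ₜ Y, ∀ y ∈ W, (φ.symm y : X) ∈ V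

/-! ### Reeb spaces -/

/-- Two points are equivalent when they lie in the same connected component of the same level set
of `g`. -/
def reebSetoid {X : Type*} [TopologicalSpace X] (g : X → ℝ) : Setoid X :=
  Setoid.ker fun x => connectedComponentIn (g ⁻¹' {g x}) x

/-- The Reeb space of `g`, with the quotient topology. -/
abbrev ReebSpace {X : Type*} [TopologicalSpace X] (g : X → ℝ) : Type _ :=
  Quotient (reebSetoid g)

/-- The quotient map onto the Reeb space. -/
def reebMap {X : Type*} [TopologicalSpace X] (g : X → ℝ) (x : X) : ReebSpace g :=
  Quotient.mk (reebSetoid g) x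

/-! ### Morse and Morse-Bott functions -/

/-- `h` is a Morse function on the open set `V`: it is smooth there, and at each of its critical
points in `V` the second derivative is a nondegenerate bilinear form. -/
def IsMorseOn {k : ℕ} (h : EuclideanSpace ℝ (Fin k) → ℝ) (V : Set (EuclideanSpace ℝ (Fin k))) :
    Prop :=
  ContDiffOn ℝ ∞ h V ∧ ∀ y ∈ V, fderiv ℝ h y = 0 →
    ∀ v, (∀ w, fderiv ℝ (fderiv ℝ h) y v w = 0) → v = 0

section MorseBott

variable {E : Type*} [NormedAddCommGroup E] [NormedSpace ℝ E]

/-- The singular points of the restriction of `g` to a submanifold `M` of `E` whose tangent space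
at `p` is `T p`: the points at which the differential of `g` vanishes on the tangent space. -/
def singularPoints (M : Set E) (T : E → Submodule ℝ E) (g : E → ℝ) : Set E :=
  {p | p ∈ M ∧ ∀ v ∈ T p, fderiv ℝ g p v = 0}

/-- The restriction of `g` to a submanifold `M` of `E` with tangent spaces `T p` is Morse-Bott:
around each of its singular points it is the composition of a submersion `s` (given as the
restriction of a smooth map on a neighbourhood in `E`) with a Morse function `h`. -/
def IsMorseBott (M : Set E) (T : E → Submodule ℝ E) (g : E → ℝ) : Prop :=
  ContDiff ℝ ∞ g ∧ ∀ p ∈ singularPoints M T g,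
    ∃ (k : ℕ) (U : Set E) (s : E → EuclideanSpace ℝ (Fin k))
      (V : Set (EuclideanSpace ℝ (Fin k))) (h : EuclideanSpace ℝ (Fin k) → ℝ),
      IsOpen U ∧ p ∈ U ∧ ContDiffOn ℝ ∞ s U ∧
      (∀ q ∈ U ∩ M, ∀ w, ∃ v ∈ T q, fderiv ℝ s q v = w) ∧
      IsOpen V ∧ MapsTo s (U ∩ M) V ∧ IsMorseOn h V ∧ ∀ q ∈ U ∩ M, g q = h (s q)

end MorseBott

/-! ### Moment-like maps over plane regions -/

/-- The function on `ℝ^σ` defined by a real polynomial. -/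
def polyFun {σ : Type*} (P : MvPolynomial σ ℝ) (x : EuclideanSpace ℝ σ) : ℝ :=
  MvPolynomial.eval (fun s => x s) P

/-- The Euclidean plane. -/
abbrev Plane : Type := EuclideanSpace ℝ (Fin 2)

/-- The zero set of a polynomial in the plane. -/
def curve (f : MvPolynomial (Fin 2) ℝ) : Set Plane := {x | polyFun f x = 0}

/-- The polynomial `(x₁ - p₁)² + (x₂ - p₂)² - r²`. -/
def circlePoly (p : Plane) (r : ℝ) : MvPolynomial (Fin 2) ℝ :=
  (MvPolynomial.X 0 - MvPolynomial.C (p 0)) ^ 2 + (MvPolynomial.X 1 - MvPolynomial.C (p 1)) ^ 2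
    - MvPolynomial.C (r ^ 2)

/-- `f` is one of the two polynomials `±((x₁ - p₁)² + (x₂ - p₂)² - r²)` that define a circle. -/
def IsCirclePoly (f : MvPolynomial (Fin 2) ℝ) : Prop :=
  ∃ (p : Plane) (r : ℝ), 0 < r ∧ (f = circlePoly p r ∨ f = -circlePoly p r)

/-- Data for a moment-like map into the plane: a set `D`, polynomials `f j` (`j < l₁`), a map
`c : {0, …, l₁ - 1} → {0, …, l₂ - 1}` and sphere dimensions `μ i` (`i < l₂`). -/
structure MomentData where
  l₁ : ℕ
  l₂ : ℕ
  D : Set Plane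
  f : Fin l₁ → MvPolynomial (Fin 2) ℝ
  c : Fin l₁ → Fin l₂
  μ : Fin l₂ → ℕ

namespace MomentData

variable (d : MomentData)

/-- The standing conditions on the data, apart from the surjectivity of `c`. -/
structure IsAdmissible : Prop where
  isOpen : IsOpen d.D
  isConnected : IsConnected d.D
  isCompact_closure : IsCompact (closure d.D)
  /-- every `f j` defines a connected curve -/
  curve_connected : ∀ j, IsConnected (curve (d.f j))
  /-- every curve is non-singular -/
  curve_nonsingular : ∀ j, ∀ p ∈ curve (d.f j), fderiv ℝ (polyFun (d.f j)) p ≠ 0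
  /-- for all sufficiently small open neighbourhoods `U` of the closure of `D`, the set `D` is the
  part of `U` on which all `f j` are positive -/
  eq_pos : ∃ U₀ : Set Plane, IsOpen U₀ ∧ closure d.D ⊆ U₀ ∧
    ∀ U : Set Plane, IsOpen U → closure d.D ⊆ U → U ⊆ U₀ →
      d.D = U ∩ {x | ∀ j, 0 < polyFun (d.f j) x}
  /-- at the points of the closure of `D` the curves intersect transversally -/
  transversal : ∀ s : Finset (Fin d.l₁), s.Nonempty → ∀ p ∈ closure d.D,
    (∀ j ∈ s, p ∈ curve (d.f j)) →
      Module.finrank ℝ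
        (⨅ j ∈ s, (fderiv ℝ (polyFun (d.f j)) p).ker : Submodule ℝ Plane) + s.card = 2
  /-- `c` is injective on any set of indices whose curves meet in the closure of `D` -/
  injOn : ∀ s : Finset (Fin d.l₁),
    (∃ p ∈ closure d.D, ∀ j ∈ s, p ∈ curve (d.f j)) → InjOn d.c s

/-- The index set of the coordinates `(x, (y i)_i)` of `ℝ² × ∏ i, ℝ^(μ i + 1)`. -/
abbrev Coord : Type := Fin 2 ⊕ (Σ i : Fin d.l₂, Fin (d.μ i + 1))

/-- The space `ℝ² × ∏ i, ℝ^(μ i + 1)`. -/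
abbrev Ambient : Type := EuclideanSpace ℝ d.Coord

/-- The polynomial `∏_{c j = i} f j (x) - ‖y i‖²`. -/
def eqn (i : Fin d.l₂) : MvPolynomial d.Coord ℝ :=
  (∏ j with d.c j = i, MvPolynomial.rename Sum.inl (d.f j))
    - ∑ k : Fin (d.μ i + 1), MvPolynomial.X (Sum.inr ⟨i, k⟩) ^ 2

/-- The common zero set of the polynomials `eqn i`. -/
def zeroSet : Set d.Ambient := {p | ∀ i, polyFun (d.eqn i) p = 0}

/-- The projection `(x, y) ↦ x`. -/
def proj (p : d.Ambient) : Plane := WithLp.toLp 2 fun i => p (Sum.inl i)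

/-- The manifold `M` of the data: the part of the zero set that lies over small neighbourhoods of
the closure of `D`, which is the part over the closure of `D`. The moment-like map is the
restriction of `proj` to it. -/
def manifold : Set d.Ambient := {p | d.proj p ∈ closure d.D ∧ p ∈ d.zeroSet}

/-- The dimension `2 + ∑ i, μ i` of the manifold. -/
def dim : ℕ := 2 + ∑ i, d.μ i

/-- The manifold is non-singular, hence by the implicit function theorem a smooth submanifold of
dimension `(2 + ∑ i, (μ i + 1)) - l₂ = dim`: the differentials of the `l₂` defining polynomials are
linearly independent at each of its points. -/
def IsNonsingular : Prop :=
  ∀ p ∈ d.manifold, LinearIndependent ℝ fun i => fderiv ℝ (polyFun (d.eqn i)) p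

/-- The tangent space of the manifold: the common kernel of the differentials of the defining
polynomials. -/
def tangent (p : d.Ambient) : Submodule ℝ d.Ambient :=
  ⨅ i, (fderiv ℝ (polyFun (d.eqn i)) p).ker

/-- The first coordinate `(x, y) ↦ x₁`. -/
def height (p : d.Ambient) : ℝ := d.proj p 0

/-- The first component of the moment-like map, as a function on the manifold. -/
def heightOn (p : d.manifold) : ℝ := d.height p

/-- The Reeb space of the first component of the moment-like map. -/
abbrev Reeb : Type := ReebSpace d.heightOn

/-- The vertices of the Reeb graph: the classes that contain singular points. -/
def vertices : Set d.Reeb :=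
  reebMap d.heightOn '' {p | (p : d.Ambient) ∈ singularPoints d.manifold d.tangent d.height}

/-- The edges of the Reeb graph. -/
abbrev Edge : Type := edgeSet d.vertices

/-- `L` is a boundary arc attached to the edge `e`: a connected component of the set of those points
of the curves that lie in the image of the preimage of `e` under the moment-like map. -/
def IsBoundaryArc (e : d.Edge) (L : Set Plane) : Prop :=
  ∃ x ∈ (fun p : d.manifold => d.proj p) '' (reebMap d.heightOn ⁻¹' (e : Set d.Reeb)) ∩
      ⋃ j, curve (d.f j),
    L = connectedComponentIn
      ((fun p : d.manifold => d.proj p) '' (reebMap d.heightOn ⁻¹' (e : Set d.Reeb)) ∩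
        ⋃ j, curve (d.f j)) x

/-- The data `d'` arise from `d` (where `l₂ = 1`) by adding, for each edge `e` of the Reeb graph of
`d`, exactly `l e` circles of radius less than `ε` centred on a boundary arc attached to `e`, and by
cutting off the discs bounded by the new circles. The indices `j < d.l₁` belong to the old circles,
the other ones to the new circles. -/
structure IsAddition (d' : MomentData) (l : d.Edge → ℕ) (ε : ℝ) : Prop where
  l₁_eq : d'.l₁ = d.l₁ + ∑ᶠ e, l e
  l₂_eq : d'.l₂ = 2
  old : ∀ (j : Fin d'.l₁) (hj : j.val < d.l₁), d'.f j = d.f ⟨j, hj⟩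
  new : ∃ (p : Fin d'.l₁ → Plane) (L : d.Edge → Set Plane),
    (∀ j : Fin d'.l₁, d.l₁ ≤ j.val → ∃ r : ℝ, 0 < r ∧ r < ε ∧ d'.f j = circlePoly (p j) r) ∧
    (∀ e, d.IsBoundaryArc e (L e)) ∧
    ∀ e, {j : Fin d'.l₁ | d.l₁ ≤ j.val ∧ p j ∈ L e}.ncard = l e
  region : d'.D = {x ∈ d.D | ∀ j : Fin d'.l₁, d.l₁ ≤ j.val → 0 < polyFun (d'.f j) x}
  colour : ∀ j : Fin d'.l₁, (d'.c j).val = if j.val < d.l₁ then 0 else 1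
  disjoint : ∀ j j' : Fin d'.l₁, d.l₁ ≤ j.val → d.l₁ ≤ j'.val → j ≠ j' →
    Disjoint (curve (d'.f j)) (curve (d'.f j'))
  meets : ∀ j : Fin d'.l₁, d.l₁ ≤ j.val →
    ∃! i : Fin d.l₁, (curve (d.f i) ∩ curve (d'.f j)).Nonempty
  two_points : ∀ j : Fin d'.l₁, d.l₁ ≤ j.val → ∀ i : Fin d.l₁,
    (curve (d.f i) ∩ curve (d'.f j)).Nonempty → (curve (d.f i) ∩ curve (d'.f j)).ncard = 2

end MomentData

end

/-! A connected component of a level set of the height lies over a vertical segment of the closed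
plane region. Suppose that every maximal vertical segment contains a point at which the product of
one fixed colour vanishes, and that all other colours have spheres of positive dimension. Then the
part of the manifold over a maximal segment is connected (`isPreconnected_over`), so the Reeb space
is the closed region with each maximal vertical segment contracted to a point
(`reebMap_eq_iff_sliceRel`), and questions about the graph become plane geometry. The structure
`IsGood` collects what this needs. The singular points lie over the extreme points of circles with
respect to the first coordinate and over the intersections of two circles (`mem_singularPoints_iff`,
`sing_cases`). Away from their classes the height on the Reeb space is locally injective and has
local sections (`isRegularFor`). On a compact Hausdorff space with a finite set of exceptional
points this already gives a finite graph (`isFiniteGraph_of_regular`).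

The new circles are centred at upper ends of slices, where the old boundary is neither vertical nor
horizontal. Near such a centre the region is the part below a graph that rises in the direction
given by a sign `σ`. The circle meets this graph in a point `tip` above the centre, on the side `σ`,
and in a point `foot` below it, on the other side. Above the disc, between `tip` and the extreme
point `apex` of the circle inside the region, a thin triangle of the region remains. Its slices are
separated by the disc from those below, and the two families join only at `apex`. Hence each circle
attaches a whisker to the Reeb graph: an edge whose free end is the class of `tip` and whose other
end is the class of `apex`. The class of `foot` is one more vertex on the part that survives the
collapse.

Removing the whiskers gives back the old graph up to subdivision, because every old slice is
represented by its lower end, which no disc touches (`slice_bottom`, `graphCollapsesTo_add`). The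
number of vertices grows by exactly three for each circle (`ncard_vertices_add`). Isomorphic graphs
therefore have the same total number of new circles, which is impossible if the two distributions
differ at exactly one edge.

The height is Morse-Bott for two reasons. Over an extreme point of a circle the equation can be
solved for the first coordinate, which gives the root of a nondegenerate quadratic polynomial
(`exists_morse_extreme`). Over a corner the two products are local coordinates of the plane, and the
height is a function of two squared norms with nonzero partial derivatives, since neither curve is
vertical there (`exists_morse_corner`). Finally, the manifold is the whole zero set because among
the functions of one colour at most one can be negative at a point, so that a nonnegative product
forces nonnegative factors (`pos_of_neg_of_boundary`, `manifold_eq_zeroSet`). -/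

noncomputable section

/-! ### A criterion for finite graphs -/

section GraphCriterion

variable {R : Type*} [TopologicalSpace R]

/-- Two connected open sets that meet, on each of which an open map to the line is injective: the
map is injective on the union. -/
theorem injOn_union_of_isOpen [T2Space R] {g : R → ℝ} (hg : Continuous g) {W : Set R}
    (hW : ∀ O ⊆ W, IsOpen O → IsOpen (g '' O)) {C₁ C₂ : Set R}
    (ho₁ : IsOpen C₁) (ho₂ : IsOpen C₂) (h₁ : C₁ ⊆ W) (h₂ : C₂ ⊆ W)
    (hc₁ : IsPreconnected C₁) (hc₂ : IsPreconnected C₂)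
    (hi₁ : InjOn g C₁) (hi₂ : InjOn g C₂) (hm : (C₁ ∩ C₂).Nonempty) :
    InjOn g (C₁ ∪ C₂) := by
  have hJ : IsPreconnected (g '' C₁ ∩ g '' C₂) := by
    have e₁ := (hc₁.image g hg.continuousOn).ordConnected
    have e₂ := (hc₂.image g hg.continuousOn).ordConnected
    exact (e₁.inter e₂).isPreconnected
  -- The values on `C₁ ∩ C₂` form a non-empty part of the interval of common values. It is open
  -- because `g` is open, and closed in the interval because the space is Hausdorff. Hence it is the
  -- whole interval.
  have hsub : g '' C₁ ∩ g '' C₂ ⊆ g '' (C₁ ∩ C₂) := by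
    apply hJ.subset_of_closure_inter_subset (hW _ (inter_subset_left.trans h₁) (ho₁.inter ho₂))
    · obtain ⟨w, hw⟩ := hm
      exact ⟨g w, ⟨mem_image_of_mem g hw.1, mem_image_of_mem g hw.2⟩, mem_image_of_mem g hw⟩
    · rintro t ⟨ht, ⟨z₁, hz₁, rfl⟩, ⟨z₂, hz₂, h12⟩⟩
      by_cases hz : z₁ = z₂
      · subst hz; exact ⟨z₁, ⟨hz₁, hz₂⟩, rfl⟩
      obtain ⟨O₁, O₂, hO₁, hO₂, hzO₁, hzO₂, hd⟩ := t2_separation hz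
      have hn : g '' (O₁ ∩ C₁) ∩ g '' (O₂ ∩ C₂) ∈ 𝓝 (g z₁) := by
        apply IsOpen.mem_nhds
        · exact (hW _ (inter_subset_right.trans h₁) (hO₁.inter ho₁)).inter
            (hW _ (inter_subset_right.trans h₂) (hO₂.inter ho₂))
        · exact ⟨mem_image_of_mem g ⟨hzO₁, hz₁⟩, ⟨z₂, ⟨hzO₂, hz₂⟩, h12⟩⟩
      obtain ⟨_, ⟨⟨a, ha, hab⟩, ⟨b, hb, hbb⟩⟩, ⟨w, hw, rfl⟩⟩ := mem_closure_iff_nhds.1 ht _ hn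
      have e1 : a = w := hi₁ ha.2 hw.1 hab
      have e2 : b = w := hi₂ hb.2 hw.2 hbb
      subst e1; subst e2
      exact (disjoint_left.1 hd ha.1 hb.1).elim
  have key : ∀ z ∈ C₁, ∀ z' ∈ C₂, g z = g z' → z = z' := by
    intro z hz z' hz' h
    obtain ⟨w, hw, hwz⟩ := hsub ⟨mem_image_of_mem g hz, ⟨z', hz', h.symm⟩⟩
    rw [← hi₁ hw.1 hz hwz, ← hi₂ hw.2 hz' (hwz.trans h)]
  rintro z (hz | hz) z' (hz' | hz') h
  · exact hi₁ hz hz' h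
  · exact key z hz z' hz' h
  · exact (key z' hz' z hz h.symm).symm
  · exact hi₂ hz hz' h

/-- A connected set that is clopen in a set `W` is a connected component of `W`. -/
theorem eq_connectedComponentIn_of_clopen {W E : Set R} {x : R} (hE : IsPreconnected E)
    (hxE : x ∈ E) (hEW : E ⊆ W) (ho : IsOpen E) (hcl : closure E ∩ W ⊆ E) :
    E = connectedComponentIn W x := by
  apply Subset.antisymm (hE.subset_connectedComponentIn hxE hEW)
  apply isPreconnected_connectedComponentIn.subset_of_closure_inter_subset ho
  · exact ⟨x, mem_connectedComponentIn (hEW hxE), hxE⟩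
  · exact fun y hy => hcl ⟨hy.1, connectedComponentIn_subset _ _ hy.2⟩

/-- Points near which `g` is a homeomorphism onto an open interval. -/
def IsRegularFor (g : R → ℝ) (x : R) : Prop :=
  (∃ N, IsOpen N ∧ x ∈ N ∧ InjOn g N) ∧
    ∃ δ > 0, ∃ s : ℝ → R, ContinuousOn s (Ioo (g x - δ) (g x + δ)) ∧ s (g x) = x ∧
      ∀ t ∈ Ioo (g x - δ) (g x + δ), g (s t) = t

/-- Near `g x` the section takes values where `g` is injective, so the image of a small interval is
cut out of `N ∩ O` by a condition on `g` alone. This makes the image open as well as connected. -/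
theorem IsRegularFor.exists_nhd {g : R → ℝ} (hg : Continuous g) {x : R}
    (h : IsRegularFor g x) {O : Set R} (hO : IsOpen O) (hx : x ∈ O) :
    ∃ N ⊆ O, IsOpen N ∧ x ∈ N ∧ InjOn g N ∧ IsPreconnected N ∧ g '' N ∈ 𝓝 (g x) := by
  obtain ⟨⟨N, hN, hxN, hi⟩, δ, hδ, s, hs, hsx, hgs⟩ := h
  have hmem : Ioo (g x - δ) (g x + δ) ∈ 𝓝 (g x) := Ioo_mem_nhds (by linarith) (by linarith)
  have hsc : ContinuousAt s (g x) := hs.continuousAt hmem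
  have : s ⁻¹' (N ∩ O) ∈ 𝓝 (g x) := hsc (by rw [hsx]; exact (hN.inter hO).mem_nhds ⟨hxN, hx⟩)
  obtain ⟨η, hη, hsub⟩ := Metric.mem_nhds_iff.1 (Filter.inter_mem this hmem)
  rw [Real.ball_eq_Ioo] at hsub
  set I := Ioo (g x - η) (g x + η) with hI
  have hEq : s '' I = (N ∩ O) ∩ g ⁻¹' I := by
    ext y
    constructor
    · rintro ⟨t, ht, rfl⟩
      refine ⟨(hsub ht).1, ?_⟩
      rw [mem_preimage, hgs t (hsub ht).2]; exact ht
    · rintro ⟨hy, hyI⟩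
      refine ⟨g y, hyI, ?_⟩
      exact hi (hsub hyI).1.1 hy.1 (hgs _ (hsub hyI).2)
  refine ⟨s '' I, ?_, ?_, ?_, ?_, ?_, ?_⟩
  · rw [hEq]; exact fun y hy => hy.1.2
  · rw [hEq]; exact (hN.inter hO).inter (isOpen_Ioo.preimage hg)
  · exact ⟨g x, ⟨by linarith, by linarith⟩, hsx⟩
  · rw [hEq]; exact hi.mono fun y hy => hy.1.1
  · exact isPreconnected_Ioo.image s (hs.mono fun t ht => (hsub ht).2)
  · refine Filter.mem_of_superset (Ioo_mem_nhds (a := g x - η) (b := g x + η) (by linarith)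
      (by linarith)) ?_
    intro t ht
    exact ⟨s t, mem_image_of_mem s ht, hgs t (hsub ht).2⟩

theorem isOpen_image_of_regular {g : R → ℝ} (hg : Continuous g) {V : Set R}
    (h : ∀ x ∉ V, IsRegularFor g x) : ∀ O ⊆ Vᶜ, IsOpen O → IsOpen (g '' O) := by
  intro O hOV hO
  rw [isOpen_iff_mem_nhds]
  rintro _ ⟨x, hx, rfl⟩
  obtain ⟨N, hNO, -, -, -, -, h6⟩ := (h x (hOV hx)).exists_nhd hg hO hx
  exact Filter.mem_of_superset h6 (image_mono hNO)

/-- The component is obtained as the union `E` of all connected open sets around the point that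
avoid `V` and on which `g` is injective. By `injOn_union_of_isOpen` this family is stable under
adding a further set of the same kind that meets a member, so `g` is injective on `E`, and `E` is
clopen in `Vᶜ`. -/
theorem edge_structure [T2Space R] {g : R → ℝ} (hg : Continuous g) {V : Set R} (hV : IsClosed V)
    (h : ∀ x ∉ V, IsRegularFor g x) {e : Set R} (he : e ∈ edgeSet V) :
    IsOpen e ∧ IsConnected e ∧ InjOn g e ∧ e ⊆ Vᶜ ∧ closure e ∩ Vᶜ ⊆ e := by
  obtain ⟨x, hx, rfl⟩ := he
  have hWo := isOpen_image_of_regular hg h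
  set 𝒞 : Set (Set R) := {C | IsOpen C ∧ x ∈ C ∧ InjOn g C ∧ IsPreconnected C ∧ C ⊆ Vᶜ} with h𝒞
  set E := ⋃₀ 𝒞 with hE
  have hunion : ∀ C₁ ∈ 𝒞, ∀ C₂ : Set R, IsOpen C₂ → InjOn g C₂ → IsPreconnected C₂ → C₂ ⊆ Vᶜ →
      (C₁ ∩ C₂).Nonempty → C₁ ∪ C₂ ∈ 𝒞 := by
    intro C₁ h₁ C₂ ho hi hc hs hm
    exact ⟨h₁.1.union ho, Or.inl h₁.2.1,
      injOn_union_of_isOpen hg hWo h₁.1 ho h₁.2.2.2.2 hs h₁.2.2.2.1 hc h₁.2.2.1 hi hm,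
      IsPreconnected.union' hm h₁.2.2.2.1 hc, union_subset h₁.2.2.2.2 hs⟩
  have hxE : x ∈ E := by
    obtain ⟨N, h1, h2, h3, h4, h5, -⟩ := (h x hx).exists_nhd hg hV.isOpen_compl hx
    exact ⟨N, ⟨h2, h3, h4, h5, h1⟩, h3⟩
  have hEo : IsOpen E := isOpen_sUnion fun C hC => hC.1
  have hEV : E ⊆ Vᶜ := sUnion_subset fun C hC => hC.2.2.2.2
  have hEc : IsPreconnected E := isPreconnected_sUnion x 𝒞 (fun C hC => hC.2.1)
    fun C hC => hC.2.2.2.1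
  have hEi : InjOn g E := by
    rintro z ⟨C₁, hC₁, hz⟩ z' ⟨C₂, hC₂, hz'⟩ heq
    have := hunion C₁ hC₁ C₂ hC₂.1 hC₂.2.2.1 hC₂.2.2.2.1 hC₂.2.2.2.2 ⟨x, hC₁.2.1, hC₂.2.1⟩
    exact this.2.2.1 (Or.inl hz) (Or.inr hz') heq
  have hEcl : closure E ∩ Vᶜ ⊆ E := by
    rintro y ⟨hy, hyV⟩
    obtain ⟨N, h1, h2, h3, h4, h5, -⟩ := (h y hyV).exists_nhd hg hV.isOpen_compl hyV
    obtain ⟨w, hwN, C, hC, hwC⟩ := mem_closure_iff_nhds.1 hy N (h2.mem_nhds h3)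
    exact ⟨C ∪ N, hunion C hC N h2 h4 h5 h1 ⟨w, hwC, hwN⟩, Or.inr h3⟩
  rw [← eq_connectedComponentIn_of_clopen hEc hxE hEV hEo hEcl]
  exact ⟨hEo, ⟨⟨x, hxE⟩, hEc⟩, hEi, hEV, hEcl⟩

/-- An edge on which `g` is injective is mapped onto an open interval, and the inverse converges at
the ends of the interval to vertices. -/
theorem edge_interval [CompactSpace R] {g : R → ℝ} (hg : Continuous g)
    {V : Set R} (h : ∀ x ∉ V, IsRegularFor g x)
    {e : Set R} (ho : IsOpen e) (hc : IsConnected e) (hi : InjOn g e) (heV : e ⊆ Vᶜ) :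
    ∃ a b, a < b ∧ g '' e = Ioo a b ∧ ∃ s : ℝ → R, ContinuousOn s (Ioo a b) ∧
      (∀ t ∈ Ioo a b, g (s t) = t ∧ s t ∈ e) := by
  have hWo := isOpen_image_of_regular hg h
  have hJo : IsOpen (g '' e) := hWo e heV ho
  have hJc : IsConnected (g '' e) := hc.image g hg.continuousOn
  have hbdd : Bornology.IsBounded (g '' e) :=
    ((isCompact_range hg).isBounded).subset (image_subset_range g e)
  obtain ⟨hba, hbb⟩ := isBounded_iff_bddBelow_bddAbove.1 hbdd
  have hIoo : g '' e = Ioo (sInf (g '' e)) (sSup (g '' e)) := by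
    apply Subset.antisymm
    · intro t ht
      obtain ⟨η, hη, hsub⟩ := Metric.isOpen_iff.1 hJo t ht
      rw [Real.ball_eq_Ioo] at hsub
      have h1 := csInf_le hba (hsub (show t - η/2 ∈ _ from ⟨by linarith, by linarith⟩))
      have h2 := le_csSup hbb (hsub (show t + η/2 ∈ _ from ⟨by linarith, by linarith⟩))
      exact ⟨by linarith, by linarith⟩
    · exact hJc.Ioo_csInf_csSup_subset hba hbb
  set a := sInf (g '' e)
  set b := sSup (g '' e)
  have hab : a < b := by
    obtain ⟨t, ht⟩ := hJc.1
    rw [hIoo] at ht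
    exact ht.1.trans ht.2
  have hex : ∀ t ∈ Ioo a b, ∃ y ∈ e, g y = t := fun t ht => by rwa [← hIoo] at ht
  classical
  obtain ⟨y₀, -⟩ := hc.1
  let s : ℝ → R := fun t => if ht : t ∈ Ioo a b then (hex t ht).choose else y₀
  have hs : ∀ t ∈ Ioo a b, g (s t) = t ∧ s t ∈ e := by
    intro t ht
    simp only [s, dif_pos ht]
    exact ⟨(hex t ht).choose_spec.2, (hex t ht).choose_spec.1⟩
  refine ⟨a, b, hab, hIoo, s, ?_, hs⟩
  intro t ht
  apply ContinuousAt.continuousWithinAt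
  rw [ContinuousAt, Filter.tendsto_def]
  intro O hO
  obtain ⟨O', hO', hO'o, hsO'⟩ := mem_nhds_iff.1 hO
  -- Continuity of the inverse is openness of `g` on the edge.
  have : g '' (O' ∩ e) ∈ 𝓝 t := by
    apply (hWo _ (inter_subset_right.trans heV) (hO'o.inter ho)).mem_nhds
    exact ⟨s t, ⟨hsO', (hs t ht).2⟩, (hs t ht).1⟩
  filter_upwards [this, isOpen_Ioo.mem_nhds ht] with u hu huI
  obtain ⟨y, hy, rfl⟩ := hu
  have : s (g y) = y := hi (hs _ huI).2 hy.2 (hs _ huI).1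
  rw [mem_preimage, this]
  exact hO' hy.1

/-- By compactness `s` is eventually close to the finite set `V`. A connected tail of `s` cannot
jump between disjoint neighbourhoods of different points of `V`, so there is only one cluster point.
-/
theorem exists_vertex_limit [T2Space R] [CompactSpace R] {V : Set R} (hV : V.Finite)
    {s : ℝ → R} {l : Filter ℝ} [l.NeBot]
    (hcon : ∀ t ∈ l, ∃ t' ∈ l, t' ⊆ t ∧ IsPreconnected (s '' t'))
    (hcl : ∀ y, MapClusterPt y l s → y ∈ V) :
    ∃ v ∈ V, Filter.Tendsto s l (𝓝 v) := by
  obtain ⟨O, hO, hdis⟩ := hV.t2_separation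
  obtain ⟨v, -, hv⟩ := isCompact_univ (X := R) (f := l.map s) (by simp)
  have hvV : v ∈ V := hcl v hv
  have hev : ∀ᶠ t in l, s t ∈ ⋃ w ∈ V, O w := by
    by_contra hcon'
    have hfr : ∃ᶠ t in l, s t ∈ (⋃ w ∈ V, O w)ᶜ := Filter.not_eventually.1 hcon'
    have hcpt : IsCompact (⋃ w ∈ V, O w)ᶜ :=
      (isOpen_biUnion fun w _ => (hO w).2).isClosed_compl.isCompact
    obtain ⟨y, hy, hyc⟩ := hcpt.exists_mapClusterPt_of_frequently hfr
    exact hy (mem_biUnion (hcl y hyc) (hO y).1)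
  obtain ⟨T, hT, hTsub, hTc⟩ := hcon _ hev
  have huniq : ∀ y, MapClusterPt y l s → y = v := by
    intro y hy
    have hyV := hcl y hy
    by_contra hne
    have f1 := (mapClusterPt_iff_frequently.1 hv (O v) ((hO v).2.mem_nhds (hO v).1)).and_eventually
      (show ∀ᶠ t in l, t ∈ T from hT)
    have f2 := (mapClusterPt_iff_frequently.1 hy (O y) ((hO y).2.mem_nhds (hO y).1)).and_eventually
      (show ∀ᶠ t in l, t ∈ T from hT)
    obtain ⟨t1, h1, h1T⟩ := f1.exists
    obtain ⟨t2, h2, h2T⟩ := f2.exists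
    have hsub : s '' T ⊆ O v := by
      apply hTc.subset_left_of_subset_union (hO v).2
        (v := ⋃ w ∈ V \ {v}, O w) (isOpen_biUnion fun w _ => (hO w).2)
      · rw [disjoint_iUnion₂_right]
        exact fun w hw => hdis hvV hw.1 (Ne.symm hw.2)
      · rintro _ ⟨t, ht, rfl⟩
        obtain ⟨w, hw, htw⟩ := mem_iUnion₂.1 (hTsub ht)
        by_cases hwv : w = v
        · subst hwv; exact Or.inl htw
        · exact Or.inr (mem_biUnion (show w ∈ V \ {v} from ⟨hw, hwv⟩) htw)
      · exact ⟨s t1, mem_image_of_mem s h1T, h1⟩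
    exact disjoint_left.1 (hdis hvV hyV (Ne.symm hne)) (hsub (mem_image_of_mem s h2T)) h2
  refine ⟨v, hvV, ?_⟩
  exact isCompact_univ.tendsto_nhds_of_unique_mapClusterPt (by simp) fun y _ hy => huniq y hy

-- A cluster point of the inverse at an end of the interval belongs to `V`: otherwise it would lie
-- in the edge, which is closed in `Vᶜ`, although its value is an end of the open interval.
-- Extending the inverse by its two limits gives the arc. That the ends of the interval are values
-- of vertices is recorded for counting the edges.
set_option maxHeartbeats 1000000 in
theorem edge_arc_of_regular [T2Space R] [CompactSpace R] {g : R → ℝ} (hg : Continuous g)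
    {V : Set R} (hV : V.Finite) (h : ∀ x ∉ V, IsRegularFor g x) {e : Set R} (he : e ∈ edgeSet V) :
    ∃ γ : C(unitInterval, R), Function.Injective γ ∧
    γ 0 ∈ V ∧ γ 1 ∈ V ∧ γ '' Ioo 0 1 = e ∧ ∃ a ∈ g '' V, ∃ b ∈ g '' V, g '' e = Ioo a b := by
  obtain ⟨ho, hc, hi, heV, hcl⟩ := edge_structure hg hV.isClosed h he
  obtain ⟨a, b, hab, hJ, s, hsc, hs⟩ := edge_interval hg h ho hc hi heV
  have hlim : ∀ (c : ℝ) (l : Filter ℝ) (_ : l.NeBot), c ∉ Ioo a b → l ≤ 𝓝 c → Ioo a b ∈ l →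
      (∀ t ∈ l, ∃ t' ∈ l, t' ⊆ t ∧ t' ⊆ Ioo a b ∧ IsPreconnected t') →
      ∃ v ∈ V, Filter.Tendsto s l (𝓝 v) ∧ g v = c := by
    intro c l hl hcI hlc hIl hcon
    have hgl : Filter.Tendsto (g ∘ s) l (𝓝 c) := by
      refine Filter.Tendsto.congr' ?_ (Filter.tendsto_id'.2 hlc)
      filter_upwards [hIl] with t ht
      exact (hs t ht).1.symm
    have hgv : ∀ y, MapClusterPt y l s → g y = c := by
      intro y hy
      have h1 : MapClusterPt (g y) l (g ∘ s) := hy.continuousAt_comp hg.continuousAt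
      have h2 : ClusterPt (g y) (𝓝 c) := h1.clusterPt.mono hgl
      exact eq_of_nhds_neBot h2
    obtain ⟨v, hv, hv'⟩ := exists_vertex_limit (s := s) (l := l) hV (fun t ht => by
        obtain ⟨t', h1, h2, h3, h4⟩ := hcon t ht
        exact ⟨t', h1, h2, h4.image s (hsc.mono h3)⟩) (fun y hy => by
        by_contra hyV
        have hye : y ∈ closure e := by
          rw [mem_closure_iff_nhds]
          intro O hO
          obtain ⟨t, ht1, ht2⟩ := ((mapClusterPt_iff_frequently.1 hy O hO).and_eventually hIl).exists
          exact ⟨s t, ht1, (hs t ht2).2⟩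
        have : g y ∈ Ioo a b := hJ ▸ mem_image_of_mem g (hcl ⟨hye, hyV⟩)
        rw [hgv y hy] at this
        exact hcI this)
    exact ⟨v, hv, hv', hgv v (hv'.mapClusterPt)⟩
  obtain ⟨va, hva, hta, hga⟩ := hlim a (𝓝[>] a) inferInstance (by simp) nhdsWithin_le_nhds
    (Ioo_mem_nhdsGT hab) (by
      intro t ht
      obtain ⟨u, hu, hsub⟩ := (mem_nhdsGT_iff_exists_Ioo_subset' hab).1 ht
      have hau : a < u := hu
      refine ⟨Ioo a (min u b), Ioo_mem_nhdsGT (lt_min hau hab),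
        (Ioo_subset_Ioo_right (min_le_left _ _)).trans hsub,
        Ioo_subset_Ioo_right (min_le_right _ _), isPreconnected_Ioo⟩)
  obtain ⟨vb, hvb, htb, hgb⟩ := hlim b (𝓝[<] b) inferInstance (by simp) nhdsWithin_le_nhds
    (Ioo_mem_nhdsLT hab) (by
      intro t ht
      obtain ⟨u, hu, hsub⟩ := (mem_nhdsLT_iff_exists_Ioo_subset' hab).1 ht
      have hau : u < b := hu
      refine ⟨Ioo (max u a) b, Ioo_mem_nhdsLT (max_lt hau hab),
        (Ioo_subset_Ioo_left (le_max_left _ _)).trans hsub,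
        Ioo_subset_Ioo_left (le_max_right _ _), isPreconnected_Ioo⟩)
  set s' := extendFrom (Ioo a b) s
  have hs'c : ContinuousOn s' (Icc a b) := continuousOn_Icc_extendFrom_Ioo hsc hta htb
  have hs'a : s' a = va := eq_lim_at_left_extendFrom_Ioo hab hta
  have hs'b : s' b = vb := eq_lim_at_right_extendFrom_Ioo hab htb
  have hs'i : ∀ t ∈ Ioo a b, s' t = s t := fun t ht => extendFrom_eq (subset_closure ht) (hsc t ht)
  have hgs' : ∀ t ∈ Icc a b, g (s' t) = t := by
    intro t ht
    rcases eq_or_lt_of_le ht.1 with rfl | h1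
    · rw [hs'a, hga]
    rcases eq_or_lt_of_le ht.2 with rfl | h2
    · rw [hs'b, hgb]
    rw [hs'i t ⟨h1, h2⟩, (hs t ⟨h1, h2⟩).1]
  have hp : ∀ u : unitInterval, a + u * (b - a) ∈ Icc a b := by
    intro u
    have h0 := u.2.1
    have h1 := u.2.2
    exact ⟨by nlinarith, by nlinarith⟩
  let γ : C(unitInterval, R) := ⟨fun u => s' (a + u * (b - a)), by
    apply hs'c.comp_continuous (by fun_prop) hp⟩
  have hba : b - a ≠ 0 := by linarith
  refine ⟨γ, ?_, ?_, ?_, ?_, a, ⟨va, hva, hga⟩, b, ⟨vb, hvb, hgb⟩, hJ⟩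
  · intro u u' huu
    have := congrArg g huu
    simp only [γ, ContinuousMap.coe_mk, hgs' _ (hp _)] at this
    have : (u : ℝ) = u' := by
      have h3 : ((u : ℝ) - u') * (b - a) = 0 := by linarith
      rcases mul_eq_zero.1 h3 with h | h
      · linarith
      · exact (hba h).elim
    exact Subtype.ext this
  · simpa [γ, hs'a] using hva
  · simpa [γ, hs'b] using hvb
  · ext y
    constructor
    · rintro ⟨u, hu, rfl⟩
      have h0 : (0 : ℝ) < u := hu.1
      have h1 : (u : ℝ) < 1 := hu.2
      have : a + u * (b - a) ∈ Ioo a b := ⟨by nlinarith, by nlinarith⟩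
      simp only [γ, ContinuousMap.coe_mk]
      rw [hs'i _ this]
      exact (hs _ this).2
    · intro hy
      have hgy : g y ∈ Ioo a b := hJ ▸ mem_image_of_mem g hy
      have hpos : 0 < b - a := by linarith
      have h0 : 0 < (g y - a) / (b - a) := div_pos (by linarith [hgy.1]) hpos
      have h1 : (g y - a) / (b - a) < 1 := (div_lt_one hpos).2 (by linarith [hgy.2])
      refine ⟨⟨(g y - a) / (b - a), h0.le, h1.le⟩, ⟨h0, h1⟩, ?_⟩
      simp only [γ, ContinuousMap.coe_mk]
      rw [div_mul_cancel₀ _ hba, add_sub_cancel, hs'i _ hgy]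
      exact hi (hs _ hgy).2 hy (hs _ hgy).1

theorem isFiniteGraph_of_regular [T2Space R] [CompactSpace R] {g : R → ℝ} (hg : Continuous g)
    {V : Set R} (hV : V.Finite) (h : ∀ x ∉ V, IsRegularFor g x) : IsFiniteGraph R V where
  t2 := inferInstance
  finite_vertices := hV
  edge_arc e he := by
    obtain ⟨γ, h1, h2, h3, h4, -⟩ := edge_arc_of_regular hg hV h he
    exact ⟨γ, h1, h2, h3, h4⟩
  finite_edges := by
    rcases isEmpty_or_nonempty R with h0 | h0
    · exact Set.toFinite _
    have hgV : (g '' V).Finite := hV.image g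
    -- The edges are sorted by their intervals, for which there are finitely many candidates.
    have hsub : edgeSet V ⊆ ⋃ a ∈ g '' V, ⋃ b ∈ g '' V, {e ∈ edgeSet V | g '' e = Ioo a b} := by
      intro e he
      obtain ⟨-, -, -, -, -, a, ha, b, hb, hJ⟩ := edge_arc_of_regular hg hV h he
      exact mem_biUnion ha (mem_biUnion hb ⟨he, hJ⟩)
    refine (hgV.biUnion fun a _ => hgV.biUnion fun b _ => ?_).subset hsub
    by_cases hab : a < b
    swap
    · convert finite_empty (α := Set R)
      ext e
      simp only [mem_ofPred_eq, mem_empty_iff_false, iff_false, not_and]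
      rintro he hJ
      rw [Ioo_eq_empty hab, image_eq_empty] at hJ
      obtain ⟨-, hc, -⟩ := edge_structure hg hV.isClosed h he
      exact hc.1.ne_empty hJ
    -- The fibre over a value not taken on `V` is compact and discrete, hence finite. Every edge
    -- over this interval contains a point of the fibre and is determined by it.
    obtain ⟨c, hcI, hcV⟩ : ∃ c ∈ Ioo a b, c ∉ g '' V :=
      ((Ioo_infinite hab).sdiff hgV).nonempty
    have hfib : (g ⁻¹' {c}).Finite := by
      have hcpt : IsCompact (g ⁻¹' {c}) := (isClosed_singleton.preimage hg).isCompact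
      have hloc : ∀ x ∈ g ⁻¹' {c}, ∃ N ∈ 𝓝[g ⁻¹' {c}] x, N.Finite := by
        intro x hx
        obtain ⟨⟨N, hN, hxN, hi⟩, -⟩ := h x fun hxV => hcV ⟨x, hxV, hx⟩
        refine ⟨N ∩ g ⁻¹' {c}, Filter.inter_mem (mem_nhdsWithin_of_mem_nhds (hN.mem_nhds hxN)) self_mem_nhdsWithin, ?_⟩
        apply (finite_singleton x).subset
        intro y hy
        exact hi hy.1 hxN (hy.2.trans hx.symm)
      exact hcpt.induction_on finite_empty (fun _ _ hst ht => ht.subset hst)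
        (fun _ _ hs ht => hs.union ht) hloc
    have hch : ∀ e ∈ {e ∈ edgeSet V | g '' e = Ioo a b}, ∃ y ∈ e, g y = c := by
      rintro e ⟨-, hJ⟩
      have : c ∈ g '' e := hJ ▸ hcI
      exact this
    choose! y hy hyc using hch
    refine Finite.of_finite_image (f := y) (hfib.subset ?_) ?_
    · rintro _ ⟨e, he, rfl⟩; exact hyc e he
    · intro e he e' he' hee
      obtain ⟨⟨x, hx, rfl⟩, -⟩ := id he
      obtain ⟨⟨x', hx', rfl⟩, -⟩ := id he'
      have h1 := hy _ he
      have h2 := hy _ he'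
      rw [hee] at h1
      exact (connectedComponentIn_eq h1).trans (connectedComponentIn_eq h2).symm

end GraphCriterion

/-! ### Reeb spaces of functions on compact spaces -/

section Reeb

variable {X : Type*} [TopologicalSpace X] {g : X → ℝ}

theorem continuous_reebMap : Continuous (reebMap g) := continuous_quotient_mk'

theorem surjective_reebMap : Function.Surjective (reebMap g) := Quotient.mk_surjective

theorem mem_fibreComponent (x : X) : x ∈ connectedComponentIn (g ⁻¹' {g x}) x :=
  mem_connectedComponentIn rfl

theorem reebMap_eq_iff {x y : X} :
    reebMap g x = reebMap g y ↔
      connectedComponentIn (g ⁻¹' {g x}) x = connectedComponentIn (g ⁻¹' {g y}) y :=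
  Quotient.eq (r := reebSetoid g)

theorem eq_of_reebMap_eq {x y : X} (h : reebMap g x = reebMap g y) : g x = g y := by
  have h1 : y ∈ connectedComponentIn (g ⁻¹' {g x}) x := by
    rw [reebMap_eq_iff.1 h]; exact mem_fibreComponent y
  exact (connectedComponentIn_subset _ _ h1).symm

theorem reebMap_eq_of_isPreconnected {x y : X} {A : Set X} (hA : IsPreconnected A)
    (hx : x ∈ A) (hy : y ∈ A) (hg : ∀ z ∈ A, g z = g x) : reebMap g x = reebMap g y := by
  rw [reebMap_eq_iff, hg y hy]
  exact connectedComponentIn_eq (hA.subset_connectedComponentIn hx (fun z hz => hg z hz) hy)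

theorem mem_fibreComponent_of_reebMap_eq {x y : X} (h : reebMap g x = reebMap g y) :
    y ∈ connectedComponentIn (g ⁻¹' {g x}) x := by
  rw [reebMap_eq_iff.1 h]; exact mem_fibreComponent y

/-- The function on the Reeb space induced by `g`. -/
def reebHeight (g : X → ℝ) : ReebSpace g → ℝ :=
  Quotient.lift g fun _ _ h => eq_of_reebMap_eq (Quotient.sound h)

@[simp] theorem reebHeight_reebMap (x : X) : reebHeight g (reebMap g x) = g x := rfl

theorem continuous_reebHeight (hg : Continuous g) : Continuous (reebHeight g) :=
  hg.quotient_lift _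

instance [CompactSpace X] : CompactSpace (ReebSpace g) := inferInstanceAs (CompactSpace (Quotient _))

/-- In a compact Hausdorff level set the components are intersections of clopen sets, so two of them
are separated by a clopen splitting. The splitting extends to disjoint open sets of `X`, and by
compactness these cover all nearby level sets too. -/
theorem t2Space_reebSpace [CompactSpace X] [T2Space X] (hg : Continuous g) :
    T2Space (ReebSpace g) := by
  refine ⟨fun a b hab => ?_⟩
  obtain ⟨x, rfl⟩ := surjective_reebMap a
  obtain ⟨y, rfl⟩ := surjective_reebMap b
  by_cases hxy : g x = g y
  swap
  · obtain ⟨u, v, hu, hv, hxu, hyv, hd⟩ := t2_separation hxy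
    refine ⟨reebHeight g ⁻¹' u, reebHeight g ⁻¹' v, hu.preimage (continuous_reebHeight hg),
      hv.preimage (continuous_reebHeight hg), hxu, hyv, hd.preimage _⟩
  set F := g ⁻¹' {g x} with hF
  have hFc : IsClosed F := isClosed_singleton.preimage hg
  have hFcpt : IsCompact F := hFc.isCompact
  have : CompactSpace F := isCompact_iff_compactSpace.1 hFcpt
  let x' : F := ⟨x, rfl⟩
  let y' : F := ⟨y, hxy.symm⟩
  have hne : y' ∉ connectedComponent x' := by
    intro h
    apply hab
    rw [reebMap_eq_iff, ← hxy, ← hF]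
    apply connectedComponentIn_eq
    rw [connectedComponentIn_eq_image (show x ∈ F from rfl)]
    exact ⟨y', h, rfl⟩
  rw [connectedComponent_eq_iInter_isClopen] at hne
  simp only [mem_iInter, Subtype.forall, not_forall] at hne
  obtain ⟨Z, ⟨hZ, hxZ⟩, hyZ⟩ := hne
  have hA : IsCompact ((↑) '' Z : Set X) := hZ.1.isCompact.image continuous_subtype_val
  have hB : IsCompact ((↑) '' Zᶜ : Set X) :=
    hZ.compl.1.isCompact.image continuous_subtype_val
  have hdis : Disjoint ((↑) '' Z : Set X) ((↑) '' Zᶜ : Set X) :=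
    (disjoint_image_iff Subtype.val_injective).2 disjoint_compl_right
  obtain ⟨U, W, hU, hW, hAU, hBW, hUW⟩ := SeparatedNhds.of_isCompact_isCompact hA hB hdis
  have hFU : F ⊆ U ∪ W := by
    intro z hz
    by_cases h : (⟨z, hz⟩ : F) ∈ Z
    · exact Or.inl (hAU ⟨⟨z, hz⟩, h, rfl⟩)
    · exact Or.inr (hBW ⟨⟨z, hz⟩, h, rfl⟩)
  -- a neighbourhood of the level over which the fibres are contained in `U ∪ W`
  have hT : ∃ T, IsOpen T ∧ g x ∈ T ∧ g ⁻¹' T ⊆ U ∪ W := by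
    refine ⟨(g '' (U ∪ W)ᶜ)ᶜ, ?_, ?_, ?_⟩
    · exact ((hU.union hW).isClosed_compl.isCompact.image hg).isClosed.isOpen_compl
    · rintro ⟨z, hz, hzx⟩
      exact hz (hFU hzx)
    · intro z hz
      by_contra hzU
      exact hz (mem_image_of_mem g hzU)
  obtain ⟨T, hTo, hxT, hT⟩ := hT
  -- A component of a level set over `T` lies entirely in one of the two open sets, so the part of
  -- `U` over `T` is saturated and its image is open.
  have hsat : ∀ (U W : Set X), IsOpen U → IsOpen W → Disjoint U W → g ⁻¹' T ⊆ U ∪ W →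
      IsOpen (reebMap g '' (U ∩ g ⁻¹' T)) ∧
        reebMap g ⁻¹' (reebMap g '' (U ∩ g ⁻¹' T)) = U ∩ g ⁻¹' T := by
    intro U W hU hW hUW hT
    have : reebMap g ⁻¹' (reebMap g '' (U ∩ g ⁻¹' T)) = U ∩ g ⁻¹' T := by
      apply Subset.antisymm _ (subset_preimage_image _ _)
      rintro z ⟨w, ⟨hwU, hwT⟩, hwz⟩
      have hz := mem_fibreComponent_of_reebMap_eq hwz
      have hsub : connectedComponentIn (g ⁻¹' {g w}) w ⊆ U := by
        apply isPreconnected_connectedComponentIn.subset_left_of_subset_union hU hW hUW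
        · intro v hv
          apply hT
          have := connectedComponentIn_subset _ _ hv
          rw [mem_preimage, mem_singleton_iff] at this
          rw [mem_preimage, this]; exact hwT
        · exact ⟨w, mem_fibreComponent w, hwU⟩
      refine ⟨hsub hz, ?_⟩
      rw [mem_preimage, ← eq_of_reebMap_eq hwz]; exact hwT
    refine ⟨?_, this⟩
    rw [← isQuotientMap_quotient_mk'.isOpen_preimage]
    change IsOpen (reebMap g ⁻¹' _)
    rw [this]
    exact hU.inter (hTo.preimage hg)
  have h1 := hsat U W hU hW hUW hT
  have h2 := hsat W U hW hU hUW.symm (by rwa [union_comm])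
  refine ⟨_, _, h1.1, h2.1, ⟨x, ⟨hAU ⟨x', hxZ, rfl⟩, hxT⟩, rfl⟩,
    ⟨y, ⟨hBW ⟨y', hyZ, rfl⟩, by rw [mem_preimage, ← hxy]; exact hxT⟩, rfl⟩, ?_⟩
  rw [disjoint_left]
  rintro c hc hc'
  obtain ⟨z, rfl⟩ := surjective_reebMap c
  have e1 : z ∈ U ∩ g ⁻¹' T := h1.2 ▸ hc
  have e2 : z ∈ W ∩ g ⁻¹' T := h2.2 ▸ hc'
  exact disjoint_left.1 hUW e1.1 e2.1

end Reeb

/-! ### Circles in the plane -/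

theorem plane_ext {x y : Plane} (h0 : x 0 = y 0) (h1 : x 1 = y 1) : x = y := by
  ext i; fin_cases i <;> assumption

/-- The signed quadratic function of a circle with centre `P` and radius `r`. -/
def circFun (s : ℝ) (P : Plane) (r : ℝ) (x : Plane) : ℝ :=
  s * ((x 0 - P 0) ^ 2 + (x 1 - P 1) ^ 2 - r ^ 2)

theorem polyFun_circlePoly (P : Plane) (r : ℝ) : polyFun (circlePoly P r) = circFun 1 P r := by
  ext x; simp [polyFun, circlePoly, circFun]

theorem polyFun_neg_circlePoly (P : Plane) (r : ℝ) :
    polyFun (-circlePoly P r) = circFun (-1) P r := by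
  ext x; simp [polyFun, circlePoly, circFun]

/-- `φ` is the function of one of the two defining polynomials of a circle. -/
def IsCircFun (φ : Plane → ℝ) : Prop :=
  ∃ (s : ℝ) (P : Plane) (r : ℝ), 0 < r ∧ (s = 1 ∨ s = -1) ∧ φ = circFun s P r

theorem IsCirclePoly.isCircFun {f : MvPolynomial (Fin 2) ℝ} (h : IsCirclePoly f) :
    IsCircFun (polyFun f) := by
  obtain ⟨p, r, hr, rfl | rfl⟩ := h
  · exact ⟨1, p, r, hr, Or.inl rfl, polyFun_circlePoly p r⟩
  · exact ⟨-1, p, r, hr, Or.inr rfl, polyFun_neg_circlePoly p r⟩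

theorem contDiff_circFun {n : WithTop ℕ∞} (s : ℝ) (P : Plane) (r : ℝ) :
    ContDiff ℝ n (circFun s P r) := by
  unfold circFun; fun_prop

theorem continuous_circFun (s : ℝ) (P : Plane) (r : ℝ) : Continuous (circFun s P r) :=
  (contDiff_circFun (n := 0) s P r).continuous

theorem hasFDerivAt_circFun (s : ℝ) (P : Plane) (r : ℝ) (x : Plane) :
    HasFDerivAt (circFun s P r) ((2 * s * (x 0 - P 0)) • (EuclideanSpace.proj 0 : Plane →L[ℝ] ℝ)
      + (2 * s * (x 1 - P 1)) • (EuclideanSpace.proj 1 : Plane →L[ℝ] ℝ)) x := by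
  have h0 : HasFDerivAt (fun x : Plane => x 0) (EuclideanSpace.proj 0 : Plane →L[ℝ] ℝ) x :=
    (EuclideanSpace.proj 0 : Plane →L[ℝ] ℝ).hasFDerivAt
  have h1 : HasFDerivAt (fun x : Plane => x 1) (EuclideanSpace.proj 1 : Plane →L[ℝ] ℝ) x :=
    (EuclideanSpace.proj 1 : Plane →L[ℝ] ℝ).hasFDerivAt
  have := (((h0.sub_const (P 0)).pow 2).add ((h1.sub_const (P 1)).pow 2)).sub_const (r ^ 2)
    |>.const_mul s
  refine this.congr_fderiv ?_
  ext v
  simp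
  ring

theorem fderiv_circFun (s : ℝ) (P : Plane) (r : ℝ) (x v : Plane) :
    fderiv ℝ (circFun s P r) x v
      = 2 * s * (x 0 - P 0) * v 0 + 2 * s * (x 1 - P 1) * v 1 := by
  rw [(hasFDerivAt_circFun s P r x).fderiv]; simp

/-- The partial derivative of a plane function with respect to the second coordinate, and its
counterpart for the first coordinate, are values of the differential on the basis vectors. -/
theorem fderiv_plane_apply {φ : Plane → ℝ} (x v : Plane) :
    fderiv ℝ φ x v = fderiv ℝ φ x !₂[1, 0] * v 0 + fderiv ℝ φ x !₂[0, 1] * v 1 := by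
  have : v = v 0 • (!₂[1, 0] : Plane) + v 1 • (!₂[0, 1] : Plane) := by
    apply plane_ext <;> simp
  conv_lhs => rw [this]
  rw [map_add, map_smul, map_smul]
  simp [mul_comm]

theorem IsCircFun.contDiff {n : WithTop ℕ∞} {φ : Plane → ℝ} (h : IsCircFun φ) :
    ContDiff ℝ n φ := by
  obtain ⟨s, P, r, -, -, rfl⟩ := h; exact contDiff_circFun s P r

theorem IsCircFun.continuous {φ : Plane → ℝ} (h : IsCircFun φ) : Continuous φ :=
  (h.contDiff (n := 0)).continuous

theorem IsCircFun.differentiable {φ : Plane → ℝ} (h : IsCircFun φ) : Differentiable ℝ φ :=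
  (h.contDiff (n := 1)).differentiable (by simp)

/-- The secant formula along a vertical line. -/
theorem circFun_sub_vertical (s : ℝ) (P : Plane) (r : ℝ) {z w : Plane} (h : z 0 = w 0) :
    circFun s P r w - circFun s P r z = (w 1 - z 1) * (s * (w 1 + z 1 - 2 * P 1)) := by
  simp only [circFun, h]; ring

/-! ### Slices of plane sets -/

/-- Two points lie on the same vertical line, and the segment between them lies in `K`. -/
def SliceRel (K : Set Plane) (x y : Plane) : Prop :=
  x 0 = y 0 ∧ ∀ z : Plane, z 0 = x 0 → z 1 ∈ uIcc (x 1) (y 1) → z ∈ K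

theorem SliceRel.refl {K : Set Plane} {x : Plane} (hx : x ∈ K) : SliceRel K x x :=
  ⟨rfl, fun z h0 h1 => by
    rw [uIcc_self, mem_singleton_iff] at h1
    rwa [plane_ext h0 h1]⟩

theorem SliceRel.symm {K : Set Plane} {x y : Plane} (h : SliceRel K x y) : SliceRel K y x :=
  ⟨h.1.symm, fun z h0 h1 => h.2 z (h0.trans h.1.symm) (by rwa [uIcc_comm])⟩

theorem SliceRel.trans {K : Set Plane} {x y z : Plane} (h : SliceRel K x y)
    (h' : SliceRel K y z) : SliceRel K x z :=
  ⟨h.1.trans h'.1, fun w h0 h1 => by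
    rcases uIcc_subset_uIcc_union_uIcc (b := y 1) h1 with h2 | h2
    · exact h.2 w h0 h2
    · exact h'.2 w (h0.trans h.1) h2⟩

theorem SliceRel.right_mem {K : Set Plane} {x y : Plane} (h : SliceRel K x y) : y ∈ K :=
  h.2 y h.1.symm right_mem_uIcc

theorem SliceRel.mono {K K' : Set Plane} (hK : K ⊆ K') {x y : Plane} (h : SliceRel K x y) :
    SliceRel K' x y := ⟨h.1, fun z h0 h1 => hK (h.2 z h0 h1)⟩

theorem SliceRel.mid {K : Set Plane} {x y z : Plane} (h : SliceRel K x y) (h0 : z 0 = x 0)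
    (h1 : z 1 ∈ uIcc (x 1) (y 1)) : SliceRel K x z :=
  ⟨h0.symm, fun w hw0 hw1 => h.2 w hw0 (uIcc_subset_uIcc_left h1 hw1)⟩

/-- The vertical segment between two points, as an image of an interval. -/
theorem SliceRel.exists_isPreconnected {K : Set Plane} {x y : Plane} (h : SliceRel K x y) :
    ∃ t, IsPreconnected t ∧ x ∈ t ∧ y ∈ t ∧ ∀ z ∈ t, SliceRel K x z := by
  refine ⟨(fun u : ℝ => (!₂[x 0, u] : Plane)) '' uIcc (x 1) (y 1),
    isPreconnected_uIcc.image _ (Continuous.continuousOn (by fun_prop)),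
    ⟨x 1, left_mem_uIcc, plane_ext rfl rfl⟩, ⟨y 1, right_mem_uIcc, plane_ext h.1 rfl⟩, ?_⟩
  rintro _ ⟨u, hu, rfl⟩
  exact h.mid rfl hu

theorem isPreconnected_sliceClass {K : Set Plane} {x : Plane} :
    IsPreconnected {z | SliceRel K x z} := by
  rcases eq_empty_or_nonempty {z | SliceRel K x z} with h0 | ⟨y, hy⟩
  · rw [h0]; exact isPreconnected_empty
  refine isPreconnected_of_forall x fun z hz => ?_
  obtain ⟨t, h1, h2, h3, h4⟩ := SliceRel.exists_isPreconnected hz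
  exact ⟨t, fun w hw => h4 w hw, h2, h3, h1⟩

theorem sliceRel_of_isPreconnected {K B : Set Plane} (hB : IsPreconnected B) (hBK : B ⊆ K)
    {x y : Plane} (hx : x ∈ B) (hy : y ∈ B) (h0 : ∀ z ∈ B, z 0 = x 0) : SliceRel K x y := by
  refine ⟨(h0 y hy).symm, fun z hz0 hz1 => ?_⟩
  have hc : (fun z : Plane => z 1) '' B |>.OrdConnected :=
    (hB.image _ (Continuous.continuousOn (by fun_prop))).ordConnected
  obtain ⟨w, hw, hwz⟩ := hc.uIcc_subset (mem_image_of_mem (fun z : Plane => z 1) hx)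
    (mem_image_of_mem (fun z : Plane => z 1) hy) hz1
  have : z = w := plane_ext (hz0.trans (h0 w hw).symm) hwz.symm
  rw [this]; exact hBK hw

/-! ### Differentials of the defining polynomials -/

namespace MomentData

variable (d : MomentData)

/-- The product of the functions of colour `i`. -/
def prodFun (i : Fin d.l₂) (x : Plane) : ℝ := ∏ j with d.c j = i, polyFun (d.f j) x

/-- The projection to the plane as a linear map. -/
def projL : d.Ambient →L[ℝ] Plane :=
  LinearMap.toContinuousLinearMap
    { toFun := d.proj
      map_add' := fun p q => by apply plane_ext <;> simp [proj]
      map_smul' := fun a p => by apply plane_ext <;> simp [proj] }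

@[simp] theorem projL_apply (p : d.Ambient) : d.projL p = d.proj p := rfl

@[simp] theorem proj_apply (p : d.Ambient) (i : Fin 2) : d.proj p i = p (Sum.inl i) := rfl

theorem polyFun_eqn (i : Fin d.l₂) (p : d.Ambient) :
    polyFun (d.eqn i) p = d.prodFun i (d.proj p) - ∑ k, p (Sum.inr ⟨i, k⟩) ^ 2 := by
  simp only [polyFun, eqn, prodFun, map_sub, map_prod, map_sum, map_pow, MvPolynomial.eval_X,
    MvPolynomial.eval_rename]
  rfl

theorem mem_zeroSet {p : d.Ambient} :
    p ∈ d.zeroSet ↔ ∀ i, d.prodFun i (d.proj p) = ∑ k, p (Sum.inr ⟨i, k⟩) ^ 2 := by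
  simp only [zeroSet, mem_ofPred_eq, polyFun_eqn, sub_eq_zero]

variable {d}

theorem contDiff_prodFun {n : WithTop ℕ∞} (hc : ∀ j, IsCircFun (polyFun (d.f j))) (i : Fin d.l₂) :
    ContDiff ℝ n (d.prodFun i) := by
  unfold prodFun
  exact contDiff_prod fun j _ => (hc j).contDiff

theorem fderiv_eqn (hc : ∀ j, IsCircFun (polyFun (d.f j))) (i : Fin d.l₂) (p v : d.Ambient) :
    fderiv ℝ (polyFun (d.eqn i)) p v
      = fderiv ℝ (d.prodFun i) (d.proj p) (d.proj v)
        - 2 * ∑ k, p (Sum.inr ⟨i, k⟩) * v (Sum.inr ⟨i, k⟩) := by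
  have h1 : HasFDerivAt (d.prodFun i ∘ d.projL)
      ((fderiv ℝ (d.prodFun i) (d.proj p)).comp d.projL) p :=
    HasFDerivAt.comp p ((contDiff_prodFun (n := 1) hc i).differentiable (by simp) _).hasFDerivAt
      d.projL.hasFDerivAt
  have h2 : HasFDerivAt (fun p : d.Ambient => ∑ k : Fin (d.μ i + 1), p (Sum.inr ⟨i, k⟩) ^ 2)
      (∑ k : Fin (d.μ i + 1), (2 * p (Sum.inr ⟨i, k⟩)) •
        (EuclideanSpace.proj (Sum.inr ⟨i, k⟩) : d.Ambient →L[ℝ] ℝ)) p := by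
    apply HasFDerivAt.fun_sum
    intro k _
    have := ((EuclideanSpace.proj (Sum.inr ⟨i, k⟩) : d.Ambient →L[ℝ] ℝ).hasFDerivAt
      (x := p)).pow 2
    refine this.congr_fderiv ?_
    ext v; simp
  have h3 : polyFun (d.eqn i) = fun p => (d.prodFun i ∘ d.projL) p
      - ∑ k : Fin (d.μ i + 1), p (Sum.inr ⟨i, k⟩) ^ 2 := by
    ext p; rw [polyFun_eqn]; rfl
  rw [h3, (h1.fun_sub h2).fderiv]
  simp [sum_apply, Finset.mul_sum, mul_assoc]

theorem fderiv_height (p v : d.Ambient) : fderiv ℝ d.height p v = v (Sum.inl 0) := by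
  have : d.height = (EuclideanSpace.proj (Sum.inl 0) : d.Ambient →L[ℝ] ℝ) := rfl
  rw [this, ContinuousLinearMap.fderiv]; rfl

theorem contDiff_height : ContDiff ℝ ∞ d.height := by
  have : d.height = (EuclideanSpace.proj (Sum.inl 0) : d.Ambient →L[ℝ] ℝ) := rfl
  rw [this]; exact ContinuousLinearMap.contDiff _

/-- At a zero of one factor the Leibniz rule leaves only the term in which this factor is
differentiated. -/
theorem fderiv_prodFun_of_zero (hc : ∀ j, IsCircFun (polyFun (d.f j)))
    {j : Fin d.l₁} {x : Plane} (hj : polyFun (d.f j) x = 0) (v : Plane) :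
    fderiv ℝ (d.prodFun (d.c j)) x v =
      (∏ k ∈ (Finset.univ.filter fun k => d.c k = d.c j).erase j, polyFun (d.f k) x) *
        fderiv ℝ (polyFun (d.f j)) x v := by
  have h : HasFDerivAt (d.prodFun (d.c j)) _ x :=
    HasFDerivAt.finsetProd (u := Finset.univ.filter fun k => d.c k = d.c j)
      (g := fun k => polyFun (d.f k)) fun k _ => ((hc k).differentiable x).hasFDerivAt
  rw [h.fderiv, sum_apply, Finset.sum_eq_single_of_mem j (by simp)]
  · simp
  · intro k hk hkj
    rw [smul_apply, Finset.prod_eq_zero (i := j) (by simp [Ne.symm hkj]) hj,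
      zero_smul]

/-- At a point of the closure of `D` on the curve of index `j`, the other factors of the same
colour do not vanish. -/
theorem IsAdmissible.prod_erase_ne_zero (h : d.IsAdmissible) {j : Fin d.l₁} {x : Plane}
    (hx : x ∈ closure d.D) (hj : polyFun (d.f j) x = 0) :
    ∏ k ∈ (Finset.univ.filter fun k => d.c k = d.c j).erase j, polyFun (d.f k) x ≠ 0 := by
  rw [Finset.prod_ne_zero_iff]
  intro k hk hk0
  rw [Finset.mem_erase, Finset.mem_filter] at hk
  have := h.injOn {j, k} ⟨x, hx, by
    intro i hi
    rcases Finset.mem_insert.1 hi with rfl | hi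
    · exact hj
    · rw [Finset.mem_singleton.1 hi]; exact hk0⟩
  exact hk.1 (this (by simp) (by simp) hk.2.2)

theorem prodFun_eq_zero_iff {i : Fin d.l₂} {x : Plane} :
    d.prodFun i x = 0 ↔ ∃ j, d.c j = i ∧ polyFun (d.f j) x = 0 := by
  simp [prodFun, Finset.prod_eq_zero_iff]

/-- Two curves that meet at a point of the closure have independent differentials. -/
theorem IsAdmissible.eq_zero_of_fderiv (h : d.IsAdmissible) {j k : Fin d.l₁} (hjk : j ≠ k)
    {x : Plane} (hx : x ∈ closure d.D) (hj : polyFun (d.f j) x = 0) (hk : polyFun (d.f k) x = 0)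
    {v : Plane} (hvj : fderiv ℝ (polyFun (d.f j)) x v = 0)
    (hvk : fderiv ℝ (polyFun (d.f k)) x v = 0) : v = 0 := by
  have := h.transversal {j, k} (by simp) x hx (by
    intro i hi
    rcases Finset.mem_insert.1 hi with rfl | hi
    · exact hj
    · rw [Finset.mem_singleton.1 hi]; exact hk)
  rw [Finset.card_pair hjk] at this
  have h0 : Module.finrank ℝ (⨅ i ∈ ({j, k} : Finset (Fin d.l₁)),
    (fderiv ℝ (polyFun (d.f i)) x).ker : Submodule ℝ Plane) = 0 := by omega
  have h1 := Submodule.finrank_eq_zero.1 h0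
  rw [← Submodule.mem_bot ℝ, ← h1]
  simp only [Submodule.mem_iInf]
  intro i hi
  rcases Finset.mem_insert.1 hi with rfl | hi
  · exact hvj
  · rw [Finset.mem_singleton.1 hi]; exact hvk

theorem IsAdmissible.not_three (h : d.IsAdmissible) {j k l : Fin d.l₁} (hjk : j ≠ k) (hjl : j ≠ l)
    (hkl : k ≠ l) {x : Plane} (hx : x ∈ closure d.D) (hj : polyFun (d.f j) x = 0)
    (hk : polyFun (d.f k) x = 0) (hl : polyFun (d.f l) x = 0) : False := by
  have := h.transversal {j, k, l} (by simp) x hx (by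
    intro i hi
    simp only [Finset.mem_insert, Finset.mem_singleton] at hi
    rcases hi with rfl | rfl | rfl <;> assumption)
  rw [Finset.card_eq_three.2 ⟨j, k, l, hjk, hjl, hkl, rfl⟩] at this
  omega

/-- Dual vectors for the differentials of the curves through a point of the closure. -/
theorem IsAdmissible.exists_dual (h : d.IsAdmissible) {j : Fin d.l₁}
    {x : Plane} (hx : x ∈ closure d.D) (hj : polyFun (d.f j) x = 0) :
    ∃ v, fderiv ℝ (polyFun (d.f j)) x v = 1 ∧
      ∀ k, k ≠ j → polyFun (d.f k) x = 0 → fderiv ℝ (polyFun (d.f k)) x v = 0 := by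
  suffices ∃ v, fderiv ℝ (polyFun (d.f j)) x v ≠ 0 ∧
      ∀ k, k ≠ j → polyFun (d.f k) x = 0 → fderiv ℝ (polyFun (d.f k)) x v = 0 by
    obtain ⟨v, hv, hv'⟩ := this
    refine ⟨(fderiv ℝ (polyFun (d.f j)) x v)⁻¹ • v, ?_, fun k hk hk0 => ?_⟩
    · rw [map_smul, smul_eq_mul, inv_mul_cancel₀ hv]
    · rw [map_smul, hv' k hk hk0, smul_zero]
  by_cases hex : ∃ k, k ≠ j ∧ polyFun (d.f k) x = 0
  · obtain ⟨k, hkj, hk⟩ := hex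
    set D := fderiv ℝ (polyFun (d.f k)) x with hD
    -- The gradient of the second curve turned by a right angle: it is tangent to that curve, and
    -- transversality keeps it from being tangent to the first one.
    let v : Plane := !₂[-D !₂[0, 1], D !₂[1, 0]]
    have hv : D v = 0 := by
      rw [hD, fderiv_plane_apply x v]; simp [v, ← hD]; ring
    refine ⟨v, ?_, ?_⟩
    · intro hjv
      have hv0 := h.eq_zero_of_fderiv hkj hx hk hj hv hjv
      have e0 : v 0 = 0 := by rw [hv0]; rfl
      have e1 : v 1 = 0 := by rw [hv0]; rfl
      apply h.curve_nonsingular k x hk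
      ext w
      rw [fderiv_plane_apply x w, ← hD]
      simp [v] at e0 e1
      simp [e0, e1]
    · intro l hlj hl
      by_cases hlk : l = k
      · rw [hlk]; exact hv
      · exact (h.not_three hlj hlk (Ne.symm hkj) hx hl hj hk).elim
  · push Not at hex
    have := h.curve_nonsingular j x hj
    obtain ⟨v, hv⟩ : ∃ v, fderiv ℝ (polyFun (d.f j)) x v ≠ 0 := by
      by_contra hcon
      push Not at hcon
      exact this (ContinuousLinearMap.ext hcon)
    exact ⟨v, hv, fun k hk hk0 => (hex k hk hk0).elim⟩

/-- Every plane vector lifts to a vector that annihilates the equations of the colours without a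
curve through the point. -/
theorem exists_lift_vector (hc : ∀ j, IsCircFun (polyFun (d.f j))) {p : d.Ambient}
    (hp : p ∈ d.zeroSet) (v : Plane) :
    ∃ V : d.Ambient, d.proj V = v ∧
      (∀ i, d.prodFun i (d.proj p) ≠ 0 → fderiv ℝ (polyFun (d.eqn i)) p V = 0) ∧
      (∀ i, d.prodFun i (d.proj p) = 0 →
        fderiv ℝ (polyFun (d.eqn i)) p V = fderiv ℝ (d.prodFun i) (d.proj p) v) := by
  classical
  -- The fibre coordinates are rescaled at the rate at which their squared norm, the product, has to
  -- change along `v`. Where the product is zero, division by zero yields zero, which is the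
  -- intended value.
  let V : d.Ambient := WithLp.toLp 2 (Sum.elim (fun i => v i) fun ik =>
    fderiv ℝ (d.prodFun ik.1) (d.proj p) v / (2 * d.prodFun ik.1 (d.proj p)) * p (Sum.inr ik))
  have hV : d.proj V = v := by apply plane_ext <;> rfl
  refine ⟨V, hV, fun i hi => ?_, fun i hi => ?_⟩
  · rw [fderiv_eqn hc, hV]
    have : ∑ k, p (Sum.inr ⟨i, k⟩) * V (Sum.inr ⟨i, k⟩) =
        fderiv ℝ (d.prodFun i) (d.proj p) v / (2 * d.prodFun i (d.proj p)) *
          ∑ k, p (Sum.inr ⟨i, k⟩) ^ 2 := by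
      rw [Finset.mul_sum]
      refine Finset.sum_congr rfl fun k _ => ?_
      simp [V]; ring
    rw [this, ← d.mem_zeroSet.1 hp i]
    field_simp
    ring
  · rw [fderiv_eqn hc, hV]
    have h0 : ∀ k, p (Sum.inr ⟨i, k⟩) = 0 := by
      have := d.mem_zeroSet.1 hp i
      rw [hi] at this
      intro k
      have := (Finset.sum_eq_zero_iff_of_nonneg (fun k _ => sq_nonneg _)).1 this.symm k
        (Finset.mem_univ k)
      simpa using this
    simp [h0]

variable (d) in
/-- The points of the closure of `D` over which there are singular points of the height. -/
def sing : Set Plane :=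
  {x | x ∈ closure d.D ∧ ∀ v : Plane,
    (∀ j, polyFun (d.f j) x = 0 → fderiv ℝ (polyFun (d.f j)) x v = 0) → v 0 = 0}

/-- Over a curve of colour `i` the squared norm of the fibre coordinates of this colour is zero, so
the fibre part of the differential drops out. -/
theorem fderiv_eqn_of_zero (hc : ∀ j, IsCircFun (polyFun (d.f j))) {p : d.Ambient}
    (hp : p ∈ d.zeroSet) {j : Fin d.l₁} (hj : polyFun (d.f j) (d.proj p) = 0) (V : d.Ambient) :
    fderiv ℝ (polyFun (d.eqn (d.c j))) p V =
      (∏ k ∈ (Finset.univ.filter fun k => d.c k = d.c j).erase j, polyFun (d.f k) (d.proj p)) *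
        fderiv ℝ (polyFun (d.f j)) (d.proj p) (d.proj V) := by
  have h0 : ∀ k, p (Sum.inr ⟨d.c j, k⟩) = 0 := by
    have := d.mem_zeroSet.1 hp (d.c j)
    rw [prodFun_eq_zero_iff.2 ⟨j, rfl, hj⟩] at this
    intro k
    have := (Finset.sum_eq_zero_iff_of_nonneg (fun k _ => sq_nonneg _)).1 this.symm k
      (Finset.mem_univ k)
    simpa using this
  rw [fderiv_eqn hc, fderiv_prodFun_of_zero hc hj]
  simp [h0]

theorem mem_tangent {p V : d.Ambient} :
    V ∈ d.tangent p ↔ ∀ i, fderiv ℝ (polyFun (d.eqn i)) p V = 0 := by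
  simp [tangent, Submodule.mem_iInf]

/-- Colours without a curve through the point put no condition on the plane part of a tangent
vector, since the fibre coordinates compensate. The other colours contribute the differentials of
the curves, up to nonzero factors. Thus the plane parts of tangent vectors form the common kernel of
the differentials of the curves through the point. -/
theorem IsAdmissible.mem_singularPoints_iff (h : d.IsAdmissible)
    (hc : ∀ j, IsCircFun (polyFun (d.f j))) {p : d.Ambient} (hp : p ∈ d.manifold) :
    p ∈ singularPoints d.manifold d.tangent d.height ↔ d.proj p ∈ d.sing := by
  constructor
  · rintro ⟨-, hs⟩
    refine ⟨hp.1, fun v hv => ?_⟩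
    obtain ⟨V, hV, h1, h2⟩ := exists_lift_vector hc hp.2 v
    have := hs V (mem_tangent.2 fun i => by
      by_cases hi : d.prodFun i (d.proj p) = 0
      · obtain ⟨j, rfl, hj⟩ := prodFun_eq_zero_iff.1 hi
        rw [fderiv_eqn_of_zero hc hp.2 hj, hV, hv j hj, mul_zero]
      · exact h1 i hi)
    rw [fderiv_height] at this
    rw [← hV]; exact this
  · rintro ⟨-, hs⟩
    refine ⟨hp, fun V hV => ?_⟩
    rw [fderiv_height]
    apply hs (d.proj V)
    intro j hj
    have := mem_tangent.1 hV (d.c j)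
    rw [fderiv_eqn_of_zero hc hp.2 hj] at this
    exact (mul_eq_zero.1 this).resolve_left (h.prod_erase_ne_zero hp.1 hj)

/-- A linear relation is tested on a lift of a vector dual to one curve if the product of the colour
vanishes at the point, and on the radial fibre vector of the colour otherwise. -/
theorem IsAdmissible.isNonsingular (h : d.IsAdmissible)
    (hc : ∀ j, IsCircFun (polyFun (d.f j))) : d.IsNonsingular := by
  classical
  intro p hp
  rw [Fintype.linearIndependent_iff]
  intro a ha i
  have ha' : ∀ V, ∑ i, a i * fderiv ℝ (polyFun (d.eqn i)) p V = 0 := fun V => by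
    have := congrArg (fun L : d.Ambient →L[ℝ] ℝ => L V) ha
    simpa [sum_apply] using this
  by_cases hi : d.prodFun i (d.proj p) = 0
  · obtain ⟨j, rfl, hj⟩ := prodFun_eq_zero_iff.1 hi
    obtain ⟨v, hv1, hv2⟩ := h.exists_dual hp.1 hj
    obtain ⟨V, hV, h1, h2⟩ := exists_lift_vector hc hp.2 v
    have := ha' V
    rw [Finset.sum_eq_single_of_mem (d.c j) (Finset.mem_univ _)] at this
    · rw [fderiv_eqn_of_zero hc hp.2 hj, hV, hv1, mul_one] at this
      exact (mul_eq_zero.1 this).resolve_right (h.prod_erase_ne_zero hp.1 hj)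
    · intro i _ hij
      by_cases hi : d.prodFun i (d.proj p) = 0
      · obtain ⟨k, rfl, hk⟩ := prodFun_eq_zero_iff.1 hi
        have hkj : k ≠ j := fun h => hij (by rw [h])
        rw [fderiv_eqn_of_zero hc hp.2 hk, hV, hv2 k hkj hk, mul_zero, mul_zero]
      · rw [h1 i hi, mul_zero]
  · let V : d.Ambient := WithLp.toLp 2 (Sum.elim 0 fun ik =>
      if ik.1 = i then p (Sum.inr ik) else 0)
    have hV : d.proj V = 0 := by apply plane_ext <;> rfl
    have := ha' V
    rw [Finset.sum_eq_single_of_mem i (Finset.mem_univ _)] at this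
    · have h2 : fderiv ℝ (polyFun (d.eqn i)) p V = - 2 * d.prodFun i (d.proj p) := by
        rw [fderiv_eqn hc, hV, d.mem_zeroSet.1 hp.2 i]
        simp [V, pow_two]
      rw [h2] at this
      rcases mul_eq_zero.1 this with h | h
      · exact h
      · exact (hi (by linarith)).elim
    · intro i' _ hi'
      rw [fderiv_eqn hc, hV]
      simp [V, hi']

end MomentData

namespace MomentData

variable {d : MomentData}

/-! ### The manifold as an image of a product with spheres -/

variable (d) in
/-- The product of the unit spheres of the fibre coordinates. -/
def spheres : Set (∀ i : Fin d.l₂, EuclideanSpace ℝ (Fin (d.μ i + 1))) :=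
  univ.pi fun _ => Metric.sphere 0 1

variable (d) in
/-- The point over `x` whose fibre coordinates point in the directions `u`. -/
def lift (x : Plane) (u : ∀ i : Fin d.l₂, EuclideanSpace ℝ (Fin (d.μ i + 1))) : d.Ambient :=
  WithLp.toLp 2 (Sum.elim (fun i => x i) fun ik => √(d.prodFun ik.1 x) * u ik.1 ik.2)

@[simp] theorem proj_lift (x : Plane) (u) : d.proj (d.lift x u) = x := by
  apply plane_ext <;> rfl

theorem sum_sq_of_mem_sphere {k : ℕ} {y : EuclideanSpace ℝ (Fin k)}
    (h : y ∈ Metric.sphere (0 : EuclideanSpace ℝ (Fin k)) 1) : ∑ i, y i ^ 2 = 1 := by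
  rw [mem_sphere_zero_iff_norm] at h
  rw [← EuclideanSpace.real_norm_sq_eq, h, one_pow]

theorem prodFun_nonneg {x : Plane} (hx : ∀ j, 0 ≤ polyFun (d.f j) x) (i : Fin d.l₂) :
    0 ≤ d.prodFun i x := Finset.prod_nonneg fun j _ => hx j

theorem lift_mem_zeroSet {x : Plane} (hx : ∀ i, 0 ≤ d.prodFun i x) {u} (hu : u ∈ d.spheres) :
    d.lift x u ∈ d.zeroSet := by
  rw [mem_zeroSet]
  intro i
  rw [proj_lift]
  simp only [lift, Sum.elim_inr, mul_pow, Real.sq_sqrt (hx i), ← Finset.mul_sum,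
    sum_sq_of_mem_sphere (hu i trivial), mul_one]

theorem exists_eq_lift {p : d.Ambient} (hp : p ∈ d.zeroSet) :
    ∃ u ∈ d.spheres, p = d.lift (d.proj p) u := by
  classical
  let y : ∀ i : Fin d.l₂, EuclideanSpace ℝ (Fin (d.μ i + 1)) := fun i =>
    WithLp.toLp 2 fun k => p (Sum.inr ⟨i, k⟩)
  have hy : ∀ i, √(d.prodFun i (d.proj p)) = ‖y i‖ := fun i => by
    rw [d.mem_zeroSet.1 hp i, EuclideanSpace.norm_eq]
    simp [y]
  -- Polar coordinates. Where the fibre coordinates vanish the direction does not matter, and a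
  -- fixed unit vector is taken.
  let u : ∀ i : Fin d.l₂, EuclideanSpace ℝ (Fin (d.μ i + 1)) := fun i =>
    if y i = 0 then EuclideanSpace.single 0 1 else ‖y i‖⁻¹ • y i
  refine ⟨u, fun i _ => ?_, ?_⟩
  · rw [mem_sphere_zero_iff_norm]
    by_cases h : y i = 0
    · simp [u, h]
    · simp only [u, h, if_false]
      rw [norm_smul, norm_inv, norm_norm, inv_mul_cancel₀ (norm_ne_zero_iff.2 h)]
  · have key : ∀ i, ‖y i‖ • u i = y i := fun i => by
      by_cases h : y i = 0
      · simp [h]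
      · simp only [u, h, if_false]
        rw [smul_smul, mul_inv_cancel₀ (norm_ne_zero_iff.2 h), one_smul]
    ext ik
    rcases ik with i | ⟨i, k⟩
    · rfl
    · have := congrArg (fun w : EuclideanSpace ℝ (Fin (d.μ i + 1)) => w k) (key i)
      simp only [lift, Sum.elim_inr, hy]
      simpa [y] using this.symm

theorem continuous_lift (hc : ∀ j, IsCircFun (polyFun (d.f j))) :
    Continuous fun q : Plane × (∀ i : Fin d.l₂, EuclideanSpace ℝ (Fin (d.μ i + 1))) =>
      d.lift q.1 q.2 := by
  have hF : ∀ i, Continuous (d.prodFun i) := fun i => (contDiff_prodFun (n := 0) hc i).continuous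
  refine (PiLp.continuous_toLp 2 _).comp (continuous_pi fun ik => ?_)
  rcases ik with i | ⟨i, k⟩
  · simp only [Sum.elim_inl]; fun_prop
  · simp only [Sum.elim_inr]
    have := hF i
    fun_prop

variable (d) in
/-- A fixed choice of directions in the fibres. -/
def dir (i : Fin d.l₂) : EuclideanSpace ℝ (Fin (d.μ i + 1)) := EuclideanSpace.single 0 1

theorem dir_mem : d.dir ∈ d.spheres := fun i _ => by simp [dir]

theorem isCompact_spheres : IsCompact d.spheres :=
  isCompact_univ_pi fun _ => isCompact_sphere _ _

variable (d) in
/-- Data over a plane region bounded by circles, with `D` the set on which all functions are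
positive, such that all spheres are connected except possibly the one of the colour `i₀`, and each
vertical slice contains a zero of the product of that colour. -/
structure IsGood (i₀ : Fin d.l₂) : Prop where
  adm : d.IsAdmissible
  circ : ∀ j, IsCircFun (polyFun (d.f j))
  region : d.D = {x | ∀ j, 0 < polyFun (d.f j) x}
  closure_region : closure d.D = {x | ∀ j, 0 ≤ polyFun (d.f j) x}
  finite_inter : ∀ i j, i ≠ j → (curve (d.f i) ∩ curve (d.f j)).Finite
  exists_zero : ∀ x ∈ closure d.D, ∃ z, SliceRel (closure d.D) x z ∧ d.prodFun i₀ z = 0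
  pos : ∀ i, i ≠ i₀ → 0 < d.μ i

namespace IsGood

variable {i₀ : Fin d.l₂} (h : d.IsGood i₀)

include h

theorem mem_closure {x : Plane} : x ∈ closure d.D ↔ ∀ j, 0 ≤ polyFun (d.f j) x := by
  rw [h.closure_region]; rfl

theorem lift_mem {x : Plane} (hx : x ∈ closure d.D) {u} (hu : u ∈ d.spheres) :
    d.lift x u ∈ d.manifold :=
  ⟨by rwa [proj_lift], lift_mem_zeroSet (prodFun_nonneg (h.mem_closure.1 hx)) hu⟩

theorem manifold_eq_image :
    d.manifold = (fun q : Plane × _ => d.lift q.1 q.2) '' (closure d.D ×ˢ d.spheres) := by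
  ext p
  constructor
  · intro hp
    obtain ⟨u, hu, hpu⟩ := exists_eq_lift hp.2
    exact ⟨(d.proj p, u), ⟨hp.1, hu⟩, hpu.symm⟩
  · rintro ⟨⟨x, u⟩, ⟨hx, hu⟩, rfl⟩
    exact h.lift_mem hx hu

theorem isCompact_manifold : IsCompact d.manifold := by
  rw [h.manifold_eq_image]
  exact (h.adm.isCompact_closure.prod isCompact_spheres).image (continuous_lift h.circ)

/-- The sphere of colour `i₀` may consist of two points, but over `z` it is contracted. For each of
its directions the lift of `A` times the remaining, connected spheres is connected, and all these
pieces share a point over `z`. -/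
theorem isPreconnected_over {A : Set Plane} (hA : IsPreconnected A) (hAK : A ⊆ closure d.D)
    {z : Plane} (hz : z ∈ A) (hz0 : d.prodFun i₀ z = 0) :
    IsPreconnected {p | p ∈ d.manifold ∧ d.proj p ∈ A} := by
  classical
  let S : EuclideanSpace ℝ (Fin (d.μ i₀ + 1)) →
      Set (∀ i : Fin d.l₂, EuclideanSpace ℝ (Fin (d.μ i + 1))) := fun w =>
    univ.pi (Function.update (fun _ => Metric.sphere 0 1) i₀ {w})
  let u₀ : ∀ i : Fin d.l₂, EuclideanSpace ℝ (Fin (d.μ i + 1)) := fun i =>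
    EuclideanSpace.single 0 1
  have hu₀ : ∀ i, u₀ i ∈ Metric.sphere (0 : EuclideanSpace ℝ (Fin (d.μ i + 1))) 1 := fun i => by
    simp [u₀]
  have hS : ∀ w, IsPreconnected (S w) := fun w => by
    refine isPreconnected_univ_pi fun i => ?_
    by_cases hi : i = i₀
    · subst hi; rw [Function.update_self]; exact isPreconnected_singleton
    · rw [Function.update_of_ne hi]
      apply isPreconnected_sphere
      have := h.pos i hi
      rw [← Module.finrank_eq_rank, finrank_euclideanSpace, Fintype.card_fin]
      exact_mod_cast (by omega : 1 < d.μ i + 1)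
  have hmemS : ∀ u ∈ d.spheres, u ∈ S (u i₀) := fun u hu i _ => by
    by_cases hi : i = i₀
    · subst hi; rw [Function.update_self]; rfl
    · rw [Function.update_of_ne hi]; exact hu i trivial
  have hSs : ∀ w ∈ Metric.sphere (0 : EuclideanSpace ℝ (Fin (d.μ i₀ + 1))) 1,
      S w ⊆ d.spheres := fun w hw u hu i _ => by
    have := hu i trivial
    by_cases hi : i = i₀
    · subst hi; rw [Function.update_self] at this; rw [mem_singleton_iff.1 this]; exact hw
    · rwa [Function.update_of_ne hi] at this
  have heq : {p | p ∈ d.manifold ∧ d.proj p ∈ A} =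
      ⋃ w ∈ Metric.sphere (0 : EuclideanSpace ℝ (Fin (d.μ i₀ + 1))) 1,
        (fun q : Plane × _ => d.lift q.1 q.2) '' (A ×ˢ S w) := by
    ext p
    simp only [mem_iUnion₂]
    constructor
    · rintro ⟨hp, hpA⟩
      obtain ⟨u, hu, hpu⟩ := exists_eq_lift hp.2
      exact ⟨u i₀, hu i₀ trivial, (d.proj p, u), ⟨hpA, hmemS u hu⟩, hpu.symm⟩
    · rintro ⟨w, hw, ⟨x, u⟩, ⟨hx, hu⟩, rfl⟩
      exact ⟨h.lift_mem (hAK hx) (hSs w hw hu), by rw [proj_lift]; exact hx⟩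
  rw [heq, ← sUnion_image]
  refine isPreconnected_sUnion (d.lift z u₀) _ (forall_mem_image.2 fun w hw => ?_)
    (forall_mem_image.2 fun w hw => (hA.prod (hS w)).image _ (continuous_lift h.circ).continuousOn)
  -- The direction `w` is multiplied by the root of the product at `z`, which is zero, so the lifted
  -- point does not depend on `w`.
  refine ⟨(z, Function.update u₀ i₀ w), ⟨hz, fun i _ => ?_⟩, ?_⟩
  · by_cases hi : i = i₀
    · subst hi; rw [Function.update_self]; simp
    · simp only [Function.update_of_ne hi]; exact hu₀ i
  · ext ik
    rcases ik with i | ⟨i, k⟩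
    · rfl
    · simp only [lift, Sum.elim_inr]
      by_cases hi : i = i₀
      · subst hi; rw [hz0]; simp
      · rw [Function.update_of_ne hi]

theorem isConnected_manifold : IsConnected d.manifold := by
  obtain ⟨x, hx⟩ := h.adm.isConnected.nonempty.closure
  obtain ⟨z, hz, hz0⟩ := h.exists_zero x hx
  have h1 := h.isPreconnected_over h.adm.isConnected.2.closure Subset.rfl hz.right_mem hz0
  have h2 : {p | p ∈ d.manifold ∧ d.proj p ∈ closure d.D} = d.manifold := by
    ext p; exact ⟨fun hp => hp.1, fun hp => ⟨hp, hp.1⟩⟩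
  rw [h2] at h1
  refine ⟨⟨d.lift x fun i => EuclideanSpace.single 0 1, h.lift_mem hx fun i _ => ?_⟩, h1⟩
  simp

/-! ### The Reeb space of the height as a quotient of the plane region -/

omit h in
theorem continuous_heightOn : Continuous d.heightOn :=
  (contDiff_height (d := d)).continuous.comp continuous_subtype_val

/-- A component of a level set projects to a connected subset of a vertical line. Conversely, the
slice through a point contains a zero of colour `i₀`, so that the part of the manifold over the
slice is connected and has constant height. -/
theorem reebMap_eq_iff_sliceRel (p q : d.manifold) :
    reebMap d.heightOn p = reebMap d.heightOn q ↔
      SliceRel (closure d.D) (d.proj p) (d.proj q) := by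
  constructor
  · intro hpq
    have hq := mem_fibreComponent_of_reebMap_eq hpq
    set C := connectedComponentIn (d.heightOn ⁻¹' {d.heightOn p}) p with hC
    have hcont : Continuous fun p : d.manifold => d.proj p :=
      d.projL.continuous.comp continuous_subtype_val
    refine sliceRel_of_isPreconnected
      (B := (fun p : d.manifold => d.proj p) '' C)
      (isPreconnected_connectedComponentIn.image _ hcont.continuousOn) ?_
      ⟨p, mem_fibreComponent p, rfl⟩ ⟨q, hq, rfl⟩ ?_
    · rintro _ ⟨w, -, rfl⟩; exact w.2.1
    · rintro _ ⟨w, hw, rfl⟩; exact connectedComponentIn_subset (d.heightOn ⁻¹' {d.heightOn p}) p hw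
  · intro hs
    obtain ⟨z, hz, hz0⟩ := h.exists_zero _ p.2.1
    have h1 := h.isPreconnected_over (A := {z | SliceRel (closure d.D) (d.proj p) z})
      isPreconnected_sliceClass (fun w hw => SliceRel.right_mem hw) hz hz0
    have h2 : IsPreconnected {q : d.manifold | SliceRel (closure d.D) (d.proj p) (d.proj q)} := by
      rw [← IsInducing.subtypeVal.isPreconnected_image]
      convert h1 using 1
      ext w
      constructor
      · rintro ⟨w, hw, rfl⟩; exact ⟨w.2, hw⟩
      · rintro ⟨hw, hw'⟩; exact ⟨⟨w, hw⟩, hw', rfl⟩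
    exact reebMap_eq_of_isPreconnected h2 (SliceRel.refl p.2.1) hs fun w hw => hw.1.symm

/-- A point of the manifold over each point of the closure. -/
def point {x : Plane} (hx : x ∈ closure d.D) : d.manifold := ⟨d.lift x d.dir, h.lift_mem hx dir_mem⟩

theorem proj_point {x : Plane} (hx : x ∈ closure d.D) : d.proj (h.point hx) = x := proj_lift _ _

theorem nonempty_closure : (closure d.D).Nonempty := h.adm.isConnected.nonempty.closure

open Classical in
/-- The class in the Reeb space of a point of the closure of `D` (a fixed class elsewhere). -/
def cls (x : Plane) : d.Reeb :=
  if hx : x ∈ closure d.D then reebMap d.heightOn (h.point hx)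
  else reebMap d.heightOn (h.point h.nonempty_closure.some_mem)

theorem cls_of_mem {x : Plane} (hx : x ∈ closure d.D) :
    h.cls x = reebMap d.heightOn (h.point hx) := dif_pos hx

theorem cls_proj (p : d.manifold) : h.cls (d.proj p) = reebMap d.heightOn p := by
  rw [h.cls_of_mem p.2.1, h.reebMap_eq_iff_sliceRel, h.proj_point]
  exact SliceRel.refl p.2.1

theorem cls_eq_iff {x y : Plane} (hx : x ∈ closure d.D) (hy : y ∈ closure d.D) :
    h.cls x = h.cls y ↔ SliceRel (closure d.D) x y := by
  rw [h.cls_of_mem hx, h.cls_of_mem hy, h.reebMap_eq_iff_sliceRel, h.proj_point, h.proj_point]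

theorem exists_cls (c : d.Reeb) : ∃ x ∈ closure d.D, h.cls x = c := by
  obtain ⟨p, rfl⟩ := surjective_reebMap c
  exact ⟨d.proj p, p.2.1, h.cls_proj p⟩

theorem reebHeight_cls {x : Plane} (hx : x ∈ closure d.D) : reebHeight d.heightOn (h.cls x) = x 0 := by
  rw [h.cls_of_mem hx, reebHeight_reebMap]
  rfl

theorem continuousOn_cls : ContinuousOn h.cls (closure d.D) := by
  rw [continuousOn_iff_continuous_domRestrict]
  have : (closure d.D).domRestrict h.cls = fun x => reebMap d.heightOn (h.point x.2) := by
    ext x; exact h.cls_of_mem x.2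
  rw [this]
  refine continuous_reebMap.comp (Continuous.subtype_mk ?_ _)
  exact (continuous_lift h.circ).comp (f := fun x : closure d.D => ((x : Plane), d.dir))
    (continuous_subtype_val.prodMk continuous_const)

theorem compactSpace_manifold : CompactSpace d.manifold :=
  isCompact_iff_compactSpace.1 h.isCompact_manifold

theorem compactSpace_reeb : CompactSpace d.Reeb :=
  have := h.compactSpace_manifold
  inferInstance

theorem t2Space_reeb : T2Space d.Reeb :=
  have := h.compactSpace_manifold
  t2Space_reebSpace continuous_heightOn

theorem isClosed_cls_image {C : Set Plane} (hC : IsClosed C) (hCK : C ⊆ closure d.D) :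
    IsClosed (h.cls '' C) :=
  have := h.t2Space_reeb
  ((h.adm.isCompact_closure.of_isClosed_subset hC hCK).image_of_continuousOn
    (h.continuousOn_cls.mono hCK)).isClosed

/-- The image of a saturated relatively open set is open. -/
theorem isOpen_cls_image {O : Set Plane} (hO : IsOpen O)
    (hsat : ∀ x ∈ O, ∀ y, SliceRel (closure d.D) x y → y ∈ O) :
    IsOpen (h.cls '' (O ∩ closure d.D)) := by
  have h1 := h.isClosed_cls_image (isClosed_closure.sdiff hO) sdiff_subset
  have h2 : h.cls '' (O ∩ closure d.D) = (h.cls '' (closure d.D \ O))ᶜ := by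
    ext c
    constructor
    · rintro ⟨x, ⟨hxO, hx⟩, rfl⟩ ⟨y, ⟨hy, hyO⟩, hyx⟩
      exact hyO (hsat x hxO y ((h.cls_eq_iff hx hy).1 hyx.symm))
    · intro hc
      obtain ⟨x, hx, rfl⟩ := h.exists_cls c
      refine ⟨x, ⟨?_, hx⟩, rfl⟩
      by_contra hxO
      exact hc ⟨x, ⟨hx, hxO⟩, rfl⟩
  rw [h2]; exact h1.isOpen_compl

/-- The classes whose slices lie in an open set form an open set. -/
theorem isOpen_cls_subset {O : Set Plane} (hO : IsOpen O) :
    IsOpen {c | ∀ x ∈ closure d.D, h.cls x = c → x ∈ O} := by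
  have h1 := h.isClosed_cls_image (isClosed_closure.sdiff hO) sdiff_subset
  convert h1.isOpen_compl using 1
  ext c
  constructor
  · rintro hc ⟨x, ⟨hx, hxO⟩, rfl⟩
    exact hxO (hc x hx rfl)
  · rintro hc x hx rfl
    by_contra hxO
    exact hc ⟨x, ⟨hx, hxO⟩, rfl⟩

theorem vertices_eq : d.vertices = h.cls '' d.sing := by
  ext c
  constructor
  · rintro ⟨p, hp, rfl⟩
    exact ⟨d.proj p, (h.adm.mem_singularPoints_iff h.circ p.2).1 hp, h.cls_proj p⟩
  · rintro ⟨x, hx, rfl⟩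
    refine ⟨h.point hx.1, ?_, (h.cls_of_mem hx.1).symm⟩
    refine (h.adm.mem_singularPoints_iff h.circ (h.point hx.1).2).2 ?_
    rw [h.proj_point]; exact hx

end IsGood

end MomentData

/-! ### The Reeb graph of good data -/

theorem finite_circFun_extreme {φ : Plane → ℝ} (h : IsCircFun φ) :
    {x : Plane | φ x = 0 ∧ fderiv ℝ φ x !₂[0, 1] = 0}.Finite := by
  obtain ⟨s, P, r, hr, hs, rfl⟩ := h
  have hs0 : s ≠ 0 := by rcases hs with rfl | rfl <;> norm_num
  refine ((finite_singleton (!₂[P 0 - r, P 1] : Plane)).union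
    (finite_singleton (!₂[P 0 + r, P 1] : Plane))).subset ?_
  rintro x ⟨h0, h1⟩
  rw [fderiv_circFun] at h1
  simp [hs0] at h1
  have h1' : x 1 = P 1 := by linarith
  simp [circFun, hs0, h1'] at h0
  have : (x 0 - P 0 - r) * (x 0 - P 0 + r) = 0 := by linarith [h0]
  rcases mul_eq_zero.1 this with h | h
  · right; exact plane_ext (by simp; linarith) h1'
  · left; exact plane_ext (by simp; linarith) h1'

namespace MomentData

variable {d : MomentData}

/-- If the tangent of the curve were vertical, all tangent vectors would have first coordinate zero
and the point would be singular. -/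
theorem fderiv_ne_zero_of_not_sing (h : d.IsAdmissible) {x : Plane} (hx : x ∈ closure d.D)
    (hs : x ∉ d.sing) {j : Fin d.l₁} (hj : polyFun (d.f j) x = 0) :
    fderiv ℝ (polyFun (d.f j)) x !₂[0, 1] ≠ 0 := by
  intro h0
  apply hs
  refine ⟨hx, fun v hv => ?_⟩
  have h1 := hv j hj
  rw [fderiv_plane_apply, h0, zero_mul, add_zero] at h1
  refine (mul_eq_zero.1 h1).resolve_left fun h2 => h.curve_nonsingular j x hj ?_
  ext w
  rw [fderiv_plane_apply, h0, h2]; simp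

theorem eq_of_not_sing (h : d.IsAdmissible) {x : Plane} (hx : x ∈ closure d.D)
    (hs : x ∉ d.sing) {j k : Fin d.l₁} (hj : polyFun (d.f j) x = 0)
    (hk : polyFun (d.f k) x = 0) : j = k := by
  by_contra hjk
  exact hs ⟨hx, fun v hv => by rw [h.eq_zero_of_fderiv hjk hx hj hk (hv j hj) (hv k hk)]; rfl⟩

/-- A singular point is an extreme point of a circle or the intersection of two circles. -/
theorem sing_cases {x : Plane} (hs : x ∈ d.sing) :
    (∃ j, polyFun (d.f j) x = 0 ∧ fderiv ℝ (polyFun (d.f j)) x !₂[0, 1] = 0 ∧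
        ∀ k, polyFun (d.f k) x = 0 → k = j) ∨
      ∃ j k, j ≠ k ∧ polyFun (d.f j) x = 0 ∧ polyFun (d.f k) x = 0 := by
  by_cases hex : ∃ j k, j ≠ k ∧ polyFun (d.f j) x = 0 ∧ polyFun (d.f k) x = 0
  · exact Or.inr hex
  push Not at hex
  left
  obtain ⟨j, hj⟩ : ∃ j, polyFun (d.f j) x = 0 := by
    by_contra hcon
    push Not at hcon
    have := hs.2 !₂[1, 0] fun j hj => (hcon j hj).elim
    simp at this
  have huniq : ∀ k, polyFun (d.f k) x = 0 → k = j := fun k hk => by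
    by_contra hkj
    exact hex j k (Ne.symm hkj) hj hk
  refine ⟨j, hj, ?_, huniq⟩
  set D := fderiv ℝ (polyFun (d.f j)) x with hD
  have := hs.2 !₂[-D !₂[0, 1], D !₂[1, 0]] fun k hk => by
    rw [huniq k hk, fderiv_plane_apply, ← hD]
    simp; ring
  simpa using this

namespace IsGood

variable {i₀ : Fin d.l₂} (h : d.IsGood i₀)

include h

theorem finite_sing : d.sing.Finite := by
  refine ((finite_iUnion fun j => finite_circFun_extreme (h.circ j)).union
    (finite_iUnion fun j => finite_iUnion fun k => finite_iUnion fun hjk : j ≠ k =>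
      h.finite_inter j k hjk)).subset fun x hx => ?_
  rcases sing_cases hx with ⟨j, h1, h2, -⟩ | ⟨j, k, hjk, h1, h2⟩
  · left; exact mem_iUnion.2 ⟨j, h1, h2⟩
  · right; exact mem_iUnion.2 ⟨j, mem_iUnion.2 ⟨k, mem_iUnion.2 ⟨hjk, h1, h2⟩⟩⟩

theorem finite_vertices : d.vertices.Finite := by
  rw [h.vertices_eq]; exact h.finite_sing.image _

theorem isClosed_vertices : IsClosed d.vertices :=
  have := h.t2Space_reeb
  h.finite_vertices.isClosed

/-- Around a slice without singular points, the slices of a neighbourhood are connected. -/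
theorem exists_open_slices {x : Plane}
    (hs : ∀ z, SliceRel (closure d.D) x z → z ∉ d.sing) :
    ∃ O, IsOpen O ∧ (∀ z, SliceRel (closure d.D) x z → z ∈ O) ∧
      ∀ z ∈ O, ∀ z' ∈ O, z ∈ closure d.D → z' ∈ closure d.D → z 0 = z' 0 →
        SliceRel (closure d.D) z z' := by
  have key : ∀ j, ∃ O, IsOpen O ∧ (∀ z, SliceRel (closure d.D) x z → z ∈ O) ∧
      ∀ z ∈ O, ∀ z' ∈ O, z ∈ closure d.D → z' ∈ closure d.D → z 0 = z' 0 →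
        ∀ w : Plane, w 0 = z 0 → w 1 ∈ uIcc (z 1) (z' 1) → 0 ≤ polyFun (d.f j) w := by
    intro j
    obtain ⟨s, P, r, hr, hs1, hf⟩ := h.circ j
    have hval : ∀ z ∈ closure d.D, 0 ≤ circFun s P r z := fun z hz => by
      rw [← hf]; exact h.mem_closure.1 hz j
    rw [hf]
    -- The interior of a circle is vertically convex everywhere. For the exterior, the slice has to
    -- pass strictly above, strictly below or strictly beside the disc, and nearby slices then do
    -- the same.
    rcases hs1 with rfl | rfl
    swap
    · refine ⟨univ, isOpen_univ, fun _ _ => trivial, ?_⟩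
      rintro z - z' - hz hz' h0 w hw0 hw1
      have e1 := hval z hz
      have e2 := hval z' hz'
      simp only [circFun, ← h0] at e1 e2
      simp only [circFun, hw0]
      rcases le_total (z 1) (z' 1) with h12 | h12
      · rw [uIcc_of_le h12] at hw1
        by_cases hP : w 1 ≤ P 1
        · nlinarith [hw1.1, hw1.2]
        · nlinarith [hw1.1, hw1.2]
      · rw [uIcc_of_ge h12] at hw1
        by_cases hP : w 1 ≤ P 1
        · nlinarith [hw1.1, hw1.2]
        · nlinarith [hw1.1, hw1.2]
    -- a point on the vertical line through the centre, or on one side of the centre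
    have side : ∀ z ∈ closure d.D, ∀ w : Plane, w 0 = z 0 →
        ((P 1 ≤ z 1 ∧ z 1 ≤ w 1) ∨ (w 1 ≤ z 1 ∧ z 1 ≤ P 1) ∨ r ≤ |z 0 - P 0|) →
        0 ≤ circFun 1 P r w := by
      intro z hz w hw0 hc
      have e1 := hval z hz
      simp only [circFun, one_mul] at e1 ⊢
      rw [hw0]
      rcases hc with ⟨h1, h2⟩ | ⟨h1, h2⟩ | h1
      · nlinarith
      · nlinarith
      · have : r ^ 2 ≤ (z 0 - P 0) ^ 2 := by
          rw [← sq_abs (z 0 - P 0)]; exact pow_le_pow_left₀ hr.le h1 2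
        nlinarith [sq_nonneg (w 1 - P 1)]
    by_cases c1 : ∀ z, SliceRel (closure d.D) x z → z 1 < P 1
    · refine ⟨{z | z 1 < P 1}, isOpen_lt (by fun_prop) continuous_const, c1, ?_⟩
      intro z hz z' hz' hzK hzK' h0 w hw0 hw1
      simp only [mem_ofPred_eq] at hz hz'
      rcases le_total (z 1) (z' 1) with h12 | h12
      · rw [uIcc_of_le h12] at hw1
        exact side z' hzK' w (hw0.trans h0) (Or.inr (Or.inl ⟨hw1.2, hz'.le⟩))
      · rw [uIcc_of_ge h12] at hw1
        exact side z hzK w hw0 (Or.inr (Or.inl ⟨hw1.2, hz.le⟩))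
    by_cases c2 : ∀ z, SliceRel (closure d.D) x z → P 1 < z 1
    · refine ⟨{z | P 1 < z 1}, isOpen_lt continuous_const (by fun_prop), c2, ?_⟩
      intro z hz z' hz' hzK hzK' h0 w hw0 hw1
      simp only [mem_ofPred_eq] at hz hz'
      rcases le_total (z 1) (z' 1) with h12 | h12
      · rw [uIcc_of_le h12] at hw1
        exact side z hzK w hw0 (Or.inl ⟨hz.le, hw1.1⟩)
      · rw [uIcc_of_ge h12] at hw1
        exact side z' hzK' w (hw0.trans h0) (Or.inl ⟨hz'.le, hw1.1⟩)
    push Not at c1 c2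
    obtain ⟨z₁, hz₁, hz₁P⟩ := c1
    obtain ⟨z₂, hz₂, hz₂P⟩ := c2
    -- The slice reaches the height of the centre, so it contains `C`. If `C` were on the circle,
    -- the tangent there would be vertical and `C` singular. Hence the slice is strictly beside the
    -- disc.
    let C : Plane := !₂[x 0, P 1]
    have hC : SliceRel (closure d.D) x C := by
      refine hz₁.trans ((hz₁.symm.trans hz₂).mid (z := C) hz₁.1 ?_)
      rw [uIcc_of_ge (hz₂P.trans hz₁P)]
      exact ⟨hz₂P, hz₁P⟩
    have hr' : r < |x 0 - P 0| := by
      have e1 := hval C hC.right_mem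
      have e2 : circFun 1 P r C ≠ 0 := by
        intro e2
        have := fderiv_ne_zero_of_not_sing h.adm hC.right_mem (hs C hC) (j := j) (by rw [hf, e2])
        rw [hf, fderiv_circFun] at this
        simp [C] at this
      have e3 : 0 < circFun 1 P r C := lt_of_le_of_ne e1 (Ne.symm e2)
      simp [circFun, C] at e3
      have := sq_lt_sq.1 e3
      rwa [abs_of_pos hr] at this
    refine ⟨{z | r < |z 0 - P 0|}, isOpen_lt continuous_const (by fun_prop), fun z hz => ?_, ?_⟩
    · change r < |z 0 - P 0|
      rw [← hz.1]; exact hr'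
    · intro z hz z' hz' hzK hzK' h0 w hw0 hw1
      exact side z hzK w hw0 (Or.inr (Or.inr (le_of_lt hz)))
  choose O hO hOA hOs using key
  refine ⟨⋂ j, O j, isOpen_iInter_of_finite hO, fun z hz => mem_iInter.2 fun j => hOA j z hz, ?_⟩
  intro z hz z' hz' hzK hzK' h0
  refine ⟨h0, fun w hw0 hw1 => h.mem_closure.2 fun j => ?_⟩
  exact hOs j z (mem_iInter.1 hz j) z' (mem_iInter.1 hz' j) hzK hzK' h0 w hw0 hw1

/-- A regular point of the boundary of the region lies in the same slice as interior points. -/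
theorem exists_slice_mem_region {x : Plane} (hx : x ∈ closure d.D) (hs : x ∉ d.sing) :
    ∃ y ∈ d.D, SliceRel (closure d.D) x y := by
  by_cases hJ : ∃ j, polyFun (d.f j) x = 0
  swap
  · push Not at hJ
    refine ⟨x, ?_, SliceRel.refl hx⟩
    rw [h.region]
    exact fun j => lt_of_le_of_ne (h.mem_closure.1 hx j) (Ne.symm (hJ j))
  obtain ⟨j, hj⟩ := hJ
  obtain ⟨s, P, r, hr, hs1, hf⟩ := h.circ j
  have h2 := fderiv_ne_zero_of_not_sing h.adm hx hs hj
  rw [hf, fderiv_circFun] at h2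
  simp at h2
  obtain ⟨hs0, hxP⟩ := h2
  -- The vertical direction in which the function of the curve grows, that is, which points into the
  -- region.
  obtain ⟨σ, hσ, hpos⟩ : ∃ σ : ℝ, (σ = 1 ∨ σ = -1) ∧ 0 < σ * (s * (x 1 - P 1)) := by
    rcases lt_or_gt_of_ne (mul_ne_zero hs0 hxP) with h' | h'
    · exact ⟨-1, Or.inr rfl, by linarith⟩
    · exact ⟨1, Or.inl rfl, by linarith⟩
  let y : ℝ → Plane := fun u => !₂[x 0, x 1 + σ * u]
  have hy : Continuous y := by fun_prop
  have hy0 : y 0 = x := plane_ext rfl (by simp [y])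
  have hev : ∀ k, ∀ᶠ u in 𝓝 (0 : ℝ), 0 < u → 0 < polyFun (d.f k) (y u) := by
    intro k
    by_cases hk : k = j
    · subst hk
      have hc : Continuous fun u : ℝ => σ * (s * (2 * (x 1 - P 1) + σ * u)) := by fun_prop
      have h0 : 0 < σ * (s * (2 * (x 1 - P 1) + σ * 0)) := by linarith
      filter_upwards [hc.continuousAt.eventually (lt_mem_nhds h0)] with u hu hu0
      have e := circFun_sub_vertical s P r (z := x) (w := y u) rfl
      rw [← hf, hj, sub_zero] at e
      rw [e]
      simp only [y, Fin.isValue, Matrix.cons_val_one, Matrix.cons_val_fin_one]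
      have := mul_pos hu0 hu
      linarith
    · have h0 : 0 < polyFun (d.f k) (y 0) := by
        rw [hy0]
        refine lt_of_le_of_ne (h.mem_closure.1 hx k) fun hk0 => hk ?_
        exact eq_of_not_sing h.adm hx hs hk0.symm hj
      filter_upwards [((h.circ k).continuous.comp hy).continuousAt.eventually (lt_mem_nhds h0)]
        with u hu _ using hu
  obtain ⟨η, hη, hball⟩ := Metric.eventually_nhds_iff.1 (Filter.eventually_all.2 hev)
  have hin : ∀ u, 0 < u → u < η → y u ∈ d.D := fun u hu0 hu => by
    rw [h.region]
    exact fun k => hball (by rw [Real.dist_eq, sub_zero, abs_of_pos hu0]; exact hu) k hu0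
  refine ⟨y (η / 2), hin _ (by linarith) (by linarith), rfl, fun z hz0 hz1 => ?_⟩
  have hz1' : z 1 ∈ uIcc (x 1) (x 1 + σ * (η / 2)) := hz1
  set u := σ * (z 1 - x 1) with hu
  have hzu : z = y u := by
    refine plane_ext hz0 ?_
    simp only [y, hu, Fin.isValue, Matrix.cons_val_one, Matrix.cons_val_fin_one]
    rcases hσ with rfl | rfl <;> ring
  have hu0 : 0 ≤ u ∧ u ≤ η / 2 := by
    rcases hσ with rfl | rfl
    · rw [uIcc_of_le (by linarith)] at hz1'
      exact ⟨by linarith [hz1'.1], by linarith [hz1'.2]⟩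
    · rw [uIcc_of_ge (by linarith)] at hz1'
      exact ⟨by linarith [hz1'.2], by linarith [hz1'.1]⟩
  rcases hu0.1.eq_or_lt with h0 | h0
  · rw [hzu, ← h0, hy0]; exact hx
  · rw [hzu]; exact subset_closure (hin u h0 (by linarith [hu0.2]))

/-- Local injectivity is the connectedness of nearby slices. A local section follows the horizontal
line through an interior point of the slice. -/
theorem isRegularFor {c : d.Reeb} (hc : c ∉ d.vertices) :
    IsRegularFor (reebHeight d.heightOn) c := by
  obtain ⟨x, hx, rfl⟩ := h.exists_cls c
  have hs : ∀ z, SliceRel (closure d.D) x z → z ∉ d.sing := by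
    intro z hz hzs
    apply hc
    rw [h.vertices_eq]
    exact ⟨z, hzs, ((h.cls_eq_iff hx hz.right_mem).2 hz).symm⟩
  rw [IsRegularFor, h.reebHeight_cls hx]
  constructor
  · obtain ⟨O, hO, hOA, hOs⟩ := h.exists_open_slices hs
    refine ⟨_, h.isOpen_cls_subset hO, fun z hz hzx => hOA z ((h.cls_eq_iff hx hz).1 hzx.symm), ?_⟩
    intro a ha b hb hab
    obtain ⟨z, hz, rfl⟩ := h.exists_cls a
    obtain ⟨z', hz', rfl⟩ := h.exists_cls b
    rw [h.reebHeight_cls hz, h.reebHeight_cls hz'] at hab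
    exact (h.cls_eq_iff hz hz').2 (hOs z (ha z hz rfl) z' (hb z' hz' rfl) hz hz' hab)
  · obtain ⟨y, hy, hxy⟩ := h.exists_slice_mem_region hx (hs x (SliceRel.refl hx))
    have hyc : Continuous fun t : ℝ => (!₂[t, y 1] : Plane) := by fun_prop
    have hy0 : (!₂[x 0, y 1] : Plane) = y := plane_ext hxy.1 rfl
    have : (fun t : ℝ => (!₂[t, y 1] : Plane)) ⁻¹' d.D ∈ 𝓝 (x 0) :=
      hyc.continuousAt (by rw [hy0]; exact h.adm.isOpen.mem_nhds hy)
    obtain ⟨δ, hδ, hsub⟩ := Metric.mem_nhds_iff.1 this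
    rw [Real.ball_eq_Ioo] at hsub
    have hsub' : ∀ t ∈ Ioo (x 0 - δ) (x 0 + δ), (!₂[t, y 1] : Plane) ∈ closure d.D :=
      fun t ht => subset_closure (hsub ht)
    refine ⟨δ, hδ, fun t => h.cls !₂[t, y 1], ?_, ?_, ?_⟩
    · exact h.continuousOn_cls.comp hyc.continuousOn hsub'
    · change h.cls !₂[x 0, y 1] = _
      rw [hy0]; exact ((h.cls_eq_iff hx hxy.right_mem).2 hxy).symm
    · intro t ht
      change reebHeight d.heightOn (h.cls _) = t
      rw [h.reebHeight_cls (hsub' t ht)]; rfl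

theorem isFiniteGraph : IsFiniteGraph d.Reeb d.vertices :=
  have := h.t2Space_reeb
  have := h.compactSpace_reeb
  isFiniteGraph_of_regular (continuous_reebHeight continuous_heightOn) h.finite_vertices
    fun _ hc => h.isRegularFor hc

end IsGood

end MomentData

/-! ### Morse-Bott functions -/

/-- A function whose gradient is diagonal with nonvanishing coefficients is a Morse function. -/
theorem isMorseOn_of_diag {k : ℕ} {h : EuclideanSpace ℝ (Fin k) → ℝ}
    {V : Set (EuclideanSpace ℝ (Fin k))} (hV : IsOpen V) (hh : ContDiffOn ℝ ∞ h V)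
    (B : Fin k → EuclideanSpace ℝ (Fin k) → ℝ)
    (hB : ∀ a, ∀ w ∈ V, DifferentiableAt ℝ (B a) w) (hB0 : ∀ a, ∀ w ∈ V, B a w ≠ 0)
    (hd : ∀ w ∈ V, ∀ u, fderiv ℝ h w u = ∑ a, B a w * w a * u a) : IsMorseOn h V := by
  refine ⟨hh, fun y hy hcrit v hv => ?_⟩
  have hs : ∀ w ∈ V, ∀ a, fderiv ℝ h w (EuclideanSpace.single a 1) = B a w * w a := by
    intro w hw a
    rw [hd w hw, Finset.sum_eq_single_of_mem a (Finset.mem_univ _)]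
    · simp
    · intro b _ hb; simp [hb]
  have hy0 : ∀ a, y a = 0 := fun a => by
    have := hs y hy a
    rw [hcrit] at this
    exact (mul_eq_zero.1 this.symm).resolve_left (hB0 a y hy)
  have hdd : DifferentiableAt ℝ (fderiv ℝ h) y :=
    ((hh.contDiffAt (hV.mem_nhds hy)).fderiv_right (m := 1) (by norm_cast)).differentiableAt (by simp)
  ext a
  have h1 : fderiv ℝ (fun w => fderiv ℝ h w (EuclideanSpace.single a 1)) y v
      = fderiv ℝ (fderiv ℝ h) y v (EuclideanSpace.single a 1) := by
    rw [fderiv_clm_apply hdd (differentiableAt_const _)]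
    simp
  have h2 : (fun w => fderiv ℝ h w (EuclideanSpace.single a 1)) =ᶠ[𝓝 y] fun w => B a w * w a := by
    filter_upwards [hV.mem_nhds hy] with w hw using hs w hw a
  -- At a critical point all coordinates vanish, so differentiating the product leaves only the
  -- nonzero coefficient times the coordinate of the vector.
  have h3 : HasFDerivAt (fun w => B a w * w a) _ y :=
    (hB a y hy).hasFDerivAt.mul
      (EuclideanSpace.proj a : EuclideanSpace ℝ (Fin k) →L[ℝ] ℝ).hasFDerivAt
  rw [h2.fderiv_eq, h3.fderiv, hv] at h1
  simp [hy0] at h1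
  exact h1.resolve_left (hB0 a y hy)

namespace MomentData

variable {d : MomentData}

/-- Vectors with prescribed fibre coordinates in some colours complete to tangent vectors. -/
theorem exists_tangent_vector (hc : ∀ j, IsCircFun (polyFun (d.f j))) {q : d.Ambient}
    (hq : q ∈ d.zeroSet) (S : Set (Fin d.l₂)) (hS : ∀ i ∉ S, d.prodFun i (d.proj q) ≠ 0)
    (v : Plane) (W : (Σ i : Fin d.l₂, Fin (d.μ i + 1)) → ℝ)
    (hW : ∀ i ∈ S, fderiv ℝ (d.prodFun i) (d.proj q) v = 2 * ∑ k, q (Sum.inr ⟨i, k⟩) * W ⟨i, k⟩) :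
    ∃ V ∈ d.tangent q, d.proj V = v ∧ ∀ i ∈ S, ∀ k, V (Sum.inr ⟨i, k⟩) = W ⟨i, k⟩ := by
  classical
  let V : d.Ambient := WithLp.toLp 2 (Sum.elim (fun i => v i) fun ik =>
    if ik.1 ∈ S then W ik else
    fderiv ℝ (d.prodFun ik.1) (d.proj q) v / (2 * d.prodFun ik.1 (d.proj q)) * q (Sum.inr ik))
  have hV : d.proj V = v := by apply plane_ext <;> rfl
  refine ⟨V, mem_tangent.2 fun i => ?_, hV, fun i hi k => by simp [V, hi]⟩
  rw [fderiv_eqn hc, hV]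
  by_cases hi : i ∈ S
  · rw [hW i hi]
    simp [V, hi]
  · have : ∑ k, q (Sum.inr ⟨i, k⟩) * V (Sum.inr ⟨i, k⟩) =
        fderiv ℝ (d.prodFun i) (d.proj q) v / (2 * d.prodFun i (d.proj q)) *
          ∑ k, q (Sum.inr ⟨i, k⟩) ^ 2 := by
      rw [Finset.mul_sum]
      refine Finset.sum_congr rfl fun k _ => ?_
      simp [V, hi]; ring
    rw [this, ← d.mem_zeroSet.1 hq i]
    have := hS i hi
    field_simp
    ring

theorem fderiv_euclidean_apply {E : Type*} [NormedAddCommGroup E] [NormedSpace ℝ E] {k : ℕ}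
    {s : E → EuclideanSpace ℝ (Fin k)} {q : E} (hs : DifferentiableAt ℝ s q) (v : E) (a : Fin k) :
    fderiv ℝ s q v a = fderiv ℝ (fun q => s q a) q v := by
  have h1 : HasFDerivAt (fun q => s q a)
      ((EuclideanSpace.proj a : EuclideanSpace ℝ (Fin k) →L[ℝ] ℝ).comp (fderiv ℝ s q)) q :=
    (EuclideanSpace.proj a : EuclideanSpace ℝ (Fin k) →L[ℝ] ℝ).hasFDerivAt.comp q hs.hasFDerivAt
  rw [h1.fderiv]; rfl

/-- The height near a point over an extreme point of a circle. -/
theorem IsGood.exists_morse_extreme {i₀ : Fin d.l₂} (h : d.IsGood i₀) {p : d.Ambient}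
    (hp : p ∈ d.manifold) {j : Fin d.l₁} (hj : polyFun (d.f j) (d.proj p) = 0)
    (hj2 : fderiv ℝ (polyFun (d.f j)) (d.proj p) !₂[0, 1] = 0)
    (huniq : ∀ k, polyFun (d.f k) (d.proj p) = 0 → k = j) :
    ∃ (k : ℕ) (U : Set d.Ambient) (s : d.Ambient → EuclideanSpace ℝ (Fin k))
      (V : Set (EuclideanSpace ℝ (Fin k))) (g : EuclideanSpace ℝ (Fin k) → ℝ),
      IsOpen U ∧ p ∈ U ∧ ContDiffOn ℝ ∞ s U ∧
      (∀ q ∈ U ∩ d.manifold, ∀ w, ∃ v ∈ d.tangent q, fderiv ℝ s q v = w) ∧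
      IsOpen V ∧ MapsTo s (U ∩ d.manifold) V ∧ IsMorseOn g V ∧
        ∀ q ∈ U ∩ d.manifold, d.height q = g (s q) := by
  classical
  obtain ⟨σ, P, r, hr, hσ, hf⟩ := h.circ j
  have hσ2 : σ * σ = 1 := by rcases hσ with rfl | rfl <;> norm_num
  have hσ0 : σ ≠ 0 := by rintro rfl; norm_num at hσ2
  set i := d.c j with hi
  -- Near the point the product is the circle function times the positive function `G`. After
  -- division of the fibre coordinates by the root of `G`, the equation says that the circle
  -- function is their squared norm. It can be solved for the first coordinate, which becomes `P 0 +
  -- τ * √(Q (s q))` with a diagonal quadratic polynomial `Q`.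
  let G : Plane → ℝ := fun x =>
    ∏ k ∈ (Finset.univ.filter fun k => d.c k = d.c j).erase j, polyFun (d.f k) x
  have hG : ContDiff ℝ ∞ G := contDiff_prod fun k _ => (h.circ k).contDiff
  have hFG : ∀ x, d.prodFun i x = circFun σ P r x * G x := fun x => by
    rw [← hf]; exact (Finset.mul_prod_erase _ (fun k => polyFun (d.f k) x) (by simp [hi])).symm
  have hpos : ∀ k, k ≠ j → 0 < polyFun (d.f k) (d.proj p) := fun k hk =>
    lt_of_le_of_ne (h.mem_closure.1 hp.1 k) fun h0 => hk (huniq k h0.symm)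
  have hGp : 0 < G (d.proj p) := Finset.prod_pos fun k hk => hpos k (Finset.ne_of_mem_erase hk)
  have hother : ∀ i', i' ≠ i → d.prodFun i' (d.proj p) ≠ 0 := fun i' hi' h0 => by
    obtain ⟨k, rfl, hk⟩ := prodFun_eq_zero_iff.1 h0
    exact hi' (by rw [huniq k hk])
  -- the position of the point on the circle
  rw [hf] at hj hj2
  rw [fderiv_circFun] at hj2
  simp [hσ0] at hj2
  have hx1 : p (Sum.inl 1) - P 1 = 0 := hj2
  have hx0 : (p (Sum.inl 0) - P 0) ^ 2 = r ^ 2 := by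
    simp [circFun, hσ0, hx1] at hj
    linarith
  -- The sign that tells the rightmost point of the circle from the leftmost one.
  obtain ⟨τ, hτ, hτp⟩ : ∃ τ : ℝ, τ * τ = 1 ∧ 0 < τ * (p (Sum.inl 0) - P 0) := by
    have : p (Sum.inl 0) - P 0 ≠ 0 := fun h0 => by
      rw [h0] at hx0
      have := pow_pos hr 2
      linarith
    rcases lt_or_gt_of_ne this with h0 | h0
    · exact ⟨-1, by norm_num, by linarith⟩
    · exact ⟨1, by norm_num, by linarith⟩
  have hτ0 : τ ≠ 0 := by rintro rfl; norm_num at hτ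
  let γ : Plane → ℝ := fun x => (√(G x))⁻¹
  have hγ : ∀ x, 0 < G x → ContDiffAt ℝ ∞ γ x := fun x hx =>
    (hG.contDiffAt.sqrt hx.ne').inv (Real.sqrt_pos.2 hx).ne'
  have hγpos : ∀ x, 0 < G x → 0 < γ x := fun x hx => inv_pos.2 (Real.sqrt_pos.2 hx)
  have hγG : ∀ x, 0 < G x → γ x * γ x * G x = 1 := fun x hx => by
    have h1 := Real.mul_self_sqrt hx.le
    have h2 := (Real.sqrt_pos.2 hx).ne'
    simp only [γ]
    nth_rw 3 [← h1]
    field_simp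
  let U : Set d.Ambient := {q | 0 < G (d.proj q) ∧ 0 < τ * (d.proj q 0 - P 0) ∧
    ∀ i', i' ≠ i → d.prodFun i' (d.proj q) ≠ 0}
  have hprojc : Continuous d.proj := d.projL.continuous
  have hU : IsOpen U := by
    refine (isOpen_lt continuous_const (hG.continuous.comp hprojc)).inter
      ((show IsOpen {q : d.Ambient | 0 < τ * (q (Sum.inl 0) - P 0)} from
        isOpen_lt continuous_const (by fun_prop)).inter ?_)
    have : {q : d.Ambient | ∀ i', i' ≠ i → d.prodFun i' (d.proj q) ≠ 0} =
        ⋂ i', ⋂ (_ : i' ≠ i), {q | d.prodFun i' (d.proj q) ≠ 0} := by ext; simp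
    change IsOpen {q : d.Ambient | ∀ i', i' ≠ i → d.prodFun i' (d.proj q) ≠ 0}
    rw [this]
    refine isOpen_iInter_of_finite fun i' => isOpen_iInter_of_finite fun _ => ?_
    exact isOpen_ne_fun ((contDiff_prodFun (n := 0) h.circ i').continuous.comp hprojc)
      continuous_const
  let s : d.Ambient → EuclideanSpace ℝ (Fin (d.μ i + 1 + 1)) := fun q =>
    WithLp.toLp 2 (Fin.cons (d.proj q 1 - P 1) fun k => q (Sum.inr ⟨i, k⟩) * γ (d.proj q))
  have hs : ∀ q ∈ U, ContDiffAt ℝ ∞ s q := by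
    intro q hq
    have hγq : ContDiffAt ℝ ∞ (fun q => γ (d.proj q)) q :=
      ContDiffAt.comp (g := γ) q (hγ _ hq.1) d.projL.contDiff.contDiffAt
    rw [contDiffAt_euclidean]
    intro a
    refine Fin.cases ?_ (fun k => ?_) a
    · change ContDiffAt ℝ ∞ (fun q : d.Ambient => q (Sum.inl 1) - P 1) q
      fun_prop
    · exact ContDiffAt.mul (f := fun q : d.Ambient => q (Sum.inr ⟨i, k⟩)) (by fun_prop) hγq
  let ε : Fin (d.μ i + 1 + 1) → ℝ := Fin.cons (-1) fun _ => σ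
  have hε : ∀ a, ε a ≠ 0 := fun a => by
    refine Fin.cases ?_ (fun k => ?_) a
    · simp [ε]
    · simpa [ε] using hσ0
  let Q : EuclideanSpace ℝ (Fin (d.μ i + 1 + 1)) → ℝ := fun w => r ^ 2 + ∑ a, ε a * w a ^ 2
  have hQ : ContDiff ℝ ∞ Q := by fun_prop
  have hQd : ∀ w, HasFDerivAt Q (∑ a, (2 * ε a * w a) •
      (EuclideanSpace.proj a : EuclideanSpace ℝ (Fin (d.μ i + 1 + 1)) →L[ℝ] ℝ)) w := by
    intro w
    refine (HasFDerivAt.fun_sum fun a _ => ?_).const_add _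
    have := (((EuclideanSpace.proj a : EuclideanSpace ℝ (Fin (d.μ i + 1 + 1)) →L[ℝ]
      ℝ).hasFDerivAt (x := w)).pow 2).const_mul (ε a)
    refine this.congr_fderiv ?_
    ext v; simp; ring
  let V : Set (EuclideanSpace ℝ (Fin (d.μ i + 1 + 1))) := {w | 0 < Q w}
  have hV : IsOpen V := isOpen_lt continuous_const hQ.continuous
  let g : EuclideanSpace ℝ (Fin (d.μ i + 1 + 1)) → ℝ := fun w => P 0 + τ * √(Q w)
  have hQs : ∀ q ∈ U ∩ d.manifold, Q (s q) = (d.proj q 0 - P 0) ^ 2 := by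
    rintro q ⟨hqU, hq⟩
    have h1 := d.mem_zeroSet.1 hq.2 i
    rw [hFG] at h1
    have h2 := hγG _ hqU.1
    have h3 : ∑ k, (q (Sum.inr ⟨i, k⟩) * γ (d.proj q)) ^ 2 = circFun σ P r (d.proj q) := by
      simp only [mul_pow, ← Finset.sum_mul]
      rw [← h1]; linear_combination (circFun σ P r (d.proj q)) * h2
    have h4 : Q (s q) = r ^ 2 - (d.proj q 1 - P 1) ^ 2 + σ * circFun σ P r (d.proj q) := by
      rw [← h3, Finset.mul_sum]
      simp only [Q, s, ε, Fin.sum_univ_succ, Fin.cons_zero, Fin.cons_succ]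
      ring
    rw [h4, circFun]
    linear_combination ((d.proj q 0 - P 0) ^ 2 + (d.proj q 1 - P 1) ^ 2 - r ^ 2) * hσ2
  refine ⟨d.μ i + 1 + 1, U, s, V, g, hU, ⟨hGp, hτp, hother⟩,
    fun q hq => (hs q hq).contDiffWithinAt, ?_, hV, ?_, ?_, ?_⟩
  · rintro q ⟨hqU, hq⟩ w
    have hγq := hγpos _ hqU.1
    have hγd : DifferentiableAt ℝ γ (d.proj q) := (hγ _ hqU.1).differentiableAt (by simp)
    set dγ := fderiv ℝ γ (d.proj q) with hdγ
    have hqx : d.proj q 0 - P 0 ≠ 0 := fun h0 => by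
      have := hqU.2.1; rw [h0] at this; simp at this
    set b := ∑ k : Fin (d.μ i + 1), q (Sum.inr ⟨i, k⟩) * w k.succ with hb
    -- The second coordinate is prescribed by `w`. The first one is solved from the differentiated
    -- equation, where its coefficient does not vanish because `q` stays off the vertical line
    -- through the centre.
    let v : Plane := !₂[(2 * γ (d.proj q) * b - 2 * σ * (d.proj q 1 - P 1) * w 0) /
      (2 * σ * (d.proj q 0 - P 0)), w 0]
    have hv : fderiv ℝ (circFun σ P r) (d.proj q) v = 2 * γ (d.proj q) * b := by
      rw [fderiv_circFun]
      simp only [v, Fin.isValue, Matrix.cons_val_zero, Matrix.cons_val_one,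
        Matrix.cons_val_fin_one]
      field_simp
      ring
    let W : (Σ i : Fin d.l₂, Fin (d.μ i + 1)) → ℝ := fun ik =>
      if hik : ik.1 = i then
        (w (Fin.succ (Fin.cast (by rw [hik]) ik.2)) - q (Sum.inr ik) * dγ v) / γ (d.proj q)
      else 0
    have hWi : ∀ k, W ⟨i, k⟩ = (w k.succ - q (Sum.inr ⟨i, k⟩) * dγ v) / γ (d.proj q) := fun k => by
      simp [W]
    -- the differential of `γ² F = f`
    have hFd : γ (d.proj q) * fderiv ℝ (d.prodFun i) (d.proj q) v
        + 2 * d.prodFun i (d.proj q) * dγ v = 2 * b := by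
      have e1 : (fun x => γ x * γ x * d.prodFun i x) =ᶠ[𝓝 (d.proj q)] circFun σ P r := by
        filter_upwards [(isOpen_lt continuous_const hG.continuous).mem_nhds hqU.1] with x hx
        rw [hFG]; linear_combination (circFun σ P r x) * hγG x hx
      have hFdiff : DifferentiableAt ℝ (d.prodFun i) (d.proj q) :=
        (contDiff_prodFun (n := 1) h.circ i).differentiable (by simp) _
      have e2 : HasFDerivAt (fun x => γ x * γ x * d.prodFun i x) _ (d.proj q) :=
        (hγd.hasFDerivAt.mul hγd.hasFDerivAt).mul hFdiff.hasFDerivAt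
      rw [← e1.fderiv_eq, e2.fderiv] at hv
      simp at hv
      rw [← hdγ] at hv
      apply mul_left_cancel₀ hγq.ne'
      linear_combination hv
    obtain ⟨X, hX, hXv, hXW⟩ := exists_tangent_vector h.circ hq.2 {i} hqU.2.2 v W (by
      rintro _ rfl
      simp only [hWi]
      have e1 : ∑ k, q (Sum.inr ⟨i, k⟩) *
          ((w k.succ - q (Sum.inr ⟨i, k⟩) * dγ v) / γ (d.proj q)) =
          (b - d.prodFun i (d.proj q) * dγ v) / γ (d.proj q) := by
        rw [d.mem_zeroSet.1 hq.2 i, hb, Finset.sum_mul, ← Finset.sum_sub_distrib,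
          Finset.sum_div]
        exact Finset.sum_congr rfl fun k _ => by ring
      rw [e1]
      field_simp
      linear_combination hFd)
    refine ⟨X, hX, ?_⟩
    have hsd : DifferentiableAt ℝ s q := (hs q hqU).differentiableAt (by simp)
    ext a
    rw [fderiv_euclidean_apply hsd]
    refine Fin.cases ?_ (fun k => ?_) a
    · have e1 : HasFDerivAt (fun q : d.Ambient => s q 0)
          (EuclideanSpace.proj (Sum.inl 1) : d.Ambient →L[ℝ] ℝ) q :=
        ((EuclideanSpace.proj (Sum.inl 1) : d.Ambient →L[ℝ] ℝ).hasFDerivAt).sub_const (P 1)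
      rw [e1.fderiv]
      change d.proj X 1 = w 0
      rw [hXv]; rfl
    · have e0 : HasFDerivAt (fun q => γ (d.proj q)) (dγ.comp d.projL) q :=
        HasFDerivAt.comp q hγd.hasFDerivAt d.projL.hasFDerivAt
      have e1 : HasFDerivAt (fun q : d.Ambient => s q k.succ) _ q :=
        ((EuclideanSpace.proj (Sum.inr ⟨i, k⟩) : d.Ambient →L[ℝ] ℝ).hasFDerivAt).mul e0
      rw [e1.fderiv]
      simp [hXv, hXW i rfl k, hWi]
      field_simp
      ring
  · intro q hq
    change 0 < Q (s q)
    rw [hQs q hq]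
    have : d.proj q 0 - P 0 ≠ 0 := fun h0 => by
      have := hq.1.2.1; rw [h0] at this; simp at this
    positivity
  · refine isMorseOn_of_diag hV ?_ (fun a w => τ * ε a / √(Q w)) ?_ ?_ ?_
    · intro w hw
      exact (contDiffAt_const.add (contDiffAt_const.mul
        (hQ.contDiffAt.sqrt (ne_of_gt hw)))).contDiffWithinAt
    · intro a w hw
      have : DifferentiableAt ℝ (fun w => √(Q w)) w :=
        (hQd w).differentiableAt.sqrt (ne_of_gt hw)
      simp only [div_eq_mul_inv]
      exact (this.fun_inv (Real.sqrt_pos.2 hw).ne').const_mul _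
    · intro a w hw
      exact div_ne_zero (mul_ne_zero hτ0 (hε a)) (Real.sqrt_pos.2 hw).ne'
    · intro w hw u
      have e : HasFDerivAt g _ w := (((hQd w).sqrt (ne_of_gt hw)).const_mul τ).const_add (P 0)
      rw [e.fderiv]
      simp [sum_apply, Finset.mul_sum]
      refine Finset.sum_congr rfl fun a _ => ?_
      have := (Real.sqrt_pos.2 hw).ne'
      field_simp
  · intro q hq
    change d.proj q 0 = P 0 + τ * √(Q (s q))
    rw [hQs q hq]
    have h1 : (d.proj q 0 - P 0) ^ 2 = (τ * (d.proj q 0 - P 0)) ^ 2 := by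
      linear_combination (-(d.proj q 0 - P 0) ^ 2) * hτ
    rw [h1, Real.sqrt_sq hq.1.2.1.le]
    linear_combination (-(d.proj q 0 - P 0)) * hτ

end MomentData

namespace MomentData

variable {d : MomentData}

/-- The height near a point over the intersection of two circles. -/
theorem IsGood.exists_morse_corner {i₀ : Fin d.l₂} (h : d.IsGood i₀) {p : d.Ambient}
    (hp : p ∈ d.manifold) {j k : Fin d.l₁} (hjk : j ≠ k)
    (hj : polyFun (d.f j) (d.proj p) = 0) (hk : polyFun (d.f k) (d.proj p) = 0)
    (hj2 : fderiv ℝ (polyFun (d.f j)) (d.proj p) !₂[0, 1] ≠ 0)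
    (hk2 : fderiv ℝ (polyFun (d.f k)) (d.proj p) !₂[0, 1] ≠ 0) :
    ∃ (k : ℕ) (U : Set d.Ambient) (s : d.Ambient → EuclideanSpace ℝ (Fin k))
      (V : Set (EuclideanSpace ℝ (Fin k))) (g : EuclideanSpace ℝ (Fin k) → ℝ),
      IsOpen U ∧ p ∈ U ∧ ContDiffOn ℝ ∞ s U ∧
      (∀ q ∈ U ∩ d.manifold, ∀ w, ∃ v ∈ d.tangent q, fderiv ℝ s q v = w) ∧
      IsOpen V ∧ MapsTo s (U ∩ d.manifold) V ∧ IsMorseOn g V ∧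
        ∀ q ∈ U ∩ d.manifold, d.height q = g (s q) := by
  classical
  set x := d.proj p with hx
  set i₁ := d.c j with hi₁
  set i₂ := d.c k with hi₂
  have hi12 : i₁ ≠ i₂ := fun h12 => hjk <| h.adm.injOn {j, k} ⟨x, hp.1, by
    intro i hi
    rcases Finset.mem_insert.1 hi with rfl | hi
    · exact hj
    · rw [Finset.mem_singleton.1 hi]; exact hk⟩ (by simp) (by simp) h12
  have hother : ∀ i, i ≠ i₁ → i ≠ i₂ → d.prodFun i x ≠ 0 := fun i h1 h2 h0 => by
    obtain ⟨l, rfl, hl⟩ := prodFun_eq_zero_iff.1 h0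
    exact h.adm.not_three hjk (fun e => h1 (by rw [← e])) (fun e => h2 (by rw [← e])) hp.1 hj hk hl
  -- By transversality the two products are local coordinates at the corner. The first plane
  -- coordinate is a function `ψ` of them, and on the manifold they equal the squared norms of the
  -- fibre coordinates.
  let Φ : Plane → Plane := fun y => !₂[d.prodFun i₁ y, d.prodFun i₂ y]
  -- Class `ω` is used since analyticity at a point persists on a neighbourhood, whereas `ContDiffAt
  -- ℝ ∞` alone does not provide a common one for all orders.
  have hΦ : ContDiff ℝ ω Φ := by
    rw [contDiff_euclidean]
    intro a
    fin_cases a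
    · exact contDiff_prodFun h.circ i₁
    · exact contDiff_prodFun h.circ i₂
  have hΦd : ∀ y, DifferentiableAt ℝ Φ y := hΦ.differentiable (by simp)
  have hΦ0 : ∀ y v, fderiv ℝ Φ y v 0 = fderiv ℝ (d.prodFun i₁) y v := fun y v =>
    fderiv_euclidean_apply (hΦd y) v 0
  have hΦ1 : ∀ y v, fderiv ℝ Φ y v 1 = fderiv ℝ (d.prodFun i₂) y v := fun y v =>
    fderiv_euclidean_apply (hΦd y) v 1
  have hΦx : Φ x = 0 := plane_ext (prodFun_eq_zero_iff.2 ⟨j, rfl, hj⟩)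
    (prodFun_eq_zero_iff.2 ⟨k, rfl, hk⟩)
  have hinj : Function.Injective (fderiv ℝ Φ x).toLinearMap := by
    rw [← LinearMap.ker_eq_bot, LinearMap.ker_eq_bot']
    intro v hv
    have hv' : fderiv ℝ Φ x v = 0 := hv
    have h0 := hΦ0 x v
    have h1 := hΦ1 x v
    rw [hv', fderiv_prodFun_of_zero h.circ hj] at h0
    rw [hv', fderiv_prodFun_of_zero h.circ hk] at h1
    exact h.adm.eq_zero_of_fderiv hjk hp.1 hj hk
      ((mul_eq_zero.1 h0.symm).resolve_left (h.adm.prod_erase_ne_zero hp.1 hj))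
      ((mul_eq_zero.1 h1.symm).resolve_left (h.adm.prod_erase_ne_zero hp.1 hk))
  let e₀ : Plane ≃L[ℝ] Plane := (LinearEquiv.ofInjectiveEndo _ hinj).toContinuousLinearEquiv
  have he₀ : (e₀ : Plane →L[ℝ] Plane) = fderiv ℝ Φ x := by ext v; rfl
  have hfd : HasFDerivAt Φ (e₀ : Plane →L[ℝ] Plane) x := by
    rw [he₀]; exact (hΦd x).hasFDerivAt
  have hΦa : ContDiffAt ℝ ω Φ x := hΦ.contDiffAt
  have hstrict : HasStrictFDerivAt Φ (e₀ : Plane →L[ℝ] Plane) x :=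
    hΦa.hasStrictFDerivAt' hfd (by simp)
  let Ψ : Plane → Plane := hstrict.localInverse Φ e₀ x
  have hΨ : ContDiffAt ℝ ω Ψ 0 := by
    have := hΦa.to_localInverse hfd (by simp)
    rwa [hΦx] at this
  have hΨΦ : ∀ᶠ y in 𝓝 x, Ψ (Φ y) = y := hstrict.eventually_left_inverse
  let ψ : Plane → ℝ := fun y => Ψ y 0
  have hψ : ContDiffAt ℝ ω ψ 0 := (contDiffAt_euclidean.1 hΨ) 0
  -- the differential of `ψ` at the corner
  have hψd : ∀ v, fderiv ℝ ψ 0 !₂[1, 0] * fderiv ℝ (d.prodFun i₁) x v +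
      fderiv ℝ ψ 0 !₂[0, 1] * fderiv ℝ (d.prodFun i₂) x v = v 0 := by
    intro v
    have e1 : (fun y => ψ (Φ y)) =ᶠ[𝓝 x] (EuclideanSpace.proj 0 : Plane →L[ℝ] ℝ) := by
      filter_upwards [hΨΦ] with y hy
      simp only [ψ, hy]; rfl
    have e2 : HasFDerivAt ψ (fderiv ℝ ψ 0) (Φ x) := by
      rw [hΦx]; exact (hψ.differentiableAt (by simp)).hasFDerivAt
    have e3 : HasFDerivAt (fun y => ψ (Φ y)) ((fderiv ℝ ψ 0).comp (fderiv ℝ Φ x)) x :=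
      e2.comp x (hΦd x).hasFDerivAt
    have e4 := e1.fderiv_eq (𝕜 := ℝ)
    rw [e3.fderiv, (EuclideanSpace.proj 0 : Plane →L[ℝ] ℝ).fderiv] at e4
    have e5 := DFunLike.congr_fun e4 v
    change fderiv ℝ ψ 0 (fderiv ℝ Φ x v) = v 0 at e5
    rw [fderiv_plane_apply, hΦ0, hΦ1] at e5
    exact e5
  have hF1 : fderiv ℝ (d.prodFun i₁) x !₂[0, 1] ≠ 0 := by
    rw [fderiv_prodFun_of_zero h.circ hj]
    exact mul_ne_zero (h.adm.prod_erase_ne_zero hp.1 hj) hj2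
  have hF2 : fderiv ℝ (d.prodFun i₂) x !₂[0, 1] ≠ 0 := by
    rw [fderiv_prodFun_of_zero h.circ hk]
    exact mul_ne_zero (h.adm.prod_erase_ne_zero hp.1 hk) hk2
  -- The first coordinate is constant in the vertical direction, while both products vary. If one
  -- partial derivative of `ψ` vanished, so would the other, against the first coordinate varying
  -- horizontally.
  have hψ12 : fderiv ℝ ψ 0 !₂[1, 0] ≠ 0 ∧ fderiv ℝ ψ 0 !₂[0, 1] ≠ 0 := by
    have a1 := hψd !₂[0, 1]
    have a2 := hψd !₂[1, 0]
    simp only [Fin.isValue, Matrix.cons_val_zero] at a1 a2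
    constructor
    · intro h0
      rw [h0] at a1 a2
      rw [zero_mul, zero_add] at a1 a2
      rw [(mul_eq_zero.1 a1).resolve_right hF2] at a2
      simp at a2
    · intro h0
      rw [h0] at a1 a2
      rw [zero_mul, add_zero] at a1 a2
      rw [(mul_eq_zero.1 a1).resolve_right hF1] at a2
      simp at a2
  obtain ⟨O, hOsub, hO, h0O⟩ : ∃ O ⊆ {y | ContDiffAt ℝ ω ψ y ∧ fderiv ℝ ψ y !₂[1, 0] ≠ 0 ∧
      fderiv ℝ ψ y !₂[0, 1] ≠ 0}, IsOpen O ∧ (0 : Plane) ∈ O := by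
    apply mem_nhds_iff.1
    have hc : ContinuousAt (fderiv ℝ ψ) 0 := (hψ.fderiv_right (m := 0) (by simp)).continuousAt
    have hc1 : ContinuousAt (fun y => fderiv ℝ ψ y !₂[1, 0]) 0 := hc.clm_apply continuousAt_const
    have hc2 : ContinuousAt (fun y => fderiv ℝ ψ y !₂[0, 1]) 0 := hc.clm_apply continuousAt_const
    filter_upwards [hψ.eventually (by simp), hc1.eventually_ne hψ12.1, hc2.eventually_ne hψ12.2]
      with y h1 h2 h3 using ⟨h1, h2, h3⟩
  obtain ⟨T, hTsub, hT, hxT⟩ : ∃ T ⊆ {y | Ψ (Φ y) = y ∧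
      ∃ e : Plane ≃L[ℝ] Plane, (e : Plane →L[ℝ] Plane) = fderiv ℝ Φ y}, IsOpen T ∧ x ∈ T := by
    apply mem_nhds_iff.1
    have hc : ContinuousAt (fderiv ℝ Φ) x := (hΦa.fderiv_right (m := 0) (by simp)).continuousAt
    have hn := hc.eventually (he₀ ▸ e₀.nhds)
    filter_upwards [hΨΦ, hn] with y h1 h2
    obtain ⟨e, he⟩ := h2
    exact ⟨h1, e, he⟩
  set n₁ := d.μ i₁ + 1
  set n₂ := d.μ i₂ + 1
  let N : EuclideanSpace ℝ (Fin (n₁ + n₂)) → Plane := fun w =>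
    !₂[∑ a : Fin n₁, w (Fin.castAdd n₂ a) ^ 2, ∑ b : Fin n₂, w (Fin.natAdd n₁ b) ^ 2]
  have hN : ContDiff ℝ ω N := by
    rw [contDiff_euclidean]
    intro a
    fin_cases a
    · change ContDiff ℝ ω fun w : EuclideanSpace ℝ (Fin (n₁ + n₂)) =>
        ∑ a : Fin n₁, w (Fin.castAdd n₂ a) ^ 2
      fun_prop
    · change ContDiff ℝ ω fun w : EuclideanSpace ℝ (Fin (n₁ + n₂)) =>
        ∑ b : Fin n₂, w (Fin.natAdd n₁ b) ^ 2
      fun_prop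
  have hsq : ∀ {m : ℕ} (ι : Fin m → Fin (n₁ + n₂)) (w u : EuclideanSpace ℝ (Fin (n₁ + n₂))),
      fderiv ℝ (fun w : EuclideanSpace ℝ (Fin (n₁ + n₂)) => ∑ a, w (ι a) ^ 2) w u =
        ∑ a, 2 * w (ι a) * u (ι a) := by
    intro m ι w u
    have : HasFDerivAt (fun w : EuclideanSpace ℝ (Fin (n₁ + n₂)) => ∑ a, w (ι a) ^ 2)
        (∑ a, (2 * w (ι a)) • (EuclideanSpace.proj (ι a) :
          EuclideanSpace ℝ (Fin (n₁ + n₂)) →L[ℝ] ℝ)) w := by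
      refine HasFDerivAt.fun_sum fun a _ => ?_
      refine (((EuclideanSpace.proj (ι a) : EuclideanSpace ℝ (Fin (n₁ + n₂)) →L[ℝ]
        ℝ).hasFDerivAt (x := w)).pow 2).congr_fderiv ?_
      ext v; simp
    rw [this.fderiv]
    simp [sum_apply]
  have hNd : ∀ w, DifferentiableAt ℝ N w := hN.differentiable (by simp)
  let V : Set (EuclideanSpace ℝ (Fin (n₁ + n₂))) := N ⁻¹' O
  have hV : IsOpen V := hO.preimage hN.continuous
  let s : d.Ambient → EuclideanSpace ℝ (Fin (n₁ + n₂)) := fun q =>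
    WithLp.toLp 2 (Fin.append (fun a : Fin n₁ => q (Sum.inr ⟨i₁, a⟩))
      fun b : Fin n₂ => q (Sum.inr ⟨i₂, b⟩))
  have hs1 : ∀ q a, s q (Fin.castAdd n₂ a) = q (Sum.inr ⟨i₁, a⟩) := fun q a => by simp [s]
  have hs2 : ∀ q b, s q (Fin.natAdd n₁ b) = q (Sum.inr ⟨i₂, b⟩) := fun q b => by simp [s]
  have hs : ContDiff ℝ ∞ s := by
    rw [contDiff_euclidean]
    intro a
    refine Fin.addCases (fun a => ?_) (fun b => ?_) a
    · simp only [hs1]; fun_prop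
    · simp only [hs2]; fun_prop
  let U : Set d.Ambient := {q | d.proj q ∈ T ∧
    (∀ i, i ≠ i₁ → i ≠ i₂ → d.prodFun i (d.proj q) ≠ 0) ∧ s q ∈ V}
  have hprojc : Continuous d.proj := d.projL.continuous
  have hU : IsOpen U := by
    refine (hT.preimage hprojc).inter (IsOpen.inter ?_ (hV.preimage hs.continuous))
    have : {q : d.Ambient | ∀ i, i ≠ i₁ → i ≠ i₂ → d.prodFun i (d.proj q) ≠ 0} =
        ⋂ i, ⋂ (_ : i ≠ i₁), ⋂ (_ : i ≠ i₂), {q | d.prodFun i (d.proj q) ≠ 0} := by ext; simp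
    change IsOpen {q : d.Ambient | ∀ i, i ≠ i₁ → i ≠ i₂ → d.prodFun i (d.proj q) ≠ 0}
    rw [this]
    refine isOpen_iInter_of_finite fun i' => isOpen_iInter_of_finite fun _ =>
      isOpen_iInter_of_finite fun _ => ?_
    exact isOpen_ne_fun ((contDiff_prodFun (n := 0) h.circ i').continuous.comp hprojc)
      continuous_const
  have hNs : ∀ q ∈ d.zeroSet, N (s q) = Φ (d.proj q) := fun q hq => by
    apply plane_ext
    · change ∑ a : Fin n₁, s q (Fin.castAdd n₂ a) ^ 2 = d.prodFun i₁ (d.proj q)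
      simp only [hs1]; exact (d.mem_zeroSet.1 hq i₁).symm
    · change ∑ b : Fin n₂, s q (Fin.natAdd n₁ b) ^ 2 = d.prodFun i₂ (d.proj q)
      simp only [hs2]; exact (d.mem_zeroSet.1 hq i₂).symm
  have hpV : s p ∈ V := by
    change N (s p) ∈ O
    rw [hNs p hp.2, ← hx, hΦx]; exact h0O
  refine ⟨n₁ + n₂, U, s, V, fun w => ψ (N w), hU, ⟨hxT, hother, hpV⟩, hs.contDiffOn, ?_, hV,
    fun q hq => hq.1.2.2, ?_, ?_⟩
  · rintro q ⟨⟨hqT, hqo, -⟩, hq⟩ w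
    obtain ⟨-, e, he⟩ := hTsub hqT
    obtain ⟨v, hv⟩ := e.surjective !₂[2 * ∑ a : Fin n₁, q (Sum.inr ⟨i₁, a⟩) * w (Fin.castAdd n₂ a),
      2 * ∑ b : Fin n₂, q (Sum.inr ⟨i₂, b⟩) * w (Fin.natAdd n₁ b)]
    have hv' : fderiv ℝ Φ (d.proj q) v = _ := (DFunLike.congr_fun he v).symm.trans hv
    have hv0 := hΦ0 (d.proj q) v
    have hv1 := hΦ1 (d.proj q) v
    rw [hv'] at hv0 hv1
    let W : (Σ i : Fin d.l₂, Fin (d.μ i + 1)) → ℝ := fun ik =>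
      if hik : ik.1 = i₁ then w (Fin.castAdd n₂ (Fin.cast (by rw [hik]) ik.2))
      else if hik : ik.1 = i₂ then w (Fin.natAdd n₁ (Fin.cast (by rw [hik]) ik.2)) else 0
    have hW1 : ∀ a, W ⟨i₁, a⟩ = w (Fin.castAdd n₂ a) := fun a => by simp [W]
    have hW2 : ∀ b, W ⟨i₂, b⟩ = w (Fin.natAdd n₁ b) := fun b => by simp [W, hi12.symm]
    obtain ⟨X, hX, -, hXW⟩ := exists_tangent_vector h.circ hq.2 {i₁, i₂}
      (fun i hi => hqo i (fun e => hi (Or.inl e)) fun e => hi (Or.inr e)) v W (by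
        rintro _ (rfl | rfl)
        · simp only [hW1]; exact hv0.symm
        · simp only [hW2]; exact hv1.symm)
    refine ⟨X, hX, ?_⟩
    have hsd : DifferentiableAt ℝ s q := hs.differentiable (by simp) q
    ext a
    rw [fderiv_euclidean_apply hsd]
    refine Fin.addCases (fun a => ?_) (fun b => ?_) a
    · simp only [hs1]
      have e1 : HasFDerivAt (fun q : d.Ambient => q (Sum.inr ⟨i₁, a⟩)) _ q :=
        (EuclideanSpace.proj (Sum.inr ⟨i₁, a⟩) : d.Ambient →L[ℝ] ℝ).hasFDerivAt
      rw [e1.fderiv, ← hW1, ← hXW i₁ (Or.inl rfl)]; rfl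
    · simp only [hs2]
      have e1 : HasFDerivAt (fun q : d.Ambient => q (Sum.inr ⟨i₂, b⟩)) _ q :=
        (EuclideanSpace.proj (Sum.inr ⟨i₂, b⟩) : d.Ambient →L[ℝ] ℝ).hasFDerivAt
      rw [e1.fderiv, ← hW2, ← hXW i₂ (Or.inr rfl)]; rfl
  · refine isMorseOn_of_diag hV (fun w hw => ?_)
      (Fin.append (fun _ w => 2 * fderiv ℝ ψ (N w) !₂[1, 0])
        fun _ w => 2 * fderiv ℝ ψ (N w) !₂[0, 1]) ?_ ?_ ?_
    · exact (((hOsub hw).1.of_le (by simp)).comp w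
        (hN.contDiffAt.of_le (by simp))).contDiffWithinAt
    · intro a w hw
      have e1 : DifferentiableAt ℝ (fderiv ℝ ψ) (N w) :=
        ((hOsub hw).1.fderiv_right (m := 1) (by simp)).differentiableAt (by simp)
      have e2 : DifferentiableAt ℝ (fun w => fderiv ℝ ψ (N w)) w := e1.comp w (hNd w)
      have e3 : ∀ v : Plane, DifferentiableAt ℝ (fun w => 2 * fderiv ℝ ψ (N w) v) w := fun v =>
        (e2.clm_apply (differentiableAt_const v)).const_mul 2
      refine Fin.addCases (fun a => ?_) (fun b => ?_) a
      · rw [Fin.append_left]; exact e3 _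
      · rw [Fin.append_right]; exact e3 _
    · intro a w hw
      refine Fin.addCases (fun a => ?_) (fun b => ?_) a
      · rw [Fin.append_left]; exact mul_ne_zero two_ne_zero (hOsub hw).2.1
      · rw [Fin.append_right]; exact mul_ne_zero two_ne_zero (hOsub hw).2.2
    · intro w hw u
      have e1 : DifferentiableAt ℝ ψ (N w) := (hOsub hw).1.differentiableAt (by simp)
      have e2 : HasFDerivAt (fun w => ψ (N w)) _ w := e1.hasFDerivAt.comp w (hNd w).hasFDerivAt
      rw [e2.fderiv, ContinuousLinearMap.comp_apply, fderiv_plane_apply,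
        fderiv_euclidean_apply (hNd w), fderiv_euclidean_apply (hNd w)]
      have e3 : fderiv ℝ (fun w => N w 0) w u = ∑ a, 2 * w (Fin.castAdd n₂ a) * u (Fin.castAdd n₂ a) :=
        hsq _ w u
      have e4 : fderiv ℝ (fun w => N w 1) w u = ∑ b, 2 * w (Fin.natAdd n₁ b) * u (Fin.natAdd n₁ b) :=
        hsq _ w u
      rw [e3, e4]
      refine Eq.trans ?_ (Fin.sum_univ_add _).symm
      simp only [Fin.append_left, Fin.append_right, Finset.mul_sum]
      congr 1 <;> exact Finset.sum_congr rfl fun _ _ => by ring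
  · rintro q ⟨⟨hqT, -⟩, hq⟩
    change d.proj q 0 = Ψ (N (s q)) 0
    rw [hNs q hq.2, (hTsub hqT).1]

/-- The height of good data is a Morse-Bott function if the curves are not vertical at their
intersection points. -/
theorem IsGood.isMorseBott {i₀ : Fin d.l₂} (h : d.IsGood i₀)
    (hcorner : ∀ x ∈ closure d.D, ∀ j k, j ≠ k → polyFun (d.f j) x = 0 → polyFun (d.f k) x = 0 →
      fderiv ℝ (polyFun (d.f j)) x !₂[0, 1] ≠ 0) :
    IsMorseBott d.manifold d.tangent d.height := by
  refine ⟨contDiff_height, fun p hp => ?_⟩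
  rcases sing_cases ((h.adm.mem_singularPoints_iff h.circ hp.1).1 hp) with
    ⟨j, h1, h2, h3⟩ | ⟨j, k, hjk, h1, h2⟩
  · exact h.exists_morse_extreme hp.1 h1 h2 h3
  · exact h.exists_morse_corner hp.1 hjk h1 h2 (hcorner _ hp.1.1 j k hjk h1 h2)
      (hcorner _ hp.1.1 k j hjk.symm h2 h1)

end MomentData

/-! ### Plane regions bounded by disjoint circles -/

theorem dist_sq_plane (x y : Plane) : dist x y ^ 2 = (x 0 - y 0) ^ 2 + (x 1 - y 1) ^ 2 := by
  rw [EuclideanSpace.dist_eq, Real.sq_sqrt (by positivity), Fin.sum_univ_two, Real.dist_eq,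
    Real.dist_eq, sq_abs, sq_abs]

theorem circFun_eq_dist (s : ℝ) (P : Plane) (r : ℝ) (x : Plane) :
    circFun s P r x = s * (dist x P ^ 2 - r ^ 2) := by
  rw [dist_sq_plane, circFun]

/-- The points of a circle nearest to and farthest from a given point. -/
theorem exists_circle_points (P Q : Plane) {r : ℝ} (hr : 0 < r) :
    (∃ x, dist x P = r ∧ dist x Q = |dist P Q - r|) ∧
      ∃ x, dist x P = r ∧ dist x Q = dist P Q + r := by
  obtain ⟨u, hu, hPQ⟩ : ∃ u : Plane, ‖u‖ = 1 ∧ Q = P + dist P Q • u := by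
    by_cases h : P = Q
    · exact ⟨EuclideanSpace.single 0 1, by simp, by simp [h]⟩
    · have h0 : ‖Q - P‖ ≠ 0 := norm_ne_zero_iff.2 (sub_ne_zero.2 (Ne.symm h))
      refine ⟨‖Q - P‖⁻¹ • (Q - P), ?_, ?_⟩
      · rw [norm_smul, norm_inv, norm_norm, inv_mul_cancel₀ h0]
      · rw [dist_comm, dist_eq_norm, smul_smul, mul_inv_cancel₀ h0, one_smul]; abel
  set δ := dist P Q with hδ
  have hδ0 : 0 ≤ δ := dist_nonneg
  constructor
  · refine ⟨P + r • u, ?_, ?_⟩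
    · rw [dist_eq_norm, add_sub_cancel_left, norm_smul, hu, mul_one, Real.norm_of_nonneg hr.le]
    · rw [dist_eq_norm]
      nth_rw 1 [hPQ]
      rw [show P + r • u - (P + δ • u) = (r - δ) • u by rw [sub_smul]; abel, norm_smul, hu, mul_one,
        Real.norm_eq_abs, abs_sub_comm]
  · refine ⟨P - r • u, ?_, ?_⟩
    · rw [dist_eq_norm, sub_sub_cancel_left, norm_neg, norm_smul, hu, mul_one,
        Real.norm_of_nonneg hr.le]
    · rw [dist_eq_norm]
      nth_rw 1 [hPQ]
      rw [show P - r • u - (P + δ • u) = (-(δ + r)) • u by rw [neg_smul, add_smul]; abel, norm_smul,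
        hu, mul_one, Real.norm_eq_abs, abs_neg, abs_of_pos (by linarith)]

theorem IsCircFun.isConnected_zero {φ : Plane → ℝ} (h : IsCircFun φ) :
    IsConnected {x | φ x = 0} := by
  obtain ⟨s, P, r, hr, hs, rfl⟩ := h
  have hs0 : s ≠ 0 := by rcases hs with rfl | rfl <;> norm_num
  have : {x | circFun s P r x = 0} = Metric.sphere P r := by
    ext x
    simp only [mem_ofPred_eq, circFun_eq_dist, mul_eq_zero, hs0, false_or, Metric.mem_sphere]
    constructor
    · intro h
      exact (pow_left_inj₀ dist_nonneg hr.le two_ne_zero).1 (by linarith)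
    · rintro rfl; ring
  rw [this]
  apply isConnected_sphere _ _ hr.le
  rw [← Module.finrank_eq_rank, finrank_euclideanSpace, Fintype.card_fin]
  norm_num

theorem IsCircFun.fderiv_ne_zero {φ : Plane → ℝ} (h : IsCircFun φ) {x : Plane} (hx : φ x = 0) :
    fderiv ℝ φ x ≠ 0 := by
  obtain ⟨s, P, r, hr, hs, rfl⟩ := h
  have hs0 : s ≠ 0 := by rcases hs with rfl | rfl <;> norm_num
  intro h0
  have h1 : fderiv ℝ (circFun s P r) x !₂[1, 0] = 0 := by rw [h0]; rfl
  have h2 : fderiv ℝ (circFun s P r) x !₂[0, 1] = 0 := by rw [h0]; rfl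
  rw [fderiv_circFun] at h1 h2
  simp [hs0] at h1 h2
  simp [circFun, hs0, h1, h2] at hx
  exact hr.ne' hx

/-- Two circles, the functions of which are positive on each other: there is no point at which one
function is negative and the other one is nonpositive. -/
theorem circFun_pos_of_neg {φ ψ : Plane → ℝ} (hφ : IsCircFun φ) (hψ : IsCircFun ψ)
    (h1 : ∀ x, φ x = 0 → 0 < ψ x) (h2 : ∀ x, ψ x = 0 → 0 < φ x) {x : Plane} (hx : φ x < 0) :
    0 < ψ x := by
  obtain ⟨s, P, r, hr, hs, rfl⟩ := hφ
  obtain ⟨s', P', r', hr', hs', rfl⟩ := hψ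
  by_contra hcon
  push Not at hcon
  -- Evaluated at the nearest and farthest points from the other centre, the two hypotheses become
  -- inequalities between the radii and the distance of the centres.
  obtain ⟨⟨a, ha, ha'⟩, b, hb, hb'⟩ := exists_circle_points P P' hr
  obtain ⟨⟨a₂, ha₂, ha₂'⟩, b₂, hb₂, hb₂'⟩ := exists_circle_points P' P hr'
  have t1 := dist_triangle P x P'
  have t2 := dist_triangle x P P'
  have t3 := dist_triangle x P' P
  have A := h1 a (by rw [circFun_eq_dist, ha]; ring)
  have B := h1 b (by rw [circFun_eq_dist, hb]; ring)
  have A₂ := h2 a₂ (by rw [circFun_eq_dist, ha₂]; ring)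
  have B₂ := h2 b₂ (by rw [circFun_eq_dist, hb₂]; ring)
  rw [circFun_eq_dist] at A B A₂ B₂ hx hcon
  rw [ha'] at A; rw [hb'] at B; rw [ha₂'] at A₂; rw [hb₂'] at B₂
  rw [dist_comm P' P] at A₂ B₂ t3
  rw [dist_comm P x] at t1
  set δ := dist P P'
  set α := dist x P
  set β := dist x P'
  have hδ : 0 ≤ δ := dist_nonneg
  have hα : 0 ≤ α := dist_nonneg
  have hβ : 0 ≤ β := dist_nonneg
  rw [sq_abs] at A A₂
  -- Two exteriors force disjoint discs, opposite signs force one disc strictly inside the other,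
  -- and two interiors are impossible.
  rcases hs with rfl | rfl <;> rcases hs' with rfl | rfl
  · have e1 : r' < |δ - r| := by
      have := sq_lt_sq.1 (show r' ^ 2 < (δ - r) ^ 2 by linarith)
      rwa [abs_of_pos hr'] at this
    have e2 : r < |δ - r'| := by
      have := sq_lt_sq.1 (show r ^ 2 < (δ - r') ^ 2 by linarith)
      rwa [abs_of_pos hr] at this
    have e3 : α < r := lt_of_pow_lt_pow_left₀ 2 hr.le (by linarith)
    have e4 : β ≤ r' := le_of_sq_le_sq (by linarith) hr'.le
    rcases lt_abs.1 e1 with e1 | e1 <;> rcases lt_abs.1 e2 with e2 | e2 <;> linarith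
  · have e1 : δ + r < r' := lt_of_pow_lt_pow_left₀ 2 hr'.le (by linarith)
    have e3 : α < r := lt_of_pow_lt_pow_left₀ 2 hr.le (by linarith)
    have e4 : r' ≤ β := le_of_sq_le_sq (by linarith) hβ
    linarith
  · have e1 : δ + r' < r := lt_of_pow_lt_pow_left₀ 2 hr.le (by linarith)
    have e3 : r < α := lt_of_pow_lt_pow_left₀ 2 hα (by linarith)
    have e4 : β ≤ r' := le_of_sq_le_sq (by linarith) hr'.le
    linarith
  · have e1 : δ + r < r' := lt_of_pow_lt_pow_left₀ 2 hr'.le (by linarith)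
    have e2 : δ + r' < r := lt_of_pow_lt_pow_left₀ 2 hr.le (by linarith)
    linarith

/-! ### Ends of slices -/

theorem sliceRel_iff {K : Set Plane} {x z : Plane} :
    SliceRel K x z ↔ z 0 = x 0 ∧ ∀ τ ∈ Icc (0 : ℝ) 1, (!₂[x 0, x 1 + τ * (z 1 - x 1)] : Plane) ∈ K := by
  constructor
  · rintro ⟨h0, h1⟩
    refine ⟨h0.symm, fun τ hτ => h1 _ rfl ?_⟩
    have e : (!₂[x 0, x 1 + τ * (z 1 - x 1)] : Plane) 1 = x 1 + τ * (z 1 - x 1) := rfl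
    rw [e]
    rcases le_total (x 1) (z 1) with h | h
    · rw [uIcc_of_le h]; exact ⟨by nlinarith [hτ.1], by nlinarith [hτ.2]⟩
    · rw [uIcc_of_ge h]; exact ⟨by nlinarith [hτ.2], by nlinarith [hτ.1]⟩
  · rintro ⟨h0, h1⟩
    refine ⟨h0.symm, fun w hw0 hw1 => ?_⟩
    by_cases hxz : x 1 = z 1
    · rw [hxz, uIcc_self] at hw1
      have := h1 0 (by simp)
      convert this using 1
      exact plane_ext hw0 (by simpa [hxz] using hw1)
    · have hne : z 1 - x 1 ≠ 0 := sub_ne_zero.2 (Ne.symm hxz)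
      have := h1 ((w 1 - x 1) / (z 1 - x 1)) (by
        rcases lt_or_gt_of_ne hxz with h | h
        · rw [uIcc_of_le h.le] at hw1
          exact ⟨div_nonneg (by linarith [hw1.1]) (by linarith),
            (div_le_one (by linarith)).2 (by linarith [hw1.2])⟩
        · rw [uIcc_of_ge h.le] at hw1
          exact ⟨div_nonneg_of_nonpos (by linarith [hw1.2]) (by linarith),
            (div_le_one_of_neg (by linarith)).2 (by linarith [hw1.1])⟩)
      convert this using 1
      refine plane_ext hw0 ?_
      change w 1 = x 1 + (w 1 - x 1) / (z 1 - x 1) * (z 1 - x 1)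
      rw [div_mul_cancel₀ _ hne]; ring

theorem isClosed_sliceClass {K : Set Plane} (hK : IsClosed K) (x : Plane) :
    IsClosed {z | SliceRel K x z} := by
  simp only [sliceRel_iff]
  refine (isClosed_eq (by fun_prop) continuous_const).inter ?_
  have : {z : Plane | ∀ τ ∈ Icc (0 : ℝ) 1, (!₂[x 0, x 1 + τ * (z 1 - x 1)] : Plane) ∈ K} =
      ⋂ τ ∈ Icc (0 : ℝ) 1, (fun z : Plane => (!₂[x 0, x 1 + τ * (z 1 - x 1)] : Plane)) ⁻¹' K := by
    ext; simp
  change IsClosed {z : Plane | ∀ τ ∈ Icc (0 : ℝ) 1, (!₂[x 0, x 1 + τ * (z 1 - x 1)] : Plane) ∈ K}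
  rw [this]
  exact isClosed_biInter fun τ _ => hK.preimage (by fun_prop)

/-- The upper (`σ = 1`) or lower (`σ = -1`) end of a slice. -/
theorem exists_slice_end {K : Set Plane} (hK : IsCompact K) {x : Plane} (hx : x ∈ K) (σ : ℝ) :
    ∃ z, SliceRel K x z ∧ ∀ w, SliceRel K x w → σ * w 1 ≤ σ * z 1 := by
  have hc : IsCompact {z | SliceRel K x z} :=
    hK.of_isClosed_subset (isClosed_sliceClass hK.isClosed x) fun z hz => SliceRel.right_mem hz
  obtain ⟨z, hz, hmax⟩ := hc.exists_isMaxOn ⟨x, SliceRel.refl hx⟩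
    (f := fun w : Plane => σ * w 1) (by fun_prop)
  exact ⟨z, hz, fun w hw => hmax hw⟩

/-- The end of a slice is not an interior point. -/
theorem not_mem_of_slice_end {K D : Set Plane} (hD : IsOpen D) (hDK : D ⊆ K) {x z : Plane} {σ : ℝ}
    (hσ : σ = 1 ∨ σ = -1) (hz : SliceRel K x z)
    (hmax : ∀ w, SliceRel K x w → σ * w 1 ≤ σ * z 1) : z ∉ D := by
  intro hzD
  have hc : Continuous fun u : ℝ => (!₂[z 0, z 1 + σ * u] : Plane) := by fun_prop
  have h0 : (!₂[z 0, z 1 + σ * 0] : Plane) = z := plane_ext rfl (by simp)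
  have : (fun u : ℝ => (!₂[z 0, z 1 + σ * u] : Plane)) ⁻¹' D ∈ 𝓝 (0 : ℝ) :=
    hc.continuousAt (by rw [h0]; exact hD.mem_nhds hzD)
  obtain ⟨η, hη, hsub⟩ := Metric.mem_nhds_iff.1 this
  rw [Real.ball_eq_Ioo] at hsub
  have hrel : SliceRel K z !₂[z 0, z 1 + σ * (η / 2)] := by
    refine ⟨rfl, fun w hw0 hw1 => hDK ?_⟩
    have hw1' : w 1 ∈ uIcc (z 1) (z 1 + σ * (η / 2)) := hw1
    have hw : w = !₂[z 0, z 1 + σ * (σ * (w 1 - z 1))] := by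
      refine plane_ext hw0 ?_
      change w 1 = z 1 + σ * (σ * (w 1 - z 1))
      rcases hσ with rfl | rfl <;> ring
    rw [hw]
    apply hsub
    rcases hσ with rfl | rfl
    · rw [uIcc_of_le (by linarith)] at hw1'
      exact ⟨by linarith [hw1'.1], by linarith [hw1'.2]⟩
    · rw [uIcc_of_ge (by linarith)] at hw1'
      exact ⟨by linarith [hw1'.2], by linarith [hw1'.1]⟩
  have := hmax _ (hz.trans hrel)
  change σ * (z 1 + σ * (η / 2)) ≤ σ * z 1 at this
  rcases hσ with rfl | rfl <;> linarith

/-! ### The original data -/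

namespace MomentData

variable {d : MomentData}

theorem IsAdmissible.closure_subset (h : d.IsAdmissible) (hc : ∀ j, IsCircFun (polyFun (d.f j))) :
    d.D ⊆ {x | ∀ j, 0 < polyFun (d.f j) x} ∧ closure d.D ⊆ {x | ∀ j, 0 ≤ polyFun (d.f j) x} := by
  obtain ⟨U, hU, hDU, hD⟩ := h.eq_pos
  have h1 : d.D ⊆ {x | ∀ j, 0 < polyFun (d.f j) x} := by
    rw [hD U hU hDU Subset.rfl]; exact inter_subset_right
  refine ⟨h1, ?_⟩
  have hcl : IsClosed {x | ∀ j, 0 ≤ polyFun (d.f j) x} := by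
    rw [show {x | ∀ j, 0 ≤ polyFun (d.f j) x} = ⋂ j, {x | 0 ≤ polyFun (d.f j) x} by ext; simp]
    exact isClosed_iInter fun j => isClosed_le continuous_const (hc j).continuous
  exact closure_minimal (fun x hx j => (h1 hx j).le) hcl

section Disjoint

variable (h : d.IsAdmissible) (hc : ∀ j, IsCircFun (polyFun (d.f j)))
  (hdisj : ∀ i j, i ≠ j → Disjoint (curve (d.f i)) (curve (d.f j)))
  (hbdry : closure d.D \ d.D = ⋃ j, curve (d.f j))

include h hc hbdry

omit h hc in
theorem curve_subset_closure (j : Fin d.l₁) : curve (d.f j) ⊆ closure d.D := fun x hx =>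
  (hbdry.symm ▸ mem_iUnion.2 ⟨j, hx⟩ : x ∈ closure d.D \ d.D).1

/-- The points outside `D` at which all functions are positive form a clopen subset of the plane. A
limit point of it on a curve would lie in `closure d.D`, and near that closure positivity implies
membership in `D`. As `D` is non-empty, the clopen set is empty. -/
theorem region_eq_of_boundary : d.D = {x | ∀ j, 0 < polyFun (d.f j) x} := by
  obtain ⟨hD, hcl⟩ := h.closure_subset hc
  refine Subset.antisymm hD fun x hx => ?_
  by_contra hxD
  set P := {x | ∀ j, 0 < polyFun (d.f j) x} with hP
  have hPo : IsOpen P := by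
    rw [show P = ⋂ j, {x | 0 < polyFun (d.f j) x} by ext; simp [hP]]
    exact isOpen_iInter_of_finite fun j => isOpen_lt continuous_const (hc j).continuous
  have hPc : P ∩ closure d.D ⊆ d.D := by
    rintro y ⟨hy, hy'⟩
    by_contra hyD
    have : y ∈ closure d.D \ d.D := ⟨hy', hyD⟩
    rw [hbdry] at this
    obtain ⟨j, hj⟩ := mem_iUnion.1 this
    exact (hy j).ne' hj
  have hQo : IsOpen (P \ d.D) := by
    have : P \ d.D = P \ closure d.D := by
      ext y
      exact ⟨fun hy => ⟨hy.1, fun hy' => hy.2 (hPc ⟨hy.1, hy'⟩)⟩,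
        fun hy => ⟨hy.1, fun hy' => hy.2 (subset_closure hy')⟩⟩
    rw [this]; exact hPo.sdiff isClosed_closure
  have hQc : IsClosed (P \ d.D) := by
    rw [← closure_subset_iff_isClosed]
    intro q hq
    have hq0 : ∀ j, 0 ≤ polyFun (d.f j) q := by
      have : closure (P \ d.D) ⊆ {x | ∀ j, 0 ≤ polyFun (d.f j) x} := by
        refine closure_minimal (fun y hy j => (hy.1 j).le) ?_
        rw [show {x | ∀ j, 0 ≤ polyFun (d.f j) x} = ⋂ j, {x | 0 ≤ polyFun (d.f j) x} by ext; simp]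
        exact isClosed_iInter fun j => isClosed_le continuous_const (hc j).continuous
      exact this hq
    by_cases hqP : q ∈ P
    · refine ⟨hqP, fun hqD => ?_⟩
      obtain ⟨y, hy, hy'⟩ := mem_closure_iff_nhds.1 hq _ (h.isOpen.mem_nhds hqD)
      exact hy'.2 hy
    · obtain ⟨j, hj⟩ : ∃ j, polyFun (d.f j) q = 0 := by
        by_contra hcon
        push Not at hcon
        exact hqP fun j => lt_of_le_of_ne (hq0 j) (Ne.symm (hcon j))
      obtain ⟨U, hU, hDU, hUD⟩ := h.eq_pos
      have hqU : q ∈ U := hDU (curve_subset_closure hbdry j hj)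
      obtain ⟨y, hy, hy'⟩ := mem_closure_iff_nhds.1 hq _ (hU.mem_nhds hqU)
      refine (hy'.2 ?_).elim
      rw [hUD U hU hDU Subset.rfl]
      exact ⟨hy, hy'.1⟩
  rcases isClopen_iff.1 ⟨hQc, hQo⟩ with h0 | h0
  · rw [eq_empty_iff_forall_notMem] at h0
    exact h0 x ⟨hx, hxD⟩
  · obtain ⟨y, hy⟩ := h.isConnected.nonempty
    have : y ∈ P \ d.D := h0 ▸ mem_univ y
    exact this.2 hy

theorem closure_eq_of_boundary : closure d.D = {x | ∀ j, 0 ≤ polyFun (d.f j) x} := by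
  refine Subset.antisymm (h.closure_subset hc).2 fun x hx => ?_
  by_cases hex : ∃ j, polyFun (d.f j) x = 0
  · obtain ⟨j, hj⟩ := hex
    exact curve_subset_closure hbdry j hj
  · push Not at hex
    apply subset_closure
    rw [region_eq_of_boundary h hc hbdry]
    exact fun j => lt_of_le_of_ne (hx j) (Ne.symm (hex j))

-- Every circle lies in the closed region and is disjoint from the others, so the functions are
-- positive on each other's circles and `circFun_pos_of_neg` applies.
include hdisj in
theorem pos_of_neg_of_boundary {i j : Fin d.l₁} (hij : i ≠ j) {x : Plane}
    (hx : polyFun (d.f i) x < 0) : 0 < polyFun (d.f j) x := by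
  have key : ∀ i j, i ≠ j → ∀ x, polyFun (d.f i) x = 0 → 0 < polyFun (d.f j) x := by
    intro i j hij x hx
    have h1 := (h.closure_subset hc).2 (curve_subset_closure hbdry i hx) j
    refine lt_of_le_of_ne h1 fun h0 => ?_
    exact disjoint_left.1 (hdisj i j hij) hx h0.symm
  exact circFun_pos_of_neg (hc i) (hc j) (key i j hij) (key j i hij.symm) hx

omit hc in
theorem nonempty_index_of_boundary : Nonempty (Fin d.l₁) := by
  by_contra hcon
  rw [not_nonempty_iff] at hcon
  rw [iUnion_of_empty] at hbdry
  have hcl : IsClosed d.D := by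
    rw [← closure_subset_iff_isClosed]; exact sdiff_eq_empty.1 hbdry
  rcases isClopen_iff.1 ⟨hcl, h.isOpen⟩ with h0 | h0
  · exact h.isConnected.nonempty.ne_empty h0
  · have := h.isCompact_closure
    rw [h0, closure_univ] at this
    exact noncompact_univ Plane this

-- With one colour there are no other spheres to consider, and the upper end of each slice is a
-- boundary point, where the product vanishes.
include hdisj in
theorem isGood_of_boundary (hl₂ : d.l₂ = 1) (i₀ : Fin d.l₂) : d.IsGood i₀ where
  adm := h
  circ := hc
  region := region_eq_of_boundary h hc hbdry
  closure_region := closure_eq_of_boundary h hc hbdry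
  finite_inter i j hij := by
    rw [(hdisj i j hij).inter_eq]; exact finite_empty
  pos i hi := by
    have h1 := i.2
    have h2 := i₀.2
    exact (hi (Fin.ext (by omega))).elim
  exists_zero x hx := by
    obtain ⟨z, hz, hmax⟩ := exists_slice_end h.isCompact_closure hx 1
    have hzD := not_mem_of_slice_end h.isOpen subset_closure (Or.inl rfl) hz hmax
    have : z ∈ closure d.D \ d.D := ⟨hz.right_mem, hzD⟩
    rw [hbdry] at this
    obtain ⟨j, hj⟩ := mem_iUnion.1 this
    refine ⟨z, hz, prodFun_eq_zero_iff.2 ⟨j, ?_, hj⟩⟩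
    have h1 := (d.c j).2
    have h2 := i₀.2
    exact Fin.ext (by omega)

end Disjoint

end MomentData

namespace MomentData

theorem continuous_polyFun {σ : Type*} [Fintype σ] (P : MvPolynomial σ ℝ) :
    Continuous (polyFun P) :=
  (MvPolynomial.continuous_eval P).comp (PiLp.continuous_ofLp 2 _)

/-! ### Small circles centred on the boundary -/

/-- The closed rectangle with centre `p` and half side lengths `r` and `H`. -/
def rect (p : Plane) (r H : ℝ) : Set Plane := {x | |x 0 - p 0| ≤ r ∧ |x 1 - p 1| ≤ H}

/-- A point `p` on the upper boundary of the region, on the curve of index `k`, in a rectangle that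
meets no other curve, and in which the function of the curve decreases strictly with the second
coordinate and increases strictly with `σ` times the first one. -/
structure IsSite (d : MomentData) (k : Fin d.l₁) (p : Plane) (σ r H : ℝ) : Prop where
  sign : σ = 1 ∨ σ = -1
  r_pos : 0 < r
  r_lt : r < H
  zero : polyFun (d.f k) p = 0
  others : ∀ x ∈ rect p r H, ∀ j, j ≠ k → 0 < polyFun (d.f j) x
  mono : ∀ x ∈ rect p r H, ∀ y ∈ rect p r H, σ * x 0 ≤ σ * y 0 → y 1 ≤ x 1 → x ≠ y →
    polyFun (d.f k) x < polyFun (d.f k) y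
  vert : ∀ x ∈ rect p r H, fderiv ℝ (polyFun (d.f k)) x !₂[0, 1] < 0
  horiz : ∀ x ∈ rect p r H, 0 < σ * fderiv ℝ (polyFun (d.f k)) x !₂[1, 0]
  top : polyFun (d.f k) !₂[p 0 + σ * r, p 1 + H] < 0

variable {d : MomentData}

/-- Where both partial derivatives have a fixed sign, an increment of a circle function is a
combination of the increments of the coordinates with coefficients of these signs. This gives strict
monotonicity on whole rectangles. The half height `H` is fixed first and only `r` shrinks: the
function is negative at height `H` above `p`, and remains so after a small horizontal move. -/
theorem exists_isSite (hc : ∀ j, IsCircFun (polyFun (d.f j))) {k : Fin d.l₁} {p : Plane}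
    (hk : polyFun (d.f k) p = 0) (hothers : ∀ j, j ≠ k → 0 < polyFun (d.f j) p)
    (h2 : fderiv ℝ (polyFun (d.f k)) p !₂[0, 1] < 0)
    (h1 : fderiv ℝ (polyFun (d.f k)) p !₂[1, 0] ≠ 0) :
    ∃ σ H, ∀ᶠ r in 𝓝[>] (0 : ℝ), IsSite d k p σ r H := by
  obtain ⟨s, P, R, hR, hs, hf⟩ := hc k
  rw [hf, fderiv_circFun] at h1 h2
  have h1' : s * (p 0 - P 0) ≠ 0 := fun h0 => h1 (by
    simp; exact mul_eq_zero.1 h0)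
  have h2' : s * (p 1 - P 1) < 0 := by simp at h2; linarith
  obtain ⟨σ, hσ, hσp⟩ : ∃ σ : ℝ, (σ = 1 ∨ σ = -1) ∧ 0 < σ * (s * (p 0 - P 0)) := by
    rcases lt_or_gt_of_ne h1' with h0 | h0
    · exact ⟨-1, Or.inr rfl, by linarith⟩
    · exact ⟨1, Or.inl rfl, by linarith⟩
  have hσ2 : σ * σ = 1 := by rcases hσ with rfl | rfl <;> norm_num
  have hN : ∀ᶠ y in 𝓝 p, (∀ j, j ≠ k → 0 < polyFun (d.f j) y) ∧ s * (y 1 - P 1) < 0 ∧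
      0 < σ * (s * (y 0 - P 0)) := by
    refine Filter.Eventually.and ?_ (Filter.Eventually.and ?_ ?_)
    · rw [Filter.eventually_all]
      intro j
      by_cases hj : j = k
      · exact Filter.Eventually.of_forall fun y hy => (hy hj).elim
      · filter_upwards [(hc j).continuous.continuousAt.eventually (lt_mem_nhds (hothers j hj))]
          with y hy _ using hy
    · have : Continuous fun y : Plane => s * (y 1 - P 1) := by fun_prop
      exact this.continuousAt.eventually (gt_mem_nhds h2')
    · have : Continuous fun y : Plane => σ * (s * (y 0 - P 0)) := by fun_prop
      exact this.continuousAt.eventually (lt_mem_nhds hσp)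
  obtain ⟨η, hη, hball⟩ := Metric.eventually_nhds_iff.1 hN
  have hbox : ∀ r, r < η / 2 → ∀ y ∈ rect p r (η / 2), dist y p < η := by
    intro r hr y hy
    refine lt_of_pow_lt_pow_left₀ 2 hη.le ?_
    rw [dist_sq_plane, ← sq_abs (y 0 - p 0), ← sq_abs (y 1 - p 1)]
    have a1 := pow_le_pow_left₀ (abs_nonneg _) (hy.1.trans hr.le) 2
    have a2 := pow_le_pow_left₀ (abs_nonneg _) hy.2 2
    nlinarith
  refine ⟨σ, η / 2, ?_⟩
  have htop : ∀ᶠ r in 𝓝[>] (0 : ℝ), polyFun (d.f k) !₂[p 0 + σ * r, p 1 + η / 2] < 0 := by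
    have hcont : Continuous fun r : ℝ => polyFun (d.f k) !₂[p 0 + σ * r, p 1 + η / 2] :=
      (hc k).continuous.comp (by fun_prop)
    refine nhdsWithin_le_nhds (hcont.continuousAt.eventually (gt_mem_nhds ?_))
    have e := circFun_sub_vertical s P R (z := p) (w := !₂[p 0 + σ * 0, p 1 + η / 2]) (by simp)
    rw [← hf, hk, sub_zero] at e
    beta_reduce
    rw [e]
    simp only [Fin.isValue, Matrix.cons_val_one, Matrix.cons_val_fin_one]
    have hd : dist (!₂[p 0, p 1 + η / 2] : Plane) p < η := by
      refine lt_of_pow_lt_pow_left₀ 2 hη.le ?_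
      rw [dist_sq_plane]; simp; nlinarith
    have := (hball hd).2.1
    simp only [Fin.isValue, Matrix.cons_val_one, Matrix.cons_val_fin_one] at this
    have h3 : s * (p 1 + η / 2 + p 1 - 2 * P 1) < 0 := by linarith
    have := mul_pos (half_pos hη) (neg_pos.2 h3)
    linarith
  filter_upwards [htop, self_mem_nhdsWithin, nhdsWithin_le_nhds (gt_mem_nhds (half_pos hη))]
    with r hr1 hr2 hr3
  have hB : ∀ y ∈ rect p r (η / 2), _ := fun y hy => hball (hbox r hr3 y hy)
  refine ⟨hσ, hr2, hr3, hk, fun x hx => (hB x hx).1, ?_, ?_, ?_, hr1⟩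
  · intro x hx y hy h0 h1 hne
    obtain ⟨-, x1, x0⟩ := hB x hx
    obtain ⟨-, y1, y0⟩ := hB y hy
    rw [hf, ← sub_pos]
    have e : circFun s P R y - circFun s P R x =
        (σ * y 0 - σ * x 0) * (σ * (s * (x 0 - P 0)) + σ * (s * (y 0 - P 0))) +
          (x 1 - y 1) * (-(s * (x 1 - P 1)) + -(s * (y 1 - P 1))) := by
      simp only [circFun]
      linear_combination (-(s * ((y 0 - P 0) ^ 2 - (x 0 - P 0) ^ 2))) * hσ2
    rw [e]
    rcases h0.lt_or_eq with h0 | h0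
    · exact add_pos_of_pos_of_nonneg (mul_pos (by linarith) (by linarith))
        (mul_nonneg (by linarith) (by linarith))
    · refine add_pos_of_nonneg_of_pos (mul_nonneg (by linarith) (by linarith))
        (mul_pos ?_ (by linarith))
      refine sub_pos.2 (lt_of_le_of_ne h1 fun h1 => hne (plane_ext ?_ h1.symm))
      have := congrArg (fun t => σ * t) h0
      simp only [← mul_assoc, hσ2, one_mul] at this
      exact this
  · intro x hx
    rw [hf, fderiv_circFun]
    have := (hB x hx).2.1
    simp only [Fin.isValue, Matrix.cons_val_zero, Matrix.cons_val_one, Matrix.cons_val_fin_one]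
    linarith
  · intro x hx
    rw [hf, fderiv_circFun]
    have := (hB x hx).2.2
    simp only [Fin.isValue, Matrix.cons_val_zero, Matrix.cons_val_one, Matrix.cons_val_fin_one]
    linarith

/-- Finitely many sites over disjoint intervals of the first coordinate that contain no critical
values. -/
structure Sites (d : MomentData) (n : ℕ) where
  k : Fin n → Fin d.l₁
  p : Fin n → Plane
  σ : Fin n → ℝ
  r : Fin n → ℝ
  H : Fin n → ℝ
  site : ∀ i, IsSite d (k i) (p i) (σ i) (r i) (H i)
  wide : ∀ i, IsSite d (k i) (p i) (σ i) (2 * r i) (H i)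
  strips : ∀ i i', i ≠ i' → 2 * r i + 2 * r i' < |p i 0 - p i' 0|
  avoid : ∀ i, ∀ x ∈ d.sing, r i < |x 0 - p i 0|

namespace Sites

variable {n : ℕ} (S : d.Sites n)

/-- The function of the circle of index `i`. -/
def φ (i : Fin n) : Plane → ℝ := circFun 1 (S.p i) (S.r i)

theorem phi_eq (i : Fin n) (x : Plane) :
    S.φ i x = (x 0 - S.p i 0) ^ 2 + (x 1 - S.p i 1) ^ 2 - S.r i ^ 2 := by
  rw [φ, circFun, one_mul]

theorem continuous_phi (i : Fin n) : Continuous (S.φ i) := continuous_circFun _ _ _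

theorem phi_pos {i : Fin n} {x : Plane} (hx : S.r i < |x 0 - S.p i 0|) : 0 < S.φ i x := by
  rw [phi_eq]
  have := pow_lt_pow_left₀ hx (S.site i).r_pos.le two_ne_zero
  rw [sq_abs] at this
  nlinarith [sq_nonneg (x 1 - S.p i 1)]

theorem mem_rect_of_phi {i : Fin n} {x : Plane} (hx : S.φ i x ≤ 0) :
    x ∈ rect (S.p i) (S.r i) (S.H i) := by
  rw [phi_eq] at hx
  have hr := (S.site i).r_pos
  refine ⟨?_, le_trans ?_ (S.site i).r_lt.le⟩
  · exact abs_le_of_sq_le_sq (by nlinarith [sq_nonneg (x 1 - S.p i 1)]) hr.le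
  · exact abs_le_of_sq_le_sq (by nlinarith [sq_nonneg (x 0 - S.p i 0)]) hr.le

theorem eq_of_strip {i i' : Fin n} {x : Plane} (hi : |x 0 - S.p i 0| ≤ S.r i)
    (hi' : |x 0 - S.p i' 0| ≤ S.r i') : i = i' := by
  by_contra hne
  have h1 := S.strips i i' hne
  have h2 := abs_sub_le (S.p i 0) (x 0) (S.p i' 0)
  rw [abs_sub_comm (S.p i 0) (x 0)] at h2
  linarith [(S.site i).r_pos, (S.site i').r_pos]

theorem phi_pos_of_ne {i i' : Fin n} (hne : i' ≠ i) {x : Plane} (hi : |x 0 - S.p i 0| ≤ S.r i) :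
    0 < S.φ i' x := by
  apply S.phi_pos
  by_contra hcon
  push Not at hcon
  exact hne (S.eq_of_strip hcon hi)

theorem center_mem_rect (i : Fin n) : S.p i ∈ rect (S.p i) (S.r i) (S.H i) := by
  have h1 := (S.site i).r_pos
  have h2 := (S.site i).r_lt
  constructor <;> simp <;> linarith

theorem sigma_sq (i : Fin n) : S.σ i * S.σ i = 1 := by
  rcases (S.site i).sign with h | h <;> rw [h] <;> norm_num

theorem abs_sigma_mul (i : Fin n) (t : ℝ) : |S.σ i * t| = |t| := by
  rcases (S.site i).sign with h | h <;> simp [h]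

/-- A zero of the function of the curve in the rectangle lies in the first or the third quadrant. -/
theorem quadrant {i : Fin n} {x : Plane} (hx : x ∈ rect (S.p i) (S.r i) (S.H i))
    (h0 : polyFun (d.f (S.k i)) x = 0) (hne : x ≠ S.p i) :
    (0 < S.σ i * (x 0 - S.p i 0) ∧ 0 < x 1 - S.p i 1) ∨
      (S.σ i * (x 0 - S.p i 0) < 0 ∧ x 1 - S.p i 1 < 0) := by
  have hp := (S.site i).zero
  by_cases h1 : 0 < S.σ i * (x 0 - S.p i 0)
  · left
    refine ⟨h1, ?_⟩
    by_contra hcon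
    have := (S.site i).mono _ (S.center_mem_rect i) x hx (by linarith) (by linarith) (Ne.symm hne)
    linarith
  · right
    push Not at h1
    have h2 : x 1 - S.p i 1 < 0 := by
      by_contra hcon
      have := (S.site i).mono x hx _ (S.center_mem_rect i) (by linarith) (by linarith) hne
      linarith
    refine ⟨lt_of_le_of_ne h1 fun h3 => ?_, h2⟩
    have := (S.site i).mono _ (S.center_mem_rect i) x hx (by linarith) (by linarith) (Ne.symm hne)
    linarith

/-- A point above the centre at which the function of the curve is nonnegative lies on the side of
the centre determined by `σ`. -/
theorem side_pos {i : Fin n} {x : Plane} (hx : x ∈ rect (S.p i) (S.r i) (S.H i))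
    (h0 : 0 ≤ polyFun (d.f (S.k i)) x) (h1 : S.p i 1 ≤ x 1) (hne : x ≠ S.p i) :
    0 < S.σ i * (x 0 - S.p i 0) := by
  by_contra hcon
  have := (S.site i).mono x hx _ (S.center_mem_rect i) (by linarith) h1 hne
  have hp := (S.site i).zero
  linarith

/-- Above the rectangle the slices end. -/
theorem top_neg {i : Fin n} {x : Plane} (hx : |x 0 - S.p i 0| ≤ S.r i)
    (h1 : x 1 = S.p i 1 + S.H i) : polyFun (d.f (S.k i)) x < 0 := by
  have hr := (S.site i).r_pos
  have hH := (S.site i).r_lt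
  have hq := (S.site i).top
  have hxR : x ∈ rect (S.p i) (S.r i) (S.H i) := by
    refine ⟨hx, ?_⟩
    rw [h1, add_sub_cancel_left, abs_of_pos (by linarith)]
  by_cases he : x = !₂[S.p i 0 + S.σ i * S.r i, S.p i 1 + S.H i]
  · rw [he]; exact hq
  refine ((S.site i).mono x hxR _ ?_ ?_ ?_ he).trans hq
  · constructor
    · simp only [Fin.isValue, Matrix.cons_val_zero, add_sub_cancel_left]
      rw [S.abs_sigma_mul, abs_of_pos hr]
    · simp only [Fin.isValue, Matrix.cons_val_one, Matrix.cons_val_fin_one, add_sub_cancel_left]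
      rw [abs_of_pos (by linarith)]
  · simp only [Fin.isValue, Matrix.cons_val_zero]
    have := S.sigma_sq i
    have h2 : S.σ i * (x 0 - S.p i 0) ≤ S.r i := by
      have := le_abs_self (S.σ i * (x 0 - S.p i 0))
      rw [S.abs_sigma_mul] at this; linarith
    nlinarith
  · simp [h1]

/-- The quarter of the circle between the vertical and the horizontal direction, both counted with
the sign `κ`, has ends at which the function of the curve has opposite signs, by comparison with the
centre. The intermediate value theorem gives a zero between them. -/
theorem exists_corner (i : Fin n) {κ : ℝ} (hκ : κ = 1 ∨ κ = -1) :
    ∃ q, S.φ i q = 0 ∧ polyFun (d.f (S.k i)) q = 0 ∧ 0 < κ * (S.σ i * (q 0 - S.p i 0)) ∧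
      0 < κ * (q 1 - S.p i 1) := by
  have hr := (S.site i).r_pos
  have hH := (S.site i).r_lt
  have hσ := S.sigma_sq i
  have hκ2 : κ * κ = 1 := by rcases hκ with rfl | rfl <;> norm_num
  have hz := (S.site i).zero
  let q : ℝ → Plane := fun u =>
    !₂[S.p i 0 + κ * (S.σ i * u), S.p i 1 + κ * √(S.r i ^ 2 - u ^ 2)]
  have hq : Continuous q := by fun_prop
  have hφ : ∀ u ∈ Icc 0 (S.r i), S.φ i (q u) = 0 := by
    intro u hu
    rw [phi_eq]
    simp only [q, Fin.isValue, Matrix.cons_val_zero, Matrix.cons_val_one, Matrix.cons_val_fin_one,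
      add_sub_cancel_left, mul_pow]
    rw [Real.sq_sqrt (by nlinarith [hu.1, hu.2])]
    simp only [pow_two]
    linear_combination (S.σ i * S.σ i * (u * u) + (S.r i * S.r i - u * u)) * hκ2 + (u * u) * hσ
  have hq0 : q 0 = !₂[S.p i 0, S.p i 1 + κ * S.r i] := by
    simp [q, Real.sqrt_sq hr.le]
  have hqr : q (S.r i) = !₂[S.p i 0 + κ * (S.σ i * S.r i), S.p i 1] := by simp [q]
  have hR : ∀ u ∈ Icc 0 (S.r i), q u ∈ rect (S.p i) (S.r i) (S.H i) := fun u hu =>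
    S.mem_rect_of_phi (hφ u hu).le
  have h0m : (0 : ℝ) ∈ Icc 0 (S.r i) := ⟨le_rfl, hr.le⟩
  have hrm : S.r i ∈ Icc 0 (S.r i) := ⟨hr.le, le_rfl⟩
  have hne0 : q 0 ≠ S.p i := fun e => by
    have := congrArg (fun y : Plane => y 1) e
    rw [hq0] at this
    simp at this
    rcases hκ with rfl | rfl <;> simp at this <;> linarith
  have hner : q (S.r i) ≠ S.p i := fun e => by
    have := congrArg (fun y : Plane => y 0) e
    rw [hqr] at this
    have h1 : κ * (S.σ i * S.r i) = 0 := by simpa using this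
    have h2 : S.r i = 0 := by
      calc S.r i = (κ * κ) * (S.σ i * S.σ i) * S.r i := by rw [hκ2, hσ]; ring
        _ = κ * S.σ i * (κ * (S.σ i * S.r i)) := by ring
        _ = 0 := by rw [h1, mul_zero]
    linarith
  have key : ∃ u ∈ Icc 0 (S.r i), polyFun (d.f (S.k i)) (q u) = 0 := by
    have hcont : ContinuousOn (fun u => polyFun (d.f (S.k i)) (q u)) (Icc 0 (S.r i)) :=
      ((continuous_polyFun _).comp hq).continuousOn
    have e0 : S.σ i * (q 0) 0 = S.σ i * S.p i 0 := by rw [hq0]; rfl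
    have e1 : (q 0) 1 = S.p i 1 + κ * S.r i := by rw [hq0]; rfl
    have e2 : S.σ i * (q (S.r i)) 0 = S.σ i * S.p i 0 + κ * S.r i := by
      rw [hqr]
      simp only [Fin.isValue, Matrix.cons_val_zero]
      linear_combination (κ * S.r i) * hσ
    have e3 : (q (S.r i)) 1 = S.p i 1 := by rw [hqr]; rfl
    rcases hκ with rfl | rfl
    · have a := (S.site i).mono _ (hR 0 h0m) _ (S.center_mem_rect i) e0.le (by rw [e1]; linarith) hne0
      have b := (S.site i).mono _ (S.center_mem_rect i) _ (hR _ hrm) (by rw [e2]; linarith) e3.le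
        (Ne.symm hner)
      rw [hz] at a b
      obtain ⟨u, hu, hu0⟩ := intermediate_value_Icc hr.le hcont ⟨a.le, b.le⟩
      exact ⟨u, hu, hu0⟩
    · have a := (S.site i).mono _ (S.center_mem_rect i) _ (hR 0 h0m) e0.ge (by rw [e1]; linarith)
        (Ne.symm hne0)
      have b := (S.site i).mono _ (hR _ hrm) _ (S.center_mem_rect i) (by rw [e2]; linarith) e3.ge hner
      rw [hz] at a b
      obtain ⟨u, hu, hu0⟩ := intermediate_value_Icc' hr.le hcont ⟨b.le, a.le⟩
      exact ⟨u, hu, hu0⟩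
  obtain ⟨u, hu, hu0⟩ := key
  refine ⟨q u, hφ u hu, hu0, ?_⟩
  have hqp : q u ≠ S.p i := fun e => by
    have h1 := hφ u hu
    rw [e, phi_eq] at h1
    nlinarith
  have hs : κ * (S.σ i * ((q u) 0 - S.p i 0)) = u := by
    simp only [q, Fin.isValue, Matrix.cons_val_zero, add_sub_cancel_left]
    linear_combination (κ * κ * u) * hσ + u * hκ2
  rcases S.quadrant (hR u hu) hu0 hqp with ⟨h1, h2⟩ | ⟨h1, h2⟩
  · have hκ1 : κ = 1 := by
      rcases hκ with rfl | rfl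
      · rfl
      · linarith [hu.1]
    subst hκ1
    exact ⟨by linarith, by linarith⟩
  · have hκ1 : κ = -1 := by
      rcases hκ with rfl | rfl
      · linarith [hu.1]
      · rfl
    subst hκ1
    exact ⟨by linarith, by linarith⟩

/-- The corner above the centre. -/
def tip (i : Fin n) : Plane := (S.exists_corner i (Or.inl rfl)).choose

/-- The corner below the centre. -/
def foot (i : Fin n) : Plane := (S.exists_corner i (Or.inr rfl)).choose

/-- The extreme point of the circle inside the region. -/
def apex (i : Fin n) : Plane := !₂[S.p i 0 + S.σ i * S.r i, S.p i 1]

theorem phi_tip (i : Fin n) : S.φ i (S.tip i) = 0 :=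
  (S.exists_corner i (Or.inl rfl)).choose_spec.1

theorem zero_tip (i : Fin n) : polyFun (d.f (S.k i)) (S.tip i) = 0 :=
  (S.exists_corner i (Or.inl rfl)).choose_spec.2.1

theorem tip_pos (i : Fin n) : 0 < S.σ i * (S.tip i 0 - S.p i 0) ∧ 0 < S.tip i 1 - S.p i 1 := by
  have h := (S.exists_corner i (κ := 1) (Or.inl rfl)).choose_spec.2.2
  change 0 < 1 * (S.σ i * (S.tip i 0 - S.p i 0)) ∧ 0 < 1 * (S.tip i 1 - S.p i 1) at h
  exact ⟨by linarith [h.1], by linarith [h.2]⟩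

theorem phi_foot (i : Fin n) : S.φ i (S.foot i) = 0 :=
  (S.exists_corner i (Or.inr rfl)).choose_spec.1

theorem zero_foot (i : Fin n) : polyFun (d.f (S.k i)) (S.foot i) = 0 :=
  (S.exists_corner i (Or.inr rfl)).choose_spec.2.1

theorem foot_neg (i : Fin n) : S.σ i * (S.foot i 0 - S.p i 0) < 0 ∧ S.foot i 1 - S.p i 1 < 0 := by
  have h := (S.exists_corner i (κ := -1) (Or.inr rfl)).choose_spec.2.2
  change 0 < -1 * (S.σ i * (S.foot i 0 - S.p i 0)) ∧ 0 < -1 * (S.foot i 1 - S.p i 1) at h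
  exact ⟨by linarith [h.1], by linarith [h.2]⟩

theorem phi_apex (i : Fin n) : S.φ i (S.apex i) = 0 := by
  rw [phi_eq]
  simp only [apex, Fin.isValue, Matrix.cons_val_zero, Matrix.cons_val_one, Matrix.cons_val_fin_one,
    add_sub_cancel_left, sub_self]
  linear_combination (S.r i ^ 2) * S.sigma_sq i

/-- The intersection points of the circle with the curve. -/
theorem eq_tip_or_foot {i : Fin n} {x : Plane} (h0 : S.φ i x = 0)
    (h1 : polyFun (d.f (S.k i)) x = 0) : x = S.tip i ∨ x = S.foot i := by
  -- The function grows strictly towards the side `σ` and downwards. Two points of the circle in the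
  -- first quadrant, or two in the third, are always comparable in this sense, so each of these
  -- quadrants contains only one zero.
  have key : ∀ x y : Plane, S.φ i x = 0 → S.φ i y = 0 → polyFun (d.f (S.k i)) x = 0 →
      polyFun (d.f (S.k i)) y = 0 →
      S.σ i * x 0 ≤ S.σ i * y 0 → y 1 ≤ x 1 → x = y := by
    intro x y hx hy hx0 hy0 h1 h2
    by_contra hne
    have := (S.site i).mono x (S.mem_rect_of_phi hx.le) y (S.mem_rect_of_phi hy.le) h1 h2 hne
    linarith
  have circ : ∀ x : Plane, S.φ i x = 0 →
      (S.σ i * (x 0 - S.p i 0)) ^ 2 + (x 1 - S.p i 1) ^ 2 = S.r i ^ 2 := by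
    intro x hx
    rw [phi_eq] at hx
    rw [mul_pow]
    have := S.sigma_sq i
    rw [← pow_two] at this
    rw [this]; linarith
  have hne : x ≠ S.p i := fun e => by
    rw [e, phi_eq] at h0
    nlinarith [(S.site i).r_pos]
  have cx := circ x h0
  rcases S.quadrant (S.mem_rect_of_phi h0.le) h1 hne with ⟨a, b⟩ | ⟨a, b⟩
  · left
    obtain ⟨a', b'⟩ := S.tip_pos i
    have ct := circ _ (S.phi_tip i)
    rcases le_total (S.σ i * (x 0 - S.p i 0)) (S.σ i * (S.tip i 0 - S.p i 0)) with h | h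
    · refine key x _ h0 (S.phi_tip i) h1 (S.zero_tip i) (by linarith) ?_
      nlinarith
    · refine (key _ x (S.phi_tip i) h0 (S.zero_tip i) h1 (by linarith) ?_).symm
      nlinarith
  · right
    obtain ⟨a', b'⟩ := S.foot_neg i
    have ct := circ _ (S.phi_foot i)
    rcases le_total (S.σ i * (x 0 - S.p i 0)) (S.σ i * (S.foot i 0 - S.p i 0)) with h | h
    · refine key x _ h0 (S.phi_foot i) h1 (S.zero_foot i) (by linarith) ?_
      nlinarith
    · refine (key _ x (S.phi_foot i) h0 (S.zero_foot i) h1 (by linarith) ?_).symm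
      nlinarith

end Sites

end MomentData

/-! ### Slices and closure of the region outside the new discs -/

theorem IsCircFun.eventually_pos {φ : Plane → ℝ} (h : IsCircFun φ) {x v : Plane} (h0 : 0 ≤ φ x)
    (hv : 0 < φ x ∨ 0 < fderiv ℝ φ x v) : ∀ᶠ t in 𝓝[>] (0 : ℝ), 0 < φ (x + t • v) := by
  rcases hv with hv | hv
  · have hc : Continuous fun t : ℝ => φ (x + t • v) := h.continuous.comp (by fun_prop)
    exact nhdsWithin_le_nhds (hc.continuousAt.eventually (lt_mem_nhds (by simpa using hv)))
  · obtain ⟨s, P, r, -, -, rfl⟩ := h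
    have hc : Continuous fun t : ℝ => fderiv ℝ (circFun s P r) x v + t * (s * (v 0 ^ 2 + v 1 ^ 2)) := by
      fun_prop
    filter_upwards [nhdsWithin_le_nhds (hc.continuousAt.eventually
      (lt_mem_nhds (a := 0) (by simpa using hv))), self_mem_nhdsWithin] with t ht ht0
    have e : circFun s P r (x + t • v) = circFun s P r x +
        t * (fderiv ℝ (circFun s P r) x v + t * (s * (v 0 ^ 2 + v 1 ^ 2))) := by
      rw [fderiv_circFun]; simp [circFun]; ring
    rw [e]
    exact add_pos_of_nonneg_of_pos h0 (mul_pos ht0 ht)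

namespace MomentData

variable {d : MomentData}

namespace Sites

variable {n : ℕ} (S : d.Sites n)

/-- The part of the closed region outside the new open discs. -/
def K : Set Plane := {x | x ∈ closure d.D ∧ ∀ i, 0 ≤ S.φ i x}

/-- The part of the region outside the new closed discs. -/
def region : Set Plane := {x | x ∈ d.D ∧ ∀ i, 0 < S.φ i x}

/-- The part of the strip of index `i` above the centre and below the top of the rectangle. -/
def wh (i : Fin n) : Set Plane :=
  {x | |x 0 - S.p i 0| < S.r i ∧ S.p i 1 < x 1 ∧ x 1 < S.p i 1 + S.H i}

theorem isOpen_wh (i : Fin n) : IsOpen (S.wh i) :=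
  (show IsOpen {x : Plane | |x 0 - S.p i 0| < S.r i} from
    isOpen_lt (by fun_prop) continuous_const).inter
    ((show IsOpen {x : Plane | S.p i 1 < x 1} from isOpen_lt continuous_const (by fun_prop)).inter
      (show IsOpen {x : Plane | x 1 < S.p i 1 + S.H i} from
        isOpen_lt (by fun_prop) continuous_const))

theorem wh_subset_rect {i : Fin n} {x : Plane} (hx : x ∈ S.wh i) :
    x ∈ rect (S.p i) (S.r i) (S.H i) :=
  ⟨hx.1.le, abs_le.2 ⟨by linarith [hx.2.1, (S.site i).r_pos, (S.site i).r_lt], by linarith [hx.2.2]⟩⟩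

theorem wh_disjoint {i i' : Fin n} {x : Plane} (hi : x ∈ S.wh i) (hi' : x ∈ S.wh i') : i = i' :=
  S.eq_of_strip hi.1.le hi'.1.le

variable {i₀ : Fin d.l₂} (h : d.IsGood i₀)

include h

theorem mem_closure_of_rect {i : Fin n} {x : Plane} (hx : x ∈ rect (S.p i) (S.r i) (S.H i))
    (h0 : 0 ≤ polyFun (d.f (S.k i)) x) : x ∈ closure d.D := by
  rw [h.mem_closure]
  intro j
  by_cases hj : j = S.k i
  · rw [hj]; exact h0
  · exact ((S.site i).others x hx j hj).le

theorem mem_D_of_rect {i : Fin n} {x : Plane} (hx : x ∈ rect (S.p i) (S.r i) (S.H i))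
    (h0 : 0 < polyFun (d.f (S.k i)) x) : x ∈ d.D := by
  rw [h.region]
  intro j
  by_cases hj : j = S.k i
  · rw [hj]; exact h0
  · exact (S.site i).others x hx j hj

/-- A slice of the closed region in a strip does not pass the top of the rectangle. -/
theorem lt_top {i : Fin n} {x y : Plane} (hxy : SliceRel (closure d.D) x y)
    (hx : |x 0 - S.p i 0| ≤ S.r i) (hx1 : x 1 < S.p i 1 + S.H i) : y 1 < S.p i 1 + S.H i := by
  by_contra hcon
  push Not at hcon
  let z : Plane := !₂[x 0, S.p i 1 + S.H i]
  have hz : z ∈ closure d.D := hxy.2 z rfl (by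
    rw [uIcc_of_le (by linarith)]; exact ⟨hx1.le, hcon⟩)
  have := S.top_neg (x := z) hx rfl
  have := h.mem_closure.1 hz (S.k i)
  linarith

/-- Going down, the slice would have to cross the horizontal diameter of the open disc. Going up, it
would have to pass the top of the rectangle, where the function of the curve is negative. -/
theorem wh_saturated {i : Fin n} {x y : Plane} (hx : x ∈ S.wh i) (hxy : SliceRel S.K x y) :
    y ∈ S.wh i := by
  refine ⟨by rw [← hxy.1]; exact hx.1, ?_, ?_⟩
  · by_contra hcon
    push Not at hcon
    let z : Plane := !₂[x 0, S.p i 1]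
    have hz : z ∈ S.K := hxy.2 z rfl (by
      rw [uIcc_of_ge (by linarith [hx.2.1])]; exact ⟨hcon, hx.2.1.le⟩)
    have h1 := hz.2 i
    rw [phi_eq] at h1
    simp [z] at h1
    have := pow_lt_pow_left₀ hx.1 (abs_nonneg _) two_ne_zero
    rw [sq_abs] at this
    linarith
  · exact S.lt_top h (hxy.mono fun z hz => hz.1) hx.1.le hx.2.2

/-- Along a slice of the closed region, the points above a point in a new disc are below the top of
the rectangle. -/
theorem above_disc {i : Fin n} {y z : Plane} (hzy : SliceRel (closure d.D) z y) (hle : z 1 ≤ y 1)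
    (hz : S.φ i z ≤ 0) (hy : S.φ i z < S.φ i y) :
    |y 0 - S.p i 0| ≤ S.r i ∧ S.p i 1 < y 1 ∧ y 1 < S.p i 1 + S.H i := by
  have hr := (S.site i).r_pos
  have hH := (S.site i).r_lt
  have hzR := S.mem_rect_of_phi hz
  rw [phi_eq] at hz
  have hlt : z 1 < S.p i 1 + S.H i := by
    have : |z 1 - S.p i 1| ≤ S.r i := abs_le_of_sq_le_sq (by nlinarith [sq_nonneg (z 0 - S.p i 0)]) hr.le
    linarith [(abs_le.1 this).2]
  refine ⟨hzy.1 ▸ hzR.1, ?_, S.lt_top h hzy hzR.1 hlt⟩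
  rw [phi_eq, phi_eq, hzy.1] at hy
  nlinarith

/-- If the segment met an open disc, its upper end would be above that disc and hence in some `wh
i`. So outside the whiskers the old and the new slices identify the same points. -/
theorem sliceRel_of_not_wh {x y : Plane} (hx : x ∈ S.K) (hy : y ∈ S.K) (hxw : ∀ i, x ∉ S.wh i)
    (hyw : ∀ i, y ∉ S.wh i) (hxy : SliceRel (closure d.D) x y) : SliceRel S.K x y := by
  refine ⟨hxy.1, fun z hz0 hz1 => ⟨hxy.2 z hz0 hz1, fun i => ?_⟩⟩
  by_contra hcon
  push Not at hcon
  have key : ∀ y ∈ S.K, y ∉ S.wh i → SliceRel (closure d.D) z y → ¬ z 1 ≤ y 1 := by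
    intro y hy hyw hzy hle
    have h1 := S.above_disc h hzy hle hcon.le (hcon.trans_le (hy.2 i))
    refine hyw ⟨?_, h1.2⟩
    rw [← hzy.1]
    rw [phi_eq] at hcon
    exact abs_lt_of_sq_lt_sq (by nlinarith [sq_nonneg (z 1 - S.p i 1)]) (S.site i).r_pos.le
  have hxz := hxy.mid hz0 hz1
  rcases mem_uIcc.1 hz1 with h1 | h1
  · exact key y hy (hyw i) (hxz.symm.trans hxy) h1.2
  · exact key x hx (hxw i) hxz.symm h1.2

/-- The lower end of a slice of the closed region lies neither in a new disc nor above one. -/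
theorem slice_bottom {x z : Plane} (hz : SliceRel (closure d.D) x z)
    (hmax : ∀ w, SliceRel (closure d.D) x w → -1 * w 1 ≤ -1 * z 1) :
    z ∈ S.K ∧ ∀ i, z ∉ S.wh i := by
  -- The function of the curve grows downwards, so from any point of the closed region in the
  -- rectangle one can descend inside the region to the bottom of the rectangle.
  have key : ∀ i, z ∈ rect (S.p i) (S.r i) (S.H i) → ¬ S.p i 1 - S.H i < z 1 := by
    intro i hzR hlow
    have h0 := h.mem_closure.1 hz.right_mem (S.k i)
    let w : Plane := !₂[z 0, S.p i 1 - S.H i]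
    have hzw : SliceRel (closure d.D) z w := by
      refine ⟨rfl, fun y hy0 hy1 => ?_⟩
      have hy1' : y 1 ∈ uIcc (z 1) (S.p i 1 - S.H i) := hy1
      rw [uIcc_of_ge hlow.le] at hy1'
      have hyR : y ∈ rect (S.p i) (S.r i) (S.H i) := by
        refine ⟨by rw [hy0]; exact hzR.1, abs_le.2 ⟨by linarith [hy1'.1], ?_⟩⟩
        linarith [hy1'.2, (abs_le.1 hzR.2).2]
      refine S.mem_closure_of_rect h hyR ?_
      by_cases hyz : z = y
      · rw [← hyz]; exact h0
      · exact h0.trans ((S.site i).mono z hzR y hyR (by rw [hy0]) hy1'.2 hyz).le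
    have := hmax w (hz.trans hzw)
    simp [w] at this
    linarith
  have hr := fun i => (S.site i).r_pos
  have hH := fun i => (S.site i).r_lt
  refine ⟨⟨hz.right_mem, fun i => ?_⟩, fun i hi => ?_⟩
  · by_contra hcon
    push Not at hcon
    refine key i (S.mem_rect_of_phi hcon.le) ?_
    rw [phi_eq] at hcon
    have : |z 1 - S.p i 1| < S.r i :=
      abs_lt_of_sq_lt_sq (by nlinarith [sq_nonneg (z 0 - S.p i 0)]) (hr i).le
    linarith [(abs_lt.1 this).1, hH i]
  · exact key i (S.wh_subset_rect hi) (by linarith [hi.2.1, hr i, hH i])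

/-- The slices over a whisker are connected. -/
theorem wh_slice {i : Fin n} {x y : Plane} (hx : x ∈ S.K) (hy : y ∈ S.K) (hxw : x ∈ S.wh i)
    (hyw : y ∈ S.wh i) (hxy : x 0 = y 0) : SliceRel S.K x y := by
  have key : ∀ x y : Plane, x ∈ S.K → y ∈ S.K → x ∈ S.wh i → y ∈ S.wh i → x 0 = y 0 → ∀ z : Plane,
      z 0 = x 0 → x 1 ≤ z 1 → z 1 ≤ y 1 → z ∈ S.K := by
    intro x y hx hy hxw hyw hxy z hz0 hz1 hz2
    have hzw : z ∈ S.wh i := ⟨by rw [hz0]; exact hxw.1, hxw.2.1.trans_le hz1, hz2.trans_lt hyw.2.2⟩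
    have hzR := S.wh_subset_rect hzw
    refine ⟨S.mem_closure_of_rect h hzR ?_, fun i' => ?_⟩
    · have h0 := h.mem_closure.1 hy.1 (S.k i)
      by_cases hyz : y = z
      · rw [← hyz]; exact h0
      · exact h0.trans ((S.site i).mono y (S.wh_subset_rect hyw) z hzR (by rw [hz0, hxy]) hz2 hyz).le
    · by_cases hi : i' = i
      · subst hi
        have h1 := hx.2 i'
        have h2 := hxw.2.1
        rw [phi_eq] at h1 ⊢
        rw [hz0]
        nlinarith
      · exact (S.phi_pos_of_ne hi hzR.1).le
  refine ⟨hxy, fun z hz0 hz1 => ?_⟩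
  rcases mem_uIcc.1 hz1 with h1 | h1
  · exact key x y hx hy hxw hyw hxy z hz0 h1.1 h1.2
  · exact key y x hy hx hyw hxw hxy.symm z (hz0.trans hxy) h1.1 h1.2

theorem isCompact_K : IsCompact S.K := by
  refine h.adm.isCompact_closure.inter_right ?_
  change IsClosed {x | ∀ i, 0 ≤ S.φ i x}
  rw [show {x | ∀ i, 0 ≤ S.φ i x} = ⋂ i, {x | 0 ≤ S.φ i x} by ext; simp]
  exact isClosed_iInter fun i => isClosed_le continuous_const (S.continuous_phi i)

/-- Each slice contains a point of an old curve. -/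
theorem exists_old_zero {x : Plane} (hx : x ∈ S.K) :
    ∃ z, SliceRel S.K x z ∧ ∃ j, polyFun (d.f j) z = 0 := by
  -- Above a disc, the upper end of the slice lies on the old curve of the site. Otherwise the lower
  -- end of the old slice belongs to the new slice and lies on some old curve.
  by_cases hw : ∃ i, x ∈ S.wh i
  · obtain ⟨i, hi⟩ := hw
    obtain ⟨z, hz, hmax⟩ := exists_slice_end (S.isCompact_K h) hx 1
    refine ⟨z, hz, S.k i, ?_⟩
    by_contra h0
    have hzw := S.wh_saturated h hi hz
    have hpos : 0 < polyFun (d.f (S.k i)) z :=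
      lt_of_le_of_ne (h.mem_closure.1 hz.right_mem.1 (S.k i)) (Ne.symm h0)
    have hc : Continuous fun t : ℝ => z + t • (!₂[0, 1] : Plane) := by fun_prop
    have e1 : ∀ᶠ t in 𝓝[>] (0 : ℝ), z + t • (!₂[0, 1] : Plane) ∈ S.wh i :=
      nhdsWithin_le_nhds (((S.isOpen_wh i).preimage hc).mem_nhds (by simpa using hzw))
    have hev := e1.and ((h.circ (S.k i)).eventually_pos (v := !₂[0, 1]) hpos.le (Or.inl hpos))
    obtain ⟨t, ⟨htw, htp⟩, ht0⟩ := (hev.and self_mem_nhdsWithin).exists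
    have ht0' : 0 < t := ht0
    set y := z + t • (!₂[0, 1] : Plane) with hy
    have hy0 : y 0 = z 0 := by simp [hy]
    have hy1 : y 1 = z 1 + t := by simp [hy]
    have hyK : y ∈ S.K := by
      refine ⟨S.mem_closure_of_rect h (S.wh_subset_rect htw) htp.le, fun i' => ?_⟩
      by_cases hi : i' = i
      · subst hi
        have h1 := hz.right_mem.2 i'
        have h2 := hzw.2.1
        rw [phi_eq] at h1 ⊢
        rw [hy0, hy1]
        nlinarith
      · exact (S.phi_pos_of_ne hi htw.1.le).le
    have := hmax y (hz.trans (S.wh_slice h hz.right_mem hyK hzw htw hy0.symm))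
    rw [hy1] at this
    linarith
  · push Not at hw
    obtain ⟨z, hz, hmax⟩ := exists_slice_end h.adm.isCompact_closure hx.1 (-1)
    obtain ⟨hzK, hzw⟩ := S.slice_bottom h hz hmax
    refine ⟨z, S.sliceRel_of_not_wh h hx hzK hw hzw hz, ?_⟩
    have hzD := not_mem_of_slice_end h.adm.isOpen subset_closure (Or.inr rfl) hz hmax
    by_contra hcon
    push Not at hcon
    apply hzD
    rw [h.region]
    exact fun j => lt_of_le_of_ne (h.mem_closure.1 hz.right_mem j) (Ne.symm (hcon j))

omit h in
/-- At a point of the old curve on a new circle, there is a direction into the new region. -/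
theorem exists_inward {i : Fin n} {x : Plane}
    (hx : S.φ i x = 0) (h0 : polyFun (d.f (S.k i)) x = 0) :
    ∃ v, 0 < fderiv ℝ (S.φ i) x v ∧ 0 < fderiv ℝ (polyFun (d.f (S.k i))) x v := by
  have hR := S.mem_rect_of_phi hx.le
  have hne : x ≠ S.p i := fun e => by
    rw [e, phi_eq] at hx
    nlinarith [(S.site i).r_pos]
  have h1 := (S.site i).horiz x hR
  have h2 := (S.site i).vert x hR
  -- Both functions grow towards the side `σ` in the first quadrant, and downwards in the third.
  rcases S.quadrant hR h0 hne with ⟨a, b⟩ | ⟨a, b⟩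
  · refine ⟨!₂[S.σ i, 0], ?_, ?_⟩
    · rw [φ, fderiv_circFun]; simp; linarith
    · rw [fderiv_plane_apply]; simp; linarith
  · refine ⟨!₂[0, -1], ?_, ?_⟩
    · rw [φ, fderiv_circFun]; simp; linarith
    · rw [fderiv_plane_apply]; simp; linarith

omit h in
theorem isCircFun_phi (i : Fin n) : IsCircFun (S.φ i) :=
  ⟨1, S.p i, S.r i, (S.site i).r_pos, Or.inl rfl, rfl⟩

theorem isOpen_region : IsOpen S.region := by
  refine h.adm.isOpen.inter ?_
  change IsOpen {x | ∀ i, 0 < S.φ i x}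
  rw [show {x | ∀ i, 0 < S.φ i x} = ⋂ i, {x | 0 < S.φ i x} by ext; simp]
  exact isOpen_iInter_of_finite fun i => isOpen_lt continuous_const (S.continuous_phi i)

/-- A point on a new circle is approached from a direction in which the circle function grows: the
radial one off the old curve, and one from `exists_inward` at an intersection. Other points of `S.K`
are limits of points of `D`, since the conditions of the discs are open there. -/
theorem closure_region : closure S.region = S.K := by
  refine Subset.antisymm (closure_minimal
    (fun x hx => ⟨subset_closure hx.1, fun i => (hx.2 i).le⟩) (S.isCompact_K h).isClosed) ?_
  intro x hx
  by_cases hall : ∀ i, 0 < S.φ i x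
  · have hO : IsOpen {x | ∀ i, 0 < S.φ i x} := by
      rw [show {x | ∀ i, 0 < S.φ i x} = ⋂ i, {x | 0 < S.φ i x} by ext; simp]
      exact isOpen_iInter_of_finite fun i => isOpen_lt continuous_const (S.continuous_phi i)
    rw [mem_closure_iff_nhds]
    intro U hU
    obtain ⟨y, ⟨hyU, hyO⟩, hyD⟩ := mem_closure_iff_nhds.1 hx.1 _
      (Filter.inter_mem hU (hO.mem_nhds hall))
    exact ⟨y, hyU, hyD, hyO⟩
  · push Not at hall
    obtain ⟨i, hi⟩ := hall
    have hi0 : S.φ i x = 0 := le_antisymm hi (hx.2 i)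
    have hR := S.mem_rect_of_phi hi
    obtain ⟨v, hv1, hv2⟩ : ∃ v, 0 < fderiv ℝ (S.φ i) x v ∧ (0 < polyFun (d.f (S.k i)) x ∨
        0 < fderiv ℝ (polyFun (d.f (S.k i))) x v) := by
      by_cases h0 : polyFun (d.f (S.k i)) x = 0
      · obtain ⟨v, h1, h2⟩ := S.exists_inward hi0 h0
        exact ⟨v, h1, Or.inr h2⟩
      · refine ⟨x - S.p i, ?_, Or.inl (lt_of_le_of_ne (h.mem_closure.1 hx.1 _) (Ne.symm h0))⟩
        rw [φ, fderiv_circFun]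
        rw [phi_eq] at hi0
        simp
        have := pow_pos (S.site i).r_pos 2
        nlinarith
    have hev : ∀ᶠ t in 𝓝[>] (0 : ℝ), x + t • v ∈ S.region := by
      have e1 : ∀ᶠ t in 𝓝[>] (0 : ℝ), ∀ j, 0 < polyFun (d.f j) (x + t • v) := by
        rw [Filter.eventually_all]
        intro j
        by_cases hj : j = S.k i
        · rw [hj]; exact (h.circ _).eventually_pos (h.mem_closure.1 hx.1 _) hv2
        · exact (h.circ _).eventually_pos (h.mem_closure.1 hx.1 _)
            (Or.inl ((S.site i).others x hR j hj))
      have e2 : ∀ᶠ t in 𝓝[>] (0 : ℝ), ∀ i', 0 < S.φ i' (x + t • v) := by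
        rw [Filter.eventually_all]
        intro i'
        by_cases hi' : i' = i
        · rw [hi']; exact (S.isCircFun_phi i).eventually_pos (hx.2 i) (Or.inr hv1)
        · exact (S.isCircFun_phi i').eventually_pos (hx.2 i')
            (Or.inl (S.phi_pos_of_ne hi' hR.1))
      filter_upwards [e1, e2] with t h1 h2
      exact ⟨by rw [h.region]; exact h1, h2⟩
    have ht : Filter.Tendsto (fun t : ℝ => x + t • v) (𝓝[>] 0) (𝓝 x) := by
      have hc : Continuous fun t : ℝ => x + t • v := by fun_prop
      have := hc.tendsto 0
      simp only [zero_smul, add_zero] at this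
      exact this.mono_left nhdsWithin_le_nhds
    exact mem_closure_of_tendsto ht hev

end Sites

end MomentData

/-! ### Connectedness of the region outside the new discs -/

/-- Removing closed pieces from a connected open set preserves connectedness if the traces of
disjoint neighbourhoods of the pieces stay connected. -/
theorem IsPreconnected.sdiff_of_locally {X ι : Type*} [TopologicalSpace X] {D : Set X}
    (hD : IsPreconnected D) (hDo : IsOpen D) {B C : ι → Set X} (hB : ∀ i, IsOpen (B i))
    (hCB : ∀ i, C i ⊆ B i) (hd : ∀ i j, i ≠ j → Disjoint (B i) (B j))
    (hopen : IsOpen (D \ ⋃ i, C i))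
    (hc : ∀ i, IsPreconnected ((D ∩ B i) \ C i)) : IsPreconnected (D \ ⋃ i, C i) := by
  rw [isPreconnected_iff_subset_of_disjoint]
  intro u v hu hv huv hdisj
  have hE : ∀ i, (D ∩ B i) \ C i ⊆ D \ ⋃ i, C i := by
    rintro i x ⟨⟨hxD, hxB⟩, hxC⟩
    refine ⟨hxD, fun hx => ?_⟩
    obtain ⟨j, hj⟩ := mem_iUnion.1 hx
    by_cases hij : i = j
    · exact hxC (hij ▸ hj)
    · exact disjoint_left.1 (hd i j hij) hxB (hCB j hj)
  have hsplit : ∀ i, (D ∩ B i) \ C i ⊆ u ∨ (D ∩ B i) \ C i ⊆ v := fun i =>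
    isPreconnected_iff_subset_of_disjoint.1 (hc i) u v hu hv ((hE i).trans huv)
      (subset_eq_empty (inter_subset_inter_left _ (hE i)) hdisj)
  let W := D \ ⋃ i, C i
  -- Each removed piece is given back, with its neighbourhood, to the open set that contains the
  -- trace around it. A separation of the difference would thus become a separation of `D`.
  let I : Set ι := {i | (D ∩ B i) \ C i ⊆ u}
  let u' := (W ∩ u) ∪ ⋃ i ∈ I, D ∩ B i
  let v' := (W ∩ v) ∪ ⋃ i ∈ Iᶜ, D ∩ B i
  have hu' : IsOpen u' := (hopen.inter hu).union
    (isOpen_biUnion fun i _ => hDo.inter (hB i))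
  have hv' : IsOpen v' := (hopen.inter hv).union
    (isOpen_biUnion fun i _ => hDo.inter (hB i))
  have hcov : D ⊆ u' ∪ v' := by
    intro x hx
    by_cases hxW : x ∈ W
    · rcases huv hxW with h | h
      · exact Or.inl (Or.inl ⟨hxW, h⟩)
      · exact Or.inr (Or.inl ⟨hxW, h⟩)
    · have : x ∈ ⋃ i, C i := by
        by_contra h; exact hxW ⟨hx, h⟩
      obtain ⟨i, hi⟩ := mem_iUnion.1 this
      by_cases hiI : i ∈ I
      · exact Or.inl (Or.inr (mem_iUnion₂.2 ⟨i, hiI, hx, hCB i hi⟩))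
      · exact Or.inr (Or.inr (mem_iUnion₂.2 ⟨i, hiI, hx, hCB i hi⟩))
  have hWu : ∀ i, ∀ x ∈ W, x ∈ B i → i ∉ I → x ∈ v := fun i x hx hxB hi =>
    ((hsplit i).resolve_left hi) ⟨⟨hx.1, hxB⟩, fun h => hx.2 (mem_iUnion.2 ⟨i, h⟩)⟩
  have hWv : ∀ i, ∀ x ∈ W, x ∈ B i → i ∈ I → x ∈ u := fun i x hx hxB hi =>
    hi ⟨⟨hx.1, hxB⟩, fun h => hx.2 (mem_iUnion.2 ⟨i, h⟩)⟩
  have hno : ∀ x ∈ W, x ∈ u → x ∈ v → False := fun x hx h1 h2 => by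
    have : x ∈ W ∩ (u ∩ v) := ⟨hx, h1, h2⟩
    rw [hdisj] at this
    exact this
  have hdisj' : D ∩ (u' ∩ v') = ∅ := by
    rw [eq_empty_iff_forall_notMem]
    rintro x ⟨hxD, h1 | h1, h2 | h2⟩
    · exact hno x h1.1 h1.2 h2.2
    · obtain ⟨i, hi, hx⟩ := mem_iUnion₂.1 h2
      exact hno x h1.1 h1.2 (hWu i x h1.1 hx.2 hi)
    · obtain ⟨i, hi, hx⟩ := mem_iUnion₂.1 h1
      exact hno x h2.1 (hWv i x h2.1 hx.2 hi) h2.2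
    · obtain ⟨i, hi, hx⟩ := mem_iUnion₂.1 h1
      obtain ⟨j, hj, hx'⟩ := mem_iUnion₂.1 h2
      have hij : i ≠ j := fun h => hj (h ▸ hi)
      exact disjoint_left.1 (hd i j hij) hx.2 hx'.2
  rcases isPreconnected_iff_subset_of_disjoint.1 hD u' v' hu' hv' hcov hdisj' with h | h
  · left
    intro x hx
    rcases h hx.1 with h1 | h1
    · exact h1.2
    · obtain ⟨i, hi, hx'⟩ := mem_iUnion₂.1 h1
      exact hWv i x hx hx'.2 hi
  · right
    intro x hx
    rcases h hx.1 with h1 | h1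
    · exact h1.2
    · obtain ⟨i, hi, hx'⟩ := mem_iUnion₂.1 h1
      exact hWu i x hx hx'.2 hi

namespace MomentData

variable {d : MomentData}

namespace Sites

variable {n : ℕ} (S : d.Sites n)

/-- An open rectangle around the closed disc. -/
def box (i : Fin n) : Set Plane := {x | |x 0 - S.p i 0| < 2 * S.r i ∧ |x 1 - S.p i 1| < S.H i}

theorem isOpen_box (i : Fin n) : IsOpen (S.box i) :=
  (show IsOpen {x : Plane | |x 0 - S.p i 0| < 2 * S.r i} from
    isOpen_lt (by fun_prop) continuous_const).inter
    (show IsOpen {x : Plane | |x 1 - S.p i 1| < S.H i} from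
      isOpen_lt (by fun_prop) continuous_const)

theorem box_subset_rect {i : Fin n} {x : Plane} (hx : x ∈ S.box i) :
    x ∈ rect (S.p i) (2 * S.r i) (S.H i) := ⟨hx.1.le, hx.2.le⟩

theorem disc_subset_box (i : Fin n) : {x | S.φ i x ≤ 0} ⊆ S.box i := by
  intro x hx
  have hx : S.φ i x ≤ 0 := hx
  have hr := (S.site i).r_pos
  rw [phi_eq] at hx
  constructor
  · exact abs_lt_of_sq_lt_sq (by nlinarith [sq_nonneg (x 1 - S.p i 1)]) (by linarith)
  · exact (abs_le_of_sq_le_sq (by nlinarith [sq_nonneg (x 0 - S.p i 0)]) hr.le).trans_lt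
      (S.site i).r_lt

theorem box_disjoint (i j : Fin n) (hij : i ≠ j) : Disjoint (S.box i) (S.box j) := by
  rw [disjoint_left]
  intro x hi hj
  have h1 := S.strips i j hij
  have h2 := abs_sub_le (S.p i 0) (x 0) (S.p j 0)
  rw [abs_sub_comm (S.p i 0) (x 0)] at h2
  linarith [hi.1, hj.1]

/-- The trace of the region on the box, outside the disc. -/
def collar (i : Fin n) : Set Plane :=
  {x | x ∈ S.box i ∧ 0 < polyFun (d.f (S.k i)) x ∧ 0 < S.φ i x}

/-- Along a segment that goes towards the side `σ` and downwards the function of the curve stays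
positive by monotonicity, so only the circle has to be avoided. -/
theorem collar_segment {i : Fin n} {y z : Plane} (hy : y ∈ S.box i) (hz : z ∈ S.box i)
    (hf : 0 < polyFun (d.f (S.k i)) y) (h0 : S.σ i * y 0 ≤ S.σ i * z 0) (h1 : z 1 ≤ y 1)
    (hφ : ∀ x : Plane, S.σ i * y 0 ≤ S.σ i * x 0 → S.σ i * x 0 ≤ S.σ i * z 0 → z 1 ≤ x 1 →
      x 1 ≤ y 1 → 0 < S.φ i x) : segment ℝ y z ⊆ S.collar i := by
  rintro x ⟨a, b, ha, hb, hab, rfl⟩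
  obtain rfl : a = 1 - b := by linarith
  have e0 : ((1 - b) • y + b • z : Plane) 0 = y 0 + b * (z 0 - y 0) := by simp; ring
  have e1 : ((1 - b) • y + b • z : Plane) 1 = y 1 + b * (z 1 - y 1) := by simp; ring
  have c1 : S.σ i * y 0 ≤ S.σ i * ((1 - b) • y + b • z : Plane) 0 := by rw [e0]; nlinarith
  have c2 : S.σ i * ((1 - b) • y + b • z : Plane) 0 ≤ S.σ i * z 0 := by rw [e0]; nlinarith
  have c3 : z 1 ≤ ((1 - b) • y + b • z : Plane) 1 := by rw [e1]; nlinarith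
  have c4 : ((1 - b) • y + b • z : Plane) 1 ≤ y 1 := by rw [e1]; nlinarith
  set x : Plane := (1 - b) • y + b • z with hx
  have hxb : x ∈ S.box i := by
    constructor
    · have h2 := hy.1
      have h3 := hz.1
      rw [← S.abs_sigma_mul i, abs_lt] at h2 h3 ⊢
      constructor <;> nlinarith
    · have h2 := abs_lt.1 hy.2
      have h3 := abs_lt.1 hz.2
      rw [abs_lt]
      constructor <;> linarith
  refine ⟨hxb, ?_, hφ x c1 c2 c3 c4⟩
  by_cases hxy : y = x
  · rw [← hxy]; exact hf
  · exact hf.trans ((S.wide i).mono y (S.box_subset_rect hy) x (S.box_subset_rect hxb) c1 c4 hxy)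

/-- Every point is joined to a base point `q`, below the disc and beyond it on the side `σ`, by a
broken line in horizontal and vertical steps that passes around the disc. -/
theorem isPreconnected_collar (i : Fin n) : IsPreconnected (S.collar i) := by
  have hr := (S.site i).r_pos
  have hH := (S.site i).r_lt
  have hσ := S.sigma_sq i
  let P := S.p i
  -- Half-way between the bottom of the disc and the bottom of the box.
  let h : ℝ := P 1 - (S.r i + S.H i) / 2
  let pt : ℝ → ℝ → Plane := fun a b => !₂[P 0 + S.σ i * a, b]
  have pt0 : ∀ a b, S.σ i * (pt a b) 0 = S.σ i * P 0 + a := fun a b => by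
    simp only [pt, Fin.isValue, Matrix.cons_val_zero]; linear_combination a * hσ
  have pt1 : ∀ a b, (pt a b) 1 = b := fun a b => rfl
  have ptbox : ∀ a b, |a| < 2 * S.r i → |b - P 1| < S.H i → pt a b ∈ S.box i := fun a b ha hb => by
    refine ⟨?_, hb⟩
    rw [← S.abs_sigma_mul i, mul_sub, pt0]
    simpa [P] using ha
  have hσφ : ∀ x : Plane, S.φ i x = (S.σ i * x 0 - S.σ i * P 0) ^ 2 + (x 1 - P 1) ^ 2 - S.r i ^ 2 :=
    fun x => by
      rw [phi_eq]; linear_combination (-(x 0 - P 0) ^ 2) * hσ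
  let q : Plane := pt (3 / 2 * S.r i) h
  have hhbox : |h - P 1| < S.H i := by
    rw [abs_lt]; constructor <;> simp only [h] <;> linarith
  have hqb : q ∈ S.box i := ptbox _ _ (by rw [abs_of_pos] <;> linarith) hhbox
  have wide : ∀ x : Plane, S.σ i * P 0 + 3 / 2 * S.r i ≤ S.σ i * x 0 → 0 < S.φ i x := fun x hx => by
    rw [hσφ]; nlinarith [sq_nonneg (x 1 - P 1)]
  have low : ∀ x : Plane, x 1 ≤ h → 0 < S.φ i x := fun x hx => by
    rw [hσφ]
    have : S.r i < P 1 - x 1 := by simp only [h] at hx; linarith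
    nlinarith [sq_nonneg (S.σ i * x 0 - S.σ i * P 0)]
  have hcen : P ∈ rect (S.p i) (2 * S.r i) (S.H i) := by
    constructor <;> simp [P] <;> linarith
  have hzero : polyFun (d.f (S.k i)) P = 0 := (S.site i).zero
  have hqf : 0 < polyFun (d.f (S.k i)) q := by
    rw [← hzero]
    refine (S.wide i).mono _ hcen q (S.box_subset_rect hqb) ?_ ?_ ?_
    · simp only [q]; rw [pt0]; linarith
    · simp only [q]; rw [pt1]; simp only [h]; linarith
    · intro e
      have := congrArg (fun x : Plane => x 1) e
      simp only [q, pt1, h] at this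
      linarith
  refine isPreconnected_of_forall q fun y hy => ?_
  obtain ⟨hyb, hyf, hyφ⟩ := hy
  set a : ℝ := S.σ i * y 0 - S.σ i * P 0 with ha
  have ha2 : |a| < 2 * S.r i := by
    have := hyb.1
    rw [← S.abs_sigma_mul i, mul_sub] at this
    exact this
  have hya : y = pt a (y 1) := by
    refine plane_ext ?_ rfl
    simp only [pt, Fin.isValue, Matrix.cons_val_zero, ha]
    linear_combination (P 0 - y 0) * hσ
  set A := max a (3 / 2 * S.r i) with hA
  set b := min (y 1) h with hb
  have hAa : a ≤ A := le_max_left _ _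
  have hAr : 3 / 2 * S.r i ≤ A := le_max_right _ _
  have hby : b ≤ y 1 := min_le_left _ _
  have hbh : b ≤ h := min_le_right _ _
  have hA2 : |A| < 2 * S.r i := by
    rw [abs_of_pos (by linarith), hA, max_lt_iff]
    exact ⟨(abs_lt.1 ha2).2, by linarith⟩
  have hb2 : |b - P 1| < S.H i := by
    rw [abs_lt]
    constructor
    · have := (abs_lt.1 hyb.2).1
      have := (abs_lt.1 hhbox).1
      rw [hb, lt_sub_iff_add_lt, lt_min_iff]
      constructor <;> linarith
    · have := (abs_lt.1 hhbox).2
      linarith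
  have hyq : S.σ i * y 0 = S.σ i * P 0 + a := by rw [ha]; ring
  have s1 : segment ℝ q (pt A b) ⊆ S.collar i := by
    refine S.collar_segment hqb (ptbox A b hA2 hb2) hqf ?_ ?_ ?_
    · simp only [q]; rw [pt0, pt0]; linarith
    · simp only [q]; rw [pt1, pt1]; exact hbh
    · intro x _ _ _ hx
      exact low x hx
  have glue : ∀ w : Plane, segment ℝ y w ⊆ S.collar i → segment ℝ w (pt A b) ⊆ S.collar i →
      ∃ t ⊆ S.collar i, q ∈ t ∧ y ∈ t ∧ IsPreconnected t := by
    intro w s2 s3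
    refine ⟨(segment ℝ q (pt A b) ∪ segment ℝ w (pt A b)) ∪ segment ℝ y w,
      union_subset (union_subset s1 s3) s2, Or.inl (Or.inl (left_mem_segment ℝ _ _)),
      Or.inr (left_mem_segment ℝ _ _), ?_⟩
    refine IsPreconnected.union w (Or.inr (left_mem_segment ℝ _ _)) (right_mem_segment ℝ _ _) ?_
      (convex_segment _ _).isPreconnected
    exact IsPreconnected.union (pt A b) (right_mem_segment ℝ _ _) (right_mem_segment ℝ _ _)
      (convex_segment _ _).isPreconnected (convex_segment _ _).isPreconnected
  -- From the upper half or from beyond the disc one moves sideways first and then down. From the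
  -- remaining part of the lower half one moves down first, away from the centre, and then sideways.
  by_cases hcase : P 1 ≤ y 1 ∨ 3 / 2 * S.r i ≤ a
  · have hwb : pt A (y 1) ∈ S.box i := ptbox _ _ hA2 hyb.2
    have s2 : segment ℝ y (pt A (y 1)) ⊆ S.collar i := by
      refine S.collar_segment hyb hwb hyf (by rw [pt0]; linarith) (by rw [pt1]) ?_
      intro x hx _ hx1 hx2
      have hx1' : x 1 = y 1 := le_antisymm hx2 hx1
      rcases hcase with hc | hc
      · have hapos : 0 < a := by
          by_contra hcon
          have := (S.wide i).mono y (S.box_subset_rect hyb) P hcen (by linarith) hc ?_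
          · linarith
          · intro e
            rw [e] at hyf; linarith
        rw [hσφ] at hyφ ⊢
        rw [hx1']
        nlinarith
      · exact wide x (by linarith)
    refine glue _ s2 ?_
    refine S.collar_segment hwb (ptbox A b hA2 hb2) (s2 (right_mem_segment ℝ _ _)).2.1
      (by rw [pt0, pt0]) (by rw [pt1, pt1]; exact hby) ?_
    intro x hx _ _ _
    rw [pt0] at hx
    exact wide x (by linarith)
  · push Not at hcase
    have hwb : pt a b ∈ S.box i := ptbox _ _ ha2 hb2
    have s2 : segment ℝ y (pt a b) ⊆ S.collar i := by
      refine S.collar_segment hyb hwb hyf (by rw [pt0]; linarith) (by rw [pt1]; exact hby) ?_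
      intro x hx hx' _ hx2
      rw [pt0] at hx'
      have : S.σ i * x 0 = S.σ i * y 0 := by linarith
      rw [hσφ] at hyφ ⊢
      rw [this]
      nlinarith [hcase.1]
    refine glue _ s2 ?_
    refine S.collar_segment hwb (ptbox A b hA2 hb2) (s2 (right_mem_segment ℝ _ _)).2.1
      (by rw [pt0, pt0]; linarith) (by rw [pt1, pt1]) ?_
    intro x _ _ _ hx
    exact low x (hx.trans hbh)

variable {i₀ : Fin d.l₂} (h : d.IsGood i₀)

include h

/-- `IsPreconnected.sdiff_of_locally` reduces the claim to the disjoint boxes. In each of them only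
the curve of the site bounds `D`, so the trace outside the disc is the collar. -/
theorem isPreconnected_region : IsPreconnected S.region := by
  have e : S.region = d.D \ ⋃ i, {x | S.φ i x ≤ 0} := by
    ext x
    simp [region]
  rw [e]
  refine IsPreconnected.sdiff_of_locally (B := S.box) h.adm.isConnected.isPreconnected h.adm.isOpen
    S.isOpen_box S.disc_subset_box S.box_disjoint (e ▸ S.isOpen_region h) fun i => ?_
  convert S.isPreconnected_collar i using 1
  ext x
  constructor
  · rintro ⟨⟨hx, hb⟩, hφ⟩
    refine ⟨hb, ?_, not_le.1 hφ⟩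
    rw [h.region] at hx
    exact hx _
  · rintro ⟨hb, hx, hφ⟩
    refine ⟨⟨?_, hb⟩, not_le.2 hφ⟩
    rw [h.region]
    intro j
    by_cases hj : j = S.k i
    · rw [hj]; exact hx
    · exact (S.wide i).others x (S.box_subset_rect hb) j hj

end Sites

end MomentData

/-! ### The enlarged data: admissibility, zero set and singular points -/

theorem nonneg_of_prod_nonneg {ι : Type*} {s : Finset ι} {g : ι → ℝ}
    (hneg : ∀ i ∈ s, ∀ j ∈ s, i ≠ j → g i < 0 → 0 < g j) (h : 0 ≤ ∏ i ∈ s, g i) :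
    ∀ i ∈ s, 0 ≤ g i := by
  classical
  intro i hi
  by_contra hcon
  push Not at hcon
  rw [← Finset.mul_prod_erase s g hi] at h
  have : 0 < ∏ j ∈ s.erase i, g j := Finset.prod_pos fun j hj =>
    hneg i hi j (Finset.mem_of_mem_erase hj) (Finset.ne_of_mem_erase hj).symm hcon
  nlinarith [mul_pos (neg_pos.2 hcon) this]

/-- Maps with the same fibres have images of the same cardinality. -/
theorem Set.ncard_image_eq_of_ker_eq {α β γ : Type*} {A : Set α} {f : α → β} {g : α → γ}
    (h : ∀ x ∈ A, ∀ y ∈ A, f x = f y ↔ g x = g y) : (f '' A).ncard = (g '' A).ncard := by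
  obtain ⟨B, hBA, hB⟩ := exists_subset_bijOn A f
  have h1 : g '' B = g '' A := by
    refine Subset.antisymm (image_mono hBA) ?_
    rintro _ ⟨x, hx, rfl⟩
    obtain ⟨y, hy, hyx⟩ := hB.surjOn (mem_image_of_mem f hx)
    exact ⟨y, hy, (h y (hBA hy) x hx).1 hyx⟩
  rw [← hB.image_eq, ← h1, hB.injOn.ncard_image, InjOn.ncard_image]
  intro x hx y hy hxy
  exact hB.injOn hx hy ((h x (hBA hx) y (hBA hy)).2 hxy)

namespace MomentData

variable {d : MomentData}

namespace Sites

variable {n : ℕ} (S : d.Sites n) (m₀ m : ℕ)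

/-- The data obtained by adding the circles of the sites, with a second colour, and by cutting off
their discs. -/
def add : MomentData where
  l₁ := d.l₁ + n
  l₂ := 2
  D := S.region
  f := Fin.append d.f fun i => circlePoly (S.p i) (S.r i)
  c := Fin.append (fun _ => 0) fun _ => 1
  μ := ![m₀, m - m₀ - 2]

/-- The index of an old curve. -/
def old (j : Fin d.l₁) : Fin (S.add m₀ m).l₁ := Fin.castAdd n j

/-- The index of a new circle. -/
def new (i : Fin n) : Fin (S.add m₀ m).l₁ := Fin.natAdd d.l₁ i

theorem val_old (j : Fin d.l₁) : (S.old m₀ m j).val = j.val := rfl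

theorem val_new (i : Fin n) : (S.new m₀ m i).val = d.l₁ + i.val := rfl

theorem index_cases (j : Fin (S.add m₀ m).l₁) :
    (∃ k, j = S.old m₀ m k) ∨ ∃ i, j = S.new m₀ m i := by
  refine Fin.addCases (motive := fun j : Fin (d.l₁ + n) =>
    (∃ k, j = S.old m₀ m k) ∨ ∃ i, j = S.new m₀ m i) (fun k => Or.inl ⟨k, rfl⟩)
    (fun i => Or.inr ⟨i, rfl⟩) j

@[simp] theorem f_old (j : Fin d.l₁) : (S.add m₀ m).f (S.old m₀ m j) = d.f j :=
  Fin.append_left d.f (fun i => circlePoly (S.p i) (S.r i)) j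

@[simp] theorem f_new (i : Fin n) :
    (S.add m₀ m).f (S.new m₀ m i) = circlePoly (S.p i) (S.r i) :=
  Fin.append_right d.f (fun i => circlePoly (S.p i) (S.r i)) i

theorem polyFun_new (i : Fin n) : polyFun ((S.add m₀ m).f (S.new m₀ m i)) = S.φ i := by
  rw [f_new, polyFun_circlePoly]; rfl

theorem c_old (j : Fin d.l₁) : (S.add m₀ m).c (S.old m₀ m j) = (0 : Fin 2) :=
  Fin.append_left (fun _ : Fin d.l₁ => (0 : Fin 2)) (fun _ : Fin n => (1 : Fin 2)) j

theorem c_new (i : Fin n) : (S.add m₀ m).c (S.new m₀ m i) = (1 : Fin 2) :=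
  Fin.append_right (fun _ : Fin d.l₁ => (0 : Fin 2)) (fun _ : Fin n => (1 : Fin 2)) i

theorem D_add : (S.add m₀ m).D = S.region := rfl

theorem forall_index {P : (Plane → ℝ) → Prop} :
    (∀ j, P (polyFun ((S.add m₀ m).f j))) ↔ (∀ j, P (polyFun (d.f j))) ∧ ∀ i, P (S.φ i) := by
  constructor
  · intro h
    exact ⟨fun j => by simpa using h (S.old m₀ m j), fun i => by
      rw [← S.polyFun_new m₀ m i]; exact h _⟩
  · rintro ⟨h1, h2⟩ j
    rcases S.index_cases m₀ m j with ⟨k, rfl⟩ | ⟨i, rfl⟩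
    · simpa using h1 k
    · rw [S.polyFun_new m₀ m i]; exact h2 i

theorem eq_of_phi {i i' : Fin n} {x : Plane} (h : S.φ i x ≤ 0) (h' : S.φ i' x ≤ 0) : i = i' :=
  S.eq_of_strip (S.mem_rect_of_phi h).1 (S.mem_rect_of_phi h').1

theorem eq_k_of_zero {i : Fin n} {j : Fin d.l₁} {x : Plane} (h : S.φ i x = 0)
    (hj : polyFun (d.f j) x = 0) : j = S.k i := by
  by_contra hne
  exact ((S.site i).others x (S.mem_rect_of_phi h.le) j hne).ne' hj

theorem ne_center {i : Fin n} {x : Plane} (h : S.φ i x = 0) : x ≠ S.p i := fun e => by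
  rw [e, phi_eq] at h
  nlinarith [(S.site i).r_pos]

/-- The new circles meet the old curves transversally. -/
theorem eq_zero_of_fderiv {i : Fin n} {x v : Plane} (h : S.φ i x = 0)
    (h0 : polyFun (d.f (S.k i)) x = 0) (h1 : fderiv ℝ (S.φ i) x v = 0)
    (h2 : fderiv ℝ (polyFun (d.f (S.k i))) x v = 0) : v = 0 := by
  have hR := S.mem_rect_of_phi h.le
  have hv := (S.site i).vert x hR
  have hh := (S.site i).horiz x hR
  have hσ := S.sigma_sq i
  rw [φ, fderiv_circFun] at h1
  rw [fderiv_plane_apply] at h2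
  set a := fderiv ℝ (polyFun (d.f (S.k i))) x !₂[1, 0]
  set b := fderiv ℝ (polyFun (d.f (S.k i))) x !₂[0, 1]
  have hdet : (S.σ i * (x 0 - S.p i 0)) * b - (x 1 - S.p i 1) * (S.σ i * a) ≠ 0 := by
    rcases S.quadrant hR h0 (S.ne_center h) with ⟨c1, c2⟩ | ⟨c1, c2⟩
    · have e1 := mul_pos c1 (neg_pos.2 hv)
      have e2 := mul_pos c2 hh
      intro e; linarith
    · have e1 := mul_pos (neg_pos.2 c1) (neg_pos.2 hv)
      have e2 := mul_pos (neg_pos.2 c2) hh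
      intro e; linarith
  have hv0 : ((S.σ i * (x 0 - S.p i 0)) * b - (x 1 - S.p i 1) * (S.σ i * a)) * v 0 = 0 := by
    linear_combination (S.σ i * b / 2) * h1 - (S.σ i * (x 1 - S.p i 1)) * h2
  have hv1 : ((S.σ i * (x 0 - S.p i 0)) * b - (x 1 - S.p i 1) * (S.σ i * a)) * v 1 = 0 := by
    linear_combination (-(S.σ i * a) / 2) * h1 + (S.σ i * (x 0 - S.p i 0)) * h2
  exact plane_ext ((mul_eq_zero.1 hv0).resolve_left hdet) ((mul_eq_zero.1 hv1).resolve_left hdet)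

variable {m₀ m}

theorem isCircFun_add (hc : ∀ j, IsCircFun (polyFun (d.f j))) :
    ∀ j, IsCircFun (polyFun ((S.add m₀ m).f j)) :=
  (S.forall_index m₀ m (P := IsCircFun)).2 ⟨hc, S.isCircFun_phi⟩

theorem apex_pos (i : Fin n) : 0 < polyFun (d.f (S.k i)) (S.apex i) := by
  rw [← (S.site i).zero]
  refine (S.site i).mono _ (S.center_mem_rect i) _ (S.mem_rect_of_phi (S.phi_apex i).le) ?_ le_rfl
    (S.ne_center (S.phi_apex i)).symm
  have := S.sigma_sq i
  have hr := (S.site i).r_pos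
  simp only [apex, Fin.isValue, Matrix.cons_val_zero]
  nlinarith

theorem finite_inter_curve (i : Fin n) : (curve (d.f (S.k i)) ∩ {x | S.φ i x = 0}).Finite :=
  (Set.toFinite {S.tip i, S.foot i}).subset fun _ hx => S.eq_tip_or_foot hx.2 hx.1

variable {i₀ : Fin d.l₂} (h : d.IsGood i₀)
  (hdisj : ∀ i j, i ≠ j → Disjoint (curve (d.f i)) (curve (d.f j)))

include h

theorem closure_add : closure (S.add m₀ m).D = S.K := S.closure_region h

theorem mem_K_of_phi {i : Fin n} {x : Plane} (hx : S.φ i x = 0)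
    (h0 : 0 ≤ polyFun (d.f (S.k i)) x) : x ∈ S.K := by
  have hR := S.mem_rect_of_phi hx.le
  refine ⟨S.mem_closure_of_rect h hR h0, fun i' => ?_⟩
  by_cases hi : i' = i
  · rw [hi, hx]
  · exact (S.phi_pos_of_ne hi hR.1).le

omit h in
theorem sing_subset_K : d.sing ⊆ S.K := fun x hx =>
  ⟨hx.1, fun i => (S.phi_pos (S.avoid i x hx)).le⟩

include hdisj

omit h in
/-- Two distinct curves of the new data that meet are an old curve and a new circle. -/
theorem pair_cases {j k : Fin (S.add m₀ m).l₁} (hjk : j ≠ k) {x : Plane}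
    (hj : polyFun ((S.add m₀ m).f j) x = 0) (hk : polyFun ((S.add m₀ m).f k) x = 0) :
    ∃ i, S.φ i x = 0 ∧ polyFun (d.f (S.k i)) x = 0 ∧
      ((j = S.old m₀ m (S.k i) ∧ k = S.new m₀ m i) ∨
        (k = S.old m₀ m (S.k i) ∧ j = S.new m₀ m i)) := by
  rcases S.index_cases m₀ m j with ⟨a, rfl⟩ | ⟨a, rfl⟩ <;>
    rcases S.index_cases m₀ m k with ⟨b, rfl⟩ | ⟨b, rfl⟩
  · rw [f_old] at hj hk
    exact (disjoint_left.1 (hdisj a b fun e => hjk (e ▸ rfl)) hj hk).elim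
  · rw [f_old] at hj
    rw [polyFun_new] at hk
    have := S.eq_k_of_zero hk hj
    subst this
    exact ⟨b, hk, hj, Or.inl ⟨rfl, rfl⟩⟩
  · rw [f_old] at hk
    rw [polyFun_new] at hj
    have := S.eq_k_of_zero hj hk
    subst this
    exact ⟨a, hj, hk, Or.inr ⟨rfl, rfl⟩⟩
  · rw [polyFun_new] at hj hk
    exact (hjk (S.eq_of_phi hj.le hk.le ▸ rfl)).elim

omit h in
theorem injOn_add (s : Finset (Fin (S.add m₀ m).l₁))
    (hs : ∃ p ∈ closure (S.add m₀ m).D, ∀ j ∈ s, p ∈ curve ((S.add m₀ m).f j)) :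
    InjOn (S.add m₀ m).c s := by
  obtain ⟨x, -, hx⟩ := hs
  intro j hj k hk hjk
  by_contra hne
  obtain ⟨i, -, -, ⟨rfl, rfl⟩ | ⟨rfl, rfl⟩⟩ := S.pair_cases hdisj hne (hx j hj) (hx k hk)
  · rw [c_old, c_new] at hjk
    exact absurd (show (0 : Fin 2) = 1 from hjk) (by decide)
  · rw [c_old, c_new] at hjk
    exact absurd (show (1 : Fin 2) = 0 from hjk) (by decide)

theorem isAdmissible_add : (S.add m₀ m).IsAdmissible where
  isOpen := S.isOpen_region h
  isConnected := by
    refine ⟨?_, S.isPreconnected_region h⟩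
    have : (closure S.region).Nonempty := by
      rw [S.closure_region h]
      obtain ⟨x, hx⟩ := h.nonempty_closure
      obtain ⟨z, hz, hmax⟩ := exists_slice_end h.adm.isCompact_closure hx (-1)
      exact ⟨z, (S.slice_bottom h hz hmax).1⟩
    exact closure_nonempty_iff.1 this
  isCompact_closure := by
    rw [S.closure_add h]; exact S.isCompact_K h
  curve_connected j := (S.isCircFun_add h.circ j).isConnected_zero
  curve_nonsingular j x hx := (S.isCircFun_add h.circ j).fderiv_ne_zero hx
  eq_pos := by
    -- The new region is the positivity set in the whole plane, so the neighbourhood `U` plays no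
    -- role.
    refine ⟨univ, isOpen_univ, subset_univ _, fun U _ hU _ => ?_⟩
    ext x
    have e := S.forall_index m₀ m (P := fun g => 0 < g x)
    constructor
    · intro hx
      refine ⟨hU (subset_closure hx), e.2 ⟨?_, hx.2⟩⟩
      have := hx.1
      rw [h.region] at this
      exact this
    · rintro ⟨-, hx⟩
      obtain ⟨h1, h2⟩ := e.1 hx
      refine ⟨?_, h2⟩
      rw [h.region]
      exact h1
  transversal s hs x hx hxs := by
    -- There are two colours, and `c` is injective on the curves through a point.
    have hcard : s.card ≤ 2 := by
      have := Finset.card_le_card_of_injOn (t := (Finset.univ : Finset (Fin 2))) (S.add m₀ m).c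
        (fun j _ => Finset.mem_coe.2 (Finset.mem_univ _)) (S.injOn_add hdisj s ⟨x, hx, hxs⟩)
      simpa using this
    have hpos := hs.card_pos
    obtain hc | hc : s.card = 1 ∨ s.card = 2 := by omega
    · obtain ⟨j, rfl⟩ := Finset.card_eq_one.1 hc
      rw [hc]
      have hj := (S.isCircFun_add h.circ j).fderiv_ne_zero (hxs j (by simp))
      have hj' : ((fderiv ℝ (polyFun ((S.add m₀ m).f j)) x : Plane →L[ℝ] ℝ) : Plane →ₗ[ℝ] ℝ) ≠ 0 :=
        fun e => hj (ContinuousLinearMap.coe_injective e)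
      have := Module.Dual.finrank_ker_add_one_of_ne_zero hj'
      rw [Finset.iInf_singleton]
      rw [finrank_euclideanSpace_fin] at this
      exact this
    · obtain ⟨j, k, hjk, rfl⟩ := Finset.card_eq_two.1 hc
      rw [hc]
      have hj : polyFun ((S.add m₀ m).f j) x = 0 := hxs j (by simp)
      have hk : polyFun ((S.add m₀ m).f k) x = 0 := hxs k (by simp)
      have : (⨅ i ∈ ({j, k} : Finset _), (fderiv ℝ (polyFun ((S.add m₀ m).f i)) x).ker :
          Submodule ℝ Plane) = ⊥ := by
        rw [eq_bot_iff]
        intro v hv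
        simp only [Finset.mem_insert, Finset.mem_singleton, iInf_or, iInf_inf_eq,
          iInf_iInf_eq_left, Submodule.mem_inf] at hv
        have h1 : fderiv ℝ (polyFun ((S.add m₀ m).f j)) x v = 0 := hv.1
        have h2 : fderiv ℝ (polyFun ((S.add m₀ m).f k)) x v = 0 := hv.2
        obtain ⟨i, hi, hi', ⟨rfl, rfl⟩ | ⟨rfl, rfl⟩⟩ := S.pair_cases hdisj hjk hj hk
        · rw [polyFun_new] at h2
          rw [f_old] at h1
          exact S.eq_zero_of_fderiv hi hi' h2 h1
        · rw [polyFun_new] at h1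
          rw [f_old] at h2
          exact S.eq_zero_of_fderiv hi hi' h1 h2
      rw [this, finrank_bot]
  injOn s hs := S.injOn_add hdisj s hs

/-- The distinguished colour is that of the old circles, as every new slice still meets one of them.
The bound on `m` makes the spheres of the new colour positive dimensional, hence connected. -/
theorem isGood_add (hm : m₀ + 2 < m) : (S.add m₀ m).IsGood (0 : Fin 2) where
  adm := S.isAdmissible_add h hdisj
  circ := S.isCircFun_add h.circ
  region := by
    ext x
    have e := S.forall_index m₀ m (P := fun g => 0 < g x)
    rw [mem_ofPred_eq, e, D_add, region, mem_ofPred_eq, h.region]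
    rfl
  closure_region := by
    rw [S.closure_add h]
    ext x
    have e := S.forall_index m₀ m (P := fun g => 0 ≤ g x)
    rw [mem_ofPred_eq, e, K, mem_ofPred_eq, h.mem_closure]
  finite_inter j k hjk := by
    by_cases hne : (curve ((S.add m₀ m).f j) ∩ curve ((S.add m₀ m).f k)).Nonempty
    · obtain ⟨x, hxj, hxk⟩ := hne
      obtain ⟨i, -, -, ⟨rfl, rfl⟩ | ⟨rfl, rfl⟩⟩ := S.pair_cases hdisj hjk hxj hxk
      · convert S.finite_inter_curve i using 2
        · rw [f_old]
        · rw [curve, polyFun_new]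
      · rw [inter_comm]
        convert S.finite_inter_curve i using 2
        · rw [f_old]
        · rw [curve, polyFun_new]
    · rw [not_nonempty_iff_eq_empty.1 hne]; exact finite_empty
  exists_zero x hx := by
    rw [S.closure_add h] at hx ⊢
    obtain ⟨z, hz, j, hj⟩ := S.exists_old_zero h hx
    exact ⟨z, hz, prodFun_eq_zero_iff.2 ⟨S.old m₀ m j, S.c_old m₀ m j, by rwa [f_old]⟩⟩
  pos i hi := by
    have : i = (1 : Fin 2) := by
      change Fin 2 at i
      fin_cases i
      · exact (hi rfl).elim
      · rfl
    subst this
    change 0 < m - m₀ - 2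
    omega

omit h in
/-- Crossing curves are not vertical tangents. -/
theorem fderiv_vertical_ne_zero (x : Plane) (j k : Fin (S.add m₀ m).l₁) (hjk : j ≠ k)
    (hj : polyFun ((S.add m₀ m).f j) x = 0) (hk : polyFun ((S.add m₀ m).f k) x = 0) :
    fderiv ℝ (polyFun ((S.add m₀ m).f j)) x !₂[0, 1] ≠ 0 := by
  obtain ⟨i, hi, hi', ⟨rfl, rfl⟩ | ⟨rfl, rfl⟩⟩ := S.pair_cases hdisj hjk hj hk
  · rw [f_old]
    exact ((S.site i).vert x (S.mem_rect_of_phi hi.le)).ne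
  · rw [polyFun_new, φ, fderiv_circFun]
    have := S.quadrant (S.mem_rect_of_phi hi.le) hi' (S.ne_center hi)
    intro e
    simp at e
    rcases this with ⟨-, c⟩ | ⟨-, c⟩ <;> linarith

-- On the zero set the product of each colour is a sum of squares. At most one factor of a colour
-- can be negative at a point: for the old circles by `hneg`, for the new ones because their discs
-- are disjoint. So all factors are nonnegative.
omit h hdisj in
theorem manifold_eq_zeroSet (hclosure : ∀ x, x ∈ closure d.D ↔ ∀ j, 0 ≤ polyFun (d.f j) x)
    (hK : closure (S.add m₀ m).D = S.K)
    (hneg : ∀ i j, i ≠ j → ∀ x, polyFun (d.f i) x < 0 → 0 < polyFun (d.f j) x) :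
    (S.add m₀ m).manifold = (S.add m₀ m).zeroSet := by
  refine Subset.antisymm (fun p hp => hp.2) fun p hp => ⟨?_, hp⟩
  rw [mem_zeroSet] at hp
  set x := (S.add m₀ m).proj p
  have key : ∀ j, 0 ≤ polyFun ((S.add m₀ m).f j) x := by
    intro j
    have h0 : 0 ≤ (S.add m₀ m).prodFun ((S.add m₀ m).c j) x := by
      rw [hp]; exact Finset.sum_nonneg fun _ _ => sq_nonneg _
    refine nonneg_of_prod_nonneg ?_ h0 j (by simp)
    intro a ha b hb hab hlt
    rw [Finset.mem_filter] at ha hb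
    have hcab := ha.2.trans hb.2.symm
    rcases S.index_cases m₀ m a with ⟨a, rfl⟩ | ⟨a, rfl⟩ <;>
      rcases S.index_cases m₀ m b with ⟨b, rfl⟩ | ⟨b, rfl⟩
    · rw [f_old] at hlt ⊢
      exact hneg a b (fun e => hab (e ▸ rfl)) x hlt
    · rw [c_old, c_new] at hcab; exact absurd (show (0 : Fin 2) = 1 from hcab) (by decide)
    · rw [c_old, c_new] at hcab; exact absurd (show (1 : Fin 2) = 0 from hcab) (by decide)
    · rw [polyFun_new] at hlt ⊢
      exact S.phi_pos_of_ne (fun e => hab (congrArg _ e.symm)) (S.mem_rect_of_phi hlt.le).1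
  obtain ⟨h1, h2⟩ := (S.forall_index m₀ m (P := fun g => 0 ≤ g x)).1 key
  rw [hK]
  exact ⟨(hclosure x).2 h1, h2⟩

omit h hdisj in
theorem dim_add (hm : m₀ + 2 < m) : (S.add m₀ m).dim = m := by
  change 2 + ∑ i : Fin 2, (![m₀, m - m₀ - 2] : Fin 2 → ℕ) i = m
  rw [Fin.sum_univ_two]
  simp
  omega

omit hdisj in
theorem D_add_ne (i : Fin n) : (S.add m₀ m).D ≠ d.D := by
  intro e
  have hr := (S.site i).r_pos
  have hH := (S.site i).r_lt
  -- The point half a radius below the centre lies in `D` and in the removed disc.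
  let x : Plane := !₂[S.p i 0, S.p i 1 - S.r i / 2]
  have hφ : S.φ i x < 0 := by
    rw [phi_eq]; simp [x]; nlinarith
  have hR := S.mem_rect_of_phi hφ.le
  have hx : x ∈ d.D := by
    refine S.mem_D_of_rect h hR ?_
    rw [← (S.site i).zero]
    refine (S.site i).mono _ (S.center_mem_rect i) x hR le_rfl (by simp [x]; linarith) fun e => ?_
    have := congrArg (fun y : Plane => y 1) e
    simp [x] at this
    linarith
  rw [← e] at hx
  exact absurd (hx.2 i) (not_lt.2 hφ.le)

-- The rightmost point of an old circle is singular, and the sites avoid singular points, so it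
-- survives. For a new circle its `apex` serves.
omit hdisj in
theorem inter_curve_nonempty (hcurve : ∀ j, curve (d.f j) ⊆ closure d.D)
    (j : Fin (S.add m₀ m).l₁) :
    ((closure (S.add m₀ m).D \ (S.add m₀ m).D) ∩ curve ((S.add m₀ m).f j)).Nonempty := by
  rw [S.closure_add h]
  rcases S.index_cases m₀ m j with ⟨k, rfl⟩ | ⟨i, rfl⟩
  · obtain ⟨s, P, R, hR, hs, hf⟩ := h.circ k
    let x : Plane := !₂[P 0 + R, P 1]
    have hx : polyFun (d.f k) x = 0 := by rw [hf]; simp [circFun, x]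
    have hsing : x ∈ d.sing := by
      refine ⟨hcurve k hx, fun v hv => ?_⟩
      have := hv k hx
      rw [hf, fderiv_circFun] at this
      simp [x] at this
      rcases this with (h1 | h1) | h1
      · rcases hs with rfl | rfl <;> norm_num at h1
      · exact absurd h1 hR.ne'
      · exact h1
    refine ⟨x, ⟨S.sing_subset_K hsing, fun hxD => ?_⟩, by rw [f_old]; exact hx⟩
    have h1 : x ∈ d.D := hxD.1
    rw [h.region] at h1
    exact (h1 k).ne' hx
  · refine ⟨S.apex i, ⟨S.mem_K_of_phi h (S.phi_apex i) (S.apex_pos i).le, fun hxD => ?_⟩, ?_⟩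
    · exact (hxD.2 i).ne' (S.phi_apex i)
    · change polyFun _ _ = 0
      rw [polyFun_new]; exact S.phi_apex i

omit hdisj in
/-- The singular points of the new data. -/
theorem sing_add : (S.add m₀ m).sing = d.sing ∪ ⋃ i, {S.tip i, S.foot i, S.apex i} := by
  have hK := S.closure_add (m₀ := m₀) (m := m) h
  ext x
  constructor
  · rintro ⟨hx, hv⟩
    rw [hK] at hx
    by_cases hex : ∃ i, S.φ i x = 0
    · obtain ⟨i, hi⟩ := hex
      refine Or.inr (mem_iUnion.2 ⟨i, ?_⟩)
      by_cases h0 : polyFun (d.f (S.k i)) x = 0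
      · rcases S.eq_tip_or_foot hi h0 with e | e
        · exact Or.inl e
        · exact Or.inr (Or.inl e)
      · have hR := S.mem_rect_of_phi hi.le
        -- This vector is tangent to the only curve through `x`, so its first coordinate vanishes
        -- and `x` has the height of the centre. Of the two such points of the circle, only the one
        -- on the side `σ` lies in the closed region.
        have h1 := hv !₂[-(x 1 - S.p i 1), x 0 - S.p i 0] (by
          intro j hj
          rcases S.index_cases m₀ m j with ⟨k, rfl⟩ | ⟨i', rfl⟩
          · rw [f_old] at hj
            exact (h0 (S.eq_k_of_zero hi hj ▸ hj)).elim
          · rw [polyFun_new] at hj ⊢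
            rw [S.eq_of_phi hj.le hi.le, φ, fderiv_circFun]
            simp; ring)
        have h2 : x 1 = S.p i 1 := by simp at h1; linarith
        have h3 := S.side_pos hR (h.mem_closure.1 hx.1 _) h2.ge (S.ne_center hi)
        have h4 : (x 0 - S.p i 0) ^ 2 = S.r i ^ 2 := by
          rw [phi_eq, h2] at hi; linarith
        refine Or.inr (Or.inr (plane_ext ?_ h2))
        simp only [apex, Fin.isValue, Matrix.cons_val_zero]
        have hr := (S.site i).r_pos
        have h5 : S.σ i * (x 0 - S.p i 0) = S.r i := by
          refine (pow_left_inj₀ h3.le hr.le two_ne_zero).1 ?_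
          rw [mul_pow, h4]
          linear_combination (S.r i ^ 2) * S.sigma_sq i
        linear_combination S.σ i * h5 - (x 0 - S.p i 0) * S.sigma_sq i
    · push Not at hex
      refine Or.inl ⟨hx.1, fun v hv' => hv v fun j hj => ?_⟩
      rcases S.index_cases m₀ m j with ⟨k, rfl⟩ | ⟨i', rfl⟩
      · rw [f_old] at hj ⊢
        exact hv' k hj
      · rw [polyFun_new] at hj
        exact (hex i' hj).elim
  · have corner : ∀ i x, S.φ i x = 0 → polyFun (d.f (S.k i)) x = 0 → x ∈ (S.add m₀ m).sing := by
      intro i x h1 h2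
      refine ⟨by rw [hK]; exact S.mem_K_of_phi h h1 h2.ge, fun v hv => ?_⟩
      have a := hv (S.old m₀ m (S.k i)) (by rwa [f_old])
      have b := hv (S.new m₀ m i) (by rwa [polyFun_new])
      rw [f_old] at a
      rw [polyFun_new] at b
      rw [S.eq_zero_of_fderiv h1 h2 b a]
      rfl
    rintro (hx | hx)
    · refine ⟨by rw [hK]; exact S.sing_subset_K hx, fun v hv => hx.2 v fun j hj => ?_⟩
      have := hv (S.old m₀ m j) (by rwa [f_old])
      rwa [f_old] at this
    · obtain ⟨i, rfl | rfl | rfl⟩ := mem_iUnion.1 hx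
      · exact corner i _ (S.phi_tip i) (S.zero_tip i)
      · exact corner i _ (S.phi_foot i) (S.zero_foot i)
      · refine ⟨by rw [hK]; exact S.mem_K_of_phi h (S.phi_apex i) (S.apex_pos i).le, fun v hv => ?_⟩
        have b := hv (S.new m₀ m i) (by rw [polyFun_new]; exact S.phi_apex i)
        rw [polyFun_new, φ, fderiv_circFun] at b
        have hr := (S.site i).r_pos
        simp [apex] at b
        rcases b with (b | b) | b
        · have := S.sigma_sq i
          rw [b] at this; norm_num at this
        · exact absurd b hr.ne'
        · exact b

end Sites

end MomentData

/-! ### The arc between tip and apex, and the number of vertices -/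

namespace MomentData

variable {d : MomentData}

namespace Sites

variable {n : ℕ} (S : d.Sites n) {m₀ m : ℕ}

/-- The point of the upper half of the new circle at the signed distance `a` from the vertical line
through the centre. -/
def arc (i : Fin n) (a : ℝ) : Plane := !₂[S.p i 0 + S.σ i * a, S.p i 1 + √(S.r i ^ 2 - a ^ 2)]

/-- The signed distance of the tip from the vertical line through the centre. -/
def tipPos (i : Fin n) : ℝ := S.σ i * (S.tip i 0 - S.p i 0)

theorem continuous_arc (i : Fin n) : Continuous (S.arc i) := by
  unfold arc; fun_prop

theorem sigma_arc (i : Fin n) (a : ℝ) : S.σ i * (S.arc i a 0 - S.p i 0) = a := by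
  simp only [arc, Fin.isValue, Matrix.cons_val_zero, add_sub_cancel_left]
  linear_combination a * S.sigma_sq i

theorem abs_arc (i : Fin n) (a : ℝ) : |S.arc i a 0 - S.p i 0| = |a| := by
  rw [← S.abs_sigma_mul i, sigma_arc]

theorem phi_arc {i : Fin n} {a : ℝ} (ha : |a| ≤ S.r i) : S.φ i (S.arc i a) = 0 := by
  have h2 := pow_le_pow_left₀ (abs_nonneg _) ha 2
  rw [sq_abs] at h2
  rw [phi_eq, ← sq_abs (S.arc i a 0 - S.p i 0), abs_arc, sq_abs]
  simp only [arc, Fin.isValue, Matrix.cons_val_one, Matrix.cons_val_fin_one, add_sub_cancel_left]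
  rw [Real.sq_sqrt (by linarith)]
  ring

theorem arc_of_phi {i : Fin n} {x : Plane} (hx : S.φ i x = 0) (h1 : S.p i 1 ≤ x 1) :
    x = S.arc i (S.σ i * (x 0 - S.p i 0)) := by
  rw [phi_eq] at hx
  have hσ := S.sigma_sq i
  refine plane_ext ?_ ?_
  · simp only [arc, Fin.isValue, Matrix.cons_val_zero]
    linear_combination (S.p i 0 - x 0) * hσ
  · simp only [arc, Fin.isValue, Matrix.cons_val_one, Matrix.cons_val_fin_one]
    have e : S.r i ^ 2 - (S.σ i * (x 0 - S.p i 0)) ^ 2 = (x 1 - S.p i 1) ^ 2 := by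
      linear_combination -hx - (x 0 - S.p i 0) ^ 2 * hσ
    rw [e, Real.sqrt_sq (by linarith)]
    ring

theorem tip_eq (i : Fin n) : S.tip i = S.arc i (S.tipPos i) :=
  S.arc_of_phi (S.phi_tip i) (by linarith [(S.tip_pos i).2])

theorem apex_eq (i : Fin n) : S.apex i = S.arc i (S.r i) := by
  simp [apex, arc]

theorem tipPos_pos (i : Fin n) : 0 < S.tipPos i := (S.tip_pos i).1

theorem tipPos_lt (i : Fin n) : S.tipPos i < S.r i := by
  have h0 := S.phi_tip i
  have h2 := (S.tip_pos i).2
  rw [phi_eq] at h0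
  refine lt_of_pow_lt_pow_left₀ 2 (S.site i).r_pos.le ?_
  have hσ := S.sigma_sq i
  have e : S.tipPos i ^ 2 = (S.tip i 0 - S.p i 0) ^ 2 := by
    rw [tipPos]; linear_combination (S.tip i 0 - S.p i 0) ^ 2 * hσ
  nlinarith

theorem arc_mem_wh {i : Fin n} {a : ℝ} (h0 : 0 < a) (h1 : a < S.r i) : S.arc i a ∈ S.wh i := by
  have hr := (S.site i).r_pos
  have hH := (S.site i).r_lt
  have hpos : 0 < S.r i ^ 2 - a ^ 2 := by nlinarith
  refine ⟨by rw [abs_arc, abs_of_pos h0]; exact h1, ?_, ?_⟩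
  · simp only [arc, Fin.isValue, Matrix.cons_val_one, Matrix.cons_val_fin_one]
    linarith [Real.sqrt_pos.2 hpos]
  · simp only [arc, Fin.isValue, Matrix.cons_val_one, Matrix.cons_val_fin_one]
    have : √(S.r i ^ 2 - a ^ 2) ≤ S.r i := by
      rw [Real.sqrt_le_iff]; exact ⟨hr.le, by nlinarith⟩
    linarith

/-- From the tip to the apex the arc goes towards the side `σ` and downwards, so the function of the
curve grows from its value zero at the tip. -/
theorem arc_pos {i : Fin n} {a : ℝ} (h0 : S.tipPos i ≤ a) (h1 : a ≤ S.r i) :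
    0 ≤ polyFun (d.f (S.k i)) (S.arc i a) := by
  have ht := S.tipPos_pos i
  rw [← S.zero_tip i, S.tip_eq]
  by_cases hne : S.arc i (S.tipPos i) = S.arc i a
  · rw [hne]
  · refine ((S.site i).mono _ ?_ _ ?_ ?_ ?_ hne).le
    · rw [← S.tip_eq]; exact S.mem_rect_of_phi (S.phi_tip i).le
    · exact S.mem_rect_of_phi (S.phi_arc (by rw [abs_of_pos] <;> linarith)).le
    · have e1 := S.sigma_arc i a
      have e2 := S.sigma_arc i (S.tipPos i)
      linarith
    · simp only [arc, Fin.isValue, Matrix.cons_val_one, Matrix.cons_val_fin_one]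
      have := Real.sqrt_le_sqrt (show S.r i ^ 2 - a ^ 2 ≤ S.r i ^ 2 - S.tipPos i ^ 2 by nlinarith)
      linarith

variable {i₀ : Fin d.l₂} (h : d.IsGood i₀)

include h

theorem arc_mem_K {i : Fin n} {a : ℝ} (h0 : S.tipPos i ≤ a) (h1 : a ≤ S.r i) :
    S.arc i a ∈ S.K := by
  have ht := S.tipPos_pos i
  exact S.mem_K_of_phi h (S.phi_arc (by rw [abs_of_pos] <;> linarith)) (S.arc_pos h0 h1)

/-- The points of a whisker lie on slices through the arc between the tip and the apex. -/
theorem sliceRel_arc {i : Fin n} {x : Plane} (hx : x ∈ S.K) (hxw : x ∈ S.wh i) :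
    ∃ a ∈ Ico (S.tipPos i) (S.r i), SliceRel S.K x (S.arc i a) := by
  have hr := (S.site i).r_pos
  have hσ := S.sigma_sq i
  have hR := S.wh_subset_rect hxw
  have hfx := h.mem_closure.1 hx.1 (S.k i)
  have hφx := hx.2 i
  have hne : x ≠ S.p i := fun e => by
    have := hxw.2.1
    rw [e] at this
    exact lt_irrefl _ this
  set a := S.σ i * (x 0 - S.p i 0) with ha
  have h0 : 0 < a := S.side_pos hR hfx hxw.2.1.le hne
  have h1 : a < S.r i := by
    have := hxw.1
    rw [← S.abs_sigma_mul i, ← ha, abs_of_pos h0] at this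
    exact this
  have hx0 : x 0 = S.arc i a 0 := by
    simp only [arc, Fin.isValue, Matrix.cons_val_zero, ha]
    linear_combination (S.p i 0 - x 0) * hσ
  have hle : S.arc i a 1 ≤ x 1 := by
    have e := S.phi_arc (i := i) (a := a) (by rw [abs_of_pos h0]; exact h1.le)
    have hw := (S.arc_mem_wh h0 h1).2.1
    rw [phi_eq] at e hφx
    rw [hx0] at hφx
    have := hxw.2.1
    nlinarith
  have hcR : S.arc i a ∈ rect (S.p i) (S.r i) (S.H i) := S.wh_subset_rect (S.arc_mem_wh h0 h1)
  have hfc : 0 ≤ polyFun (d.f (S.k i)) (S.arc i a) := by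
    by_cases he : x = S.arc i a
    · rw [← he]; exact hfx
    · exact hfx.trans ((S.site i).mono x hR _ hcR (by rw [hx0]) hle he).le
  -- Before the tip the function of the curve is negative on the arc, by monotonicity.
  have hta : S.tipPos i ≤ a := by
    by_contra hcon
    push Not at hcon
    have htl := S.tipPos_lt i
    have : polyFun (d.f (S.k i)) (S.arc i a) < polyFun (d.f (S.k i)) (S.tip i) := by
      refine (S.site i).mono _ hcR _ (S.mem_rect_of_phi (S.phi_tip i).le) ?_ ?_ ?_
      · have e1 := S.sigma_arc i a
        have e2 : S.tipPos i = S.σ i * (S.tip i 0 - S.p i 0) := rfl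
        linarith
      · rw [S.tip_eq]
        simp only [arc, Fin.isValue, Matrix.cons_val_one, Matrix.cons_val_fin_one]
        have := Real.sqrt_le_sqrt (show S.r i ^ 2 - S.tipPos i ^ 2 ≤ S.r i ^ 2 - a ^ 2 by nlinarith)
        linarith
      · intro e
        have e1 := S.sigma_arc i a
        rw [e] at e1
        exact hcon.ne' e1
    rw [S.zero_tip i] at this
    linarith
  exact ⟨a, ⟨hta, h1⟩, S.wh_slice h hx (S.arc_mem_K h hta h1.le) hxw (S.arc_mem_wh h0 h1) hx0⟩

variable (hdisj : ∀ i j, i ≠ j → Disjoint (curve (d.f i)) (curve (d.f j)))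

include hdisj

/-- Old singular points lie over no new strip, so they are in no whisker and are identified as
before. The three new singular points of each circle have first coordinates different from one
another, from those of the other circles and from the old critical values, so their classes are all
new and distinct. -/
theorem ncard_vertices_add (hm : m₀ + 2 < m) :
    (S.add m₀ m).vertices.ncard = d.vertices.ncard + 3 * n := by
  have h' := S.isGood_add h hdisj hm
  have hK := S.closure_add (m₀ := m₀) (m := m) h
  have := h'.finite_vertices
  rw [h'.vertices_eq, S.sing_add h, image_union] at this ⊢
  let q : Fin n × Fin 3 → Plane := fun a => ![S.tip a.1, S.foot a.1, S.apex a.1] a.2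
  have hq0 : ∀ a, S.φ a.1 (q a) = 0 := by
    rintro ⟨i, b⟩
    fin_cases b
    · exact S.phi_tip i
    · exact S.phi_foot i
    · exact S.phi_apex i
  have hqf : ∀ a, 0 ≤ polyFun (d.f (S.k a.1)) (q a) := by
    rintro ⟨i, b⟩
    fin_cases b
    · exact (S.zero_tip i).ge
    · exact (S.zero_foot i).ge
    · exact (S.apex_pos i).le
  have hqK : ∀ a, q a ∈ closure (S.add m₀ m).D := fun a => by
    rw [hK]; exact S.mem_K_of_phi h (hq0 a) (hqf a)
  have hqr : ∀ a, |q a 0 - S.p a.1 0| ≤ S.r a.1 := fun a => (S.mem_rect_of_phi (hq0 a).le).1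
  have himg : (⋃ i, {S.tip i, S.foot i, S.apex i} : Set Plane) = range q := by
    ext x
    rw [mem_iUnion]
    constructor
    · rintro ⟨i, rfl | rfl | rfl⟩
      · exact ⟨(i, 0), rfl⟩
      · exact ⟨(i, 1), rfl⟩
      · exact ⟨(i, 2), rfl⟩
    · rintro ⟨⟨i, b⟩, rfl⟩
      refine ⟨i, ?_⟩
      fin_cases b
      · exact Or.inl rfl
      · exact Or.inr (Or.inl rfl)
      · exact Or.inr (Or.inr rfl)
  -- Different circles lie over disjoint strips. Within one strip the signed distances of foot, tip
  -- and apex from the centre are a negative number, a number between `0` and `r`, and `r`.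
  have hinj : Function.Injective fun a => q a 0 := by
    rintro ⟨i, b⟩ ⟨i', b'⟩ hab
    have hab : q (i, b) 0 = q (i', b') 0 := hab
    have h1 := hqr (i, b)
    have h2 := hqr (i', b')
    rw [← hab] at h2
    obtain rfl : i = i' := S.eq_of_strip h1 h2
    have hs : S.σ i * (q (i, b) 0 - S.p i 0) = S.σ i * (q (i, b') 0 - S.p i 0) := by rw [hab]
    have e0 : S.σ i * (q (i, 0) 0 - S.p i 0) = S.tipPos i := rfl
    have e1 : S.σ i * (q (i, 1) 0 - S.p i 0) < 0 := (S.foot_neg i).1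
    have e2 : S.σ i * (q (i, 2) 0 - S.p i 0) = S.r i := by
      have := S.sigma_arc i (S.r i)
      rw [← S.apex_eq] at this
      exact this
    have t1 := S.tipPos_pos i
    have t2 := S.tipPos_lt i
    have : b = b' := by
      fin_cases b <;> fin_cases b' <;> first
        | rfl
        | (exfalso; change _ = _ at hs
           simp only [Fin.zero_eta, Fin.mk_one, Fin.reduceFinMk] at hs; linarith)
    rw [this]
  rw [himg, ← range_comp] at this ⊢
  rw [ncard_union_eq ?_ (this.subset subset_union_left) (this.subset subset_union_right)]
  · congr 1
    · rw [h.vertices_eq]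
      -- The classes live in two different Reeb spaces, so the two class maps are compared through
      -- their fibres on the old singular points.
      refine ncard_image_eq_of_ker_eq fun x hx y hy => ?_
      have hx' := S.sing_subset_K hx
      have hy' := S.sing_subset_K hy
      have hnw : ∀ x ∈ d.sing, ∀ i, x ∉ S.wh i := fun x hx i hi =>
        lt_asymm (S.avoid i x hx) hi.1
      rw [h'.cls_eq_iff (by rw [hK]; exact hx') (by rw [hK]; exact hy'), h.cls_eq_iff hx.1 hy.1, hK]
      exact ⟨fun e => e.mono fun z hz => hz.1,
        S.sliceRel_of_not_wh h hx' hy' (hnw x hx) (hnw y hy)⟩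
    · rw [← image_univ, InjOn.ncard_image, ncard_univ, Nat.card_eq_fintype_card]
      · simp [mul_comm]
      · intro a _ b _ hab
        have := congrArg (reebHeight (S.add m₀ m).heightOn) hab
        simp only [Function.comp] at this
        rw [h'.reebHeight_cls (hqK a), h'.reebHeight_cls (hqK b)] at this
        exact hinj this
  · rw [disjoint_left]
    rintro _ ⟨x, hx, rfl⟩ ⟨a, ha⟩
    have := congrArg (reebHeight (S.add m₀ m).heightOn) ha
    simp only [Function.comp] at this
    rw [h'.reebHeight_cls (hqK a), h'.reebHeight_cls (by rw [hK]; exact S.sing_subset_K hx)] at this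
    have h1 := hqr a
    rw [this] at h1
    exact absurd (S.avoid a.1 x hx) (not_lt.2 h1)

end Sites

end MomentData

/-! ### Whiskers and their collapse -/

theorem eq_of_mem_edgeSet {X : Type*} [TopologicalSpace X] {V e e' : Set X} (he : e ∈ edgeSet V)
    (he' : e' ∈ edgeSet V) {x : X} (hx : x ∈ e) (hx' : x ∈ e') : e = e' := by
  obtain ⟨y, -, rfl⟩ := he
  obtain ⟨z, -, rfl⟩ := he'
  exact (connectedComponentIn_eq hx).trans (connectedComponentIn_eq hx').symm

theorem subset_compl_of_mem_edgeSet {X : Type*} [TopologicalSpace X] {V e : Set X}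
    (he : e ∈ edgeSet V) : e ⊆ Vᶜ := by
  obtain ⟨y, -, rfl⟩ := he
  exact connectedComponentIn_subset _ _

/-- Finitely many disjoint open half-open edges can be collapsed successively. -/
theorem reflTransGen_elementaryCollapse {X ι : Type*} [TopologicalSpace X] [Finite ι] {V : Set X}
    {v : ι → X} {e : ι → Set X} (hv : ∀ i, v i ∈ V) (he : ∀ i, e i ∈ edgeSet V)
    (hve : ∀ i, v i ∈ closure (e i)) (ho : ∀ i, IsOpen (e i ∪ {v i}))
    (hd : ∀ i j, i ≠ j → Disjoint (e i ∪ {v i}) (e j ∪ {v j})) :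
    Relation.ReflTransGen (ElementaryCollapse V) univ (⋃ i, (e i ∪ {v i}))ᶜ := by
  classical
  have := Fintype.ofFinite ι
  suffices ∀ s : Finset ι, Relation.ReflTransGen (ElementaryCollapse V) univ
      (⋃ i ∈ s, (e i ∪ {v i}))ᶜ by simpa using this Finset.univ
  intro s
  induction s using Finset.induction_on with
  | empty => simpa using Relation.ReflTransGen.refl
  | insert i s hi ih =>
    refine ih.tail ⟨v i, hv i, e i, he i, ?_⟩
    have hmem : e i ∪ {v i} ⊆ (⋃ j ∈ s, (e j ∪ {v j}))ᶜ := by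
      intro x hx hx'
      obtain ⟨j, hj, hxj⟩ := mem_iUnion₂.1 hx'
      exact disjoint_left.1 (hd i j fun e => hi (e ▸ hj)) hx hxj
    refine ⟨hmem (Or.inr rfl), subset_union_left.trans hmem, hve i, ?_, ?_⟩
    · intro e' he' _ hcl
      -- Since `e i ∪ {v i}` is a neighbourhood of `v i`, every edge with `v i` in its closure meets
      -- `e i` and so equals it. This is the sense in which `v i` is a free end.
      obtain ⟨x, hx, hxe'⟩ := mem_closure_iff.1 hcl _ (ho i) (Or.inr rfl)
      rcases hx with hx | hx
      · exact eq_of_mem_edgeSet he' (he i) hxe' hx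
      · rw [mem_singleton_iff.1 hx] at hxe'
        exact (subset_compl_of_mem_edgeSet he' hxe' (hv i)).elim
    · ext x
      simp only [Finset.mem_insert, iUnion_iUnion_eq_or_left, mem_compl_iff, mem_union, mem_sdiff]
      tauto

namespace MomentData

variable {d : MomentData}

namespace Sites

variable {n : ℕ} (S : d.Sites n) {m₀ m : ℕ} {i₀ : Fin d.l₂} (h : d.IsGood i₀)
  {i₀' : Fin (S.add m₀ m).l₂} (h' : (S.add m₀ m).IsGood i₀')

include h

omit h in
theorem tip_mem_wh (i : Fin n) : S.tip i ∈ S.wh i := by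
  rw [S.tip_eq]
  exact S.arc_mem_wh (S.tipPos_pos i) (S.tipPos_lt i)

theorem tip_mem_K (i : Fin n) : S.tip i ∈ S.K := S.mem_K_of_phi h (S.phi_tip i) (S.zero_tip i).ge

theorem cls_eq_iff_add {x y : Plane} (hx : x ∈ S.K) (hy : y ∈ S.K) :
    h'.cls x = h'.cls y ↔ SliceRel S.K x y := by
  rw [← S.closure_add (m₀ := m₀) (m := m) h] at hx hy ⊢
  exact h'.cls_eq_iff hx hy

theorem continuousOn_cls_add : ContinuousOn h'.cls S.K := by
  rw [← S.closure_add (m₀ := m₀) (m := m) h]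
  exact h'.continuousOn_cls

/-- A whisker with its free end. -/
def whisker (_ : d.IsGood i₀) (h' : (S.add m₀ m).IsGood i₀') (i : Fin n) :
    Set (S.add m₀ m).Reeb := h'.cls '' (S.wh i ∩ S.K)

theorem mem_whisker {i : Fin n} {x : Plane} (hx : x ∈ S.K) :
    h'.cls x ∈ S.whisker h h' i ↔ x ∈ S.wh i := by
  constructor
  · rintro ⟨y, hy, hxy⟩
    exact S.wh_saturated h hy.1 ((S.cls_eq_iff_add h h' hy.2 hx).1 hxy)
  · intro hxw
    exact ⟨x, ⟨hxw, hx⟩, rfl⟩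

/-- Each slice above a disc meets the arc of the circle between tip and apex. The parameter of the
tip is included and that of the apex is not: the tip is the free end, and the apex remains after the
collapse. -/
theorem whisker_eq_arc (i : Fin n) :
    S.whisker h h' i = (h'.cls ∘ S.arc i) '' Ico (S.tipPos i) (S.r i) := by
  ext c
  constructor
  · rintro ⟨x, ⟨hxw, hx⟩, rfl⟩
    obtain ⟨a, ha, hxa⟩ := S.sliceRel_arc h hx hxw
    exact ⟨a, ha, ((S.cls_eq_iff_add h h' hx hxa.right_mem).2 hxa).symm⟩
  · rintro ⟨a, ha, rfl⟩
    exact ⟨_, ⟨S.arc_mem_wh ((S.tipPos_pos i).trans_le ha.1) ha.2, S.arc_mem_K h ha.1 ha.2.le⟩, rfl⟩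

theorem isOpen_whisker (i : Fin n) : IsOpen (S.whisker h h' i) := by
  have hK := S.closure_add (m₀ := m₀) (m := m) h
  have := h'.isOpen_cls_image (S.isOpen_wh i) (by
    rw [hK]; exact fun x hx y hxy => S.wh_saturated h hx hxy)
  rw [hK] at this
  exact this

theorem disjoint_whisker {i j : Fin n} (hij : i ≠ j) :
    Disjoint (S.whisker h h' i) (S.whisker h h' j) := by
  rw [disjoint_left]
  rintro _ ⟨x, ⟨hxw, hx⟩, rfl⟩ h2
  exact hij (S.wh_disjoint hxw ((S.mem_whisker h h' hx).1 h2))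

theorem continuousOn_cls_arc (i : Fin n) :
    ContinuousOn (h'.cls ∘ S.arc i) (Icc (S.tipPos i) (S.r i)) :=
  (S.continuousOn_cls_add h h').comp (S.continuous_arc i).continuousOn fun _ ha =>
    S.arc_mem_K h ha.1 ha.2

theorem injOn_cls_arc (i : Fin n) :
    InjOn (h'.cls ∘ S.arc i) (Icc (S.tipPos i) (S.r i)) := by
  intro a ha b hb hab
  have := ((S.cls_eq_iff_add h h' (S.arc_mem_K h ha.1 ha.2) (S.arc_mem_K h hb.1 hb.2)).1 hab).1
  rw [← S.sigma_arc i a, this, S.sigma_arc]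

theorem whisker_diff_tip (i : Fin n) :
    S.whisker h h' i \ {h'.cls (S.tip i)} = (h'.cls ∘ S.arc i) '' Ioo (S.tipPos i) (S.r i) := by
  have hlt := S.tipPos_lt i
  have e : ({h'.cls (S.tip i)} : Set _) = (h'.cls ∘ S.arc i) '' {S.tipPos i} := by
    rw [image_singleton, Function.comp, ← S.tip_eq]
  rw [whisker_eq_arc, e, ← ((S.injOn_cls_arc h h' i).mono _).image_sdiff_subset, Ico_sdiff_left]
  · exact singleton_subset_iff.2 ⟨le_rfl, hlt⟩
  · exact Ico_subset_Icc_self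

theorem tip_mem_closure (i : Fin n) :
    h'.cls (S.tip i) ∈ closure (S.whisker h h' i \ {h'.cls (S.tip i)}) := by
  have hlt := S.tipPos_lt i
  rw [whisker_diff_tip]
  have h1 : ContinuousOn (h'.cls ∘ S.arc i) (closure (Ioo (S.tipPos i) (S.r i))) := by
    rw [closure_Ioo hlt.ne]; exact S.continuousOn_cls_arc h h' i
  have := h1.image_closure (mem_image_of_mem _ (show S.tipPos i ∈ closure (Ioo _ (S.r i)) by
    rw [closure_Ioo hlt.ne]; exact ⟨le_rfl, hlt.le⟩))
  rw [Function.comp, ← S.tip_eq] at this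
  exact this

omit h in
theorem mem_vertices_add {x : Plane} (hx : x ∈ (S.add m₀ m).sing) :
    h'.cls x ∈ (S.add m₀ m).vertices := by
  rw [h'.vertices_eq]; exact mem_image_of_mem _ hx

theorem tip_mem_vertices (i : Fin n) : h'.cls (S.tip i) ∈ (S.add m₀ m).vertices :=
  S.mem_vertices_add h' (by
    rw [S.sing_add h]; exact Or.inr (mem_iUnion.2 ⟨i, Or.inl rfl⟩))

theorem eq_tip_of_vertex_whisker {i : Fin n} {x : Plane} (hx : x ∈ (S.add m₀ m).sing)
    (hxw : x ∈ S.wh i) : x = S.tip i := by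
  rw [S.sing_add h] at hx
  rcases hx with hx | hx
  · exact absurd (S.avoid i x hx) (not_lt.2 hxw.1.le)
  · obtain ⟨j, hj⟩ := mem_iUnion.1 hx
    have hφ : S.φ j x = 0 := by
      rcases hj with rfl | rfl | rfl
      exacts [S.phi_tip j, S.phi_foot j, S.phi_apex j]
    obtain rfl : j = i := S.eq_of_strip (S.mem_rect_of_phi hφ.le).1 hxw.1.le
    rcases hj with rfl | rfl | rfl
    · rfl
    · linarith [(S.foot_neg j).2, hxw.2.1]
    · exact (lt_irrefl _ hxw.2.1).elim

/-- Without its tip the whisker is an open arc that is open in the Reeb space. Its closure adds at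
most the classes of tip and apex, which are vertices, so it is clopen in the complement of the
vertices. -/
theorem whisker_edge (i : Fin n) :
    S.whisker h h' i \ {h'.cls (S.tip i)} ∈ edgeSet (S.add m₀ m).vertices := by
  have := h'.t2Space_reeb
  have hlt := S.tipPos_lt i
  have hsub : S.whisker h h' i \ {h'.cls (S.tip i)} ⊆ (S.add m₀ m).verticesᶜ := by
    rintro c ⟨hc, hct⟩ hcV
    rw [h'.vertices_eq] at hcV
    obtain ⟨x, hx, rfl⟩ := hcV
    have hxK : x ∈ S.K := by
      rw [← S.closure_add (m₀ := m₀) (m := m) h]; exact hx.1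
    exact hct (congrArg _ (S.eq_tip_of_vertex_whisker h hx ((S.mem_whisker h h' hxK).1 hc)))
  obtain ⟨a, ha⟩ := nonempty_Ioo.2 hlt
  have hmem : (h'.cls ∘ S.arc i) a ∈ S.whisker h h' i \ {h'.cls (S.tip i)} := by
    rw [whisker_diff_tip]; exact mem_image_of_mem _ ha
  refine ⟨_, hsub hmem, eq_connectedComponentIn_of_clopen ?_ hmem hsub ?_ ?_⟩
  · rw [whisker_diff_tip]
    exact isPreconnected_Ioo.image _ ((S.continuousOn_cls_arc h h' i).mono Ioo_subset_Icc_self)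
  · exact (S.isOpen_whisker h h' i).sdiff isClosed_singleton
  · rintro c ⟨hc, hcV⟩
    have hcl : IsClosed ((h'.cls ∘ S.arc i) '' Icc (S.tipPos i) (S.r i)) :=
      (isCompact_Icc.image_of_continuousOn (S.continuousOn_cls_arc h h' i)).isClosed
    have := closure_minimal (by
      rw [whisker_diff_tip]; exact image_mono Ioo_subset_Icc_self) hcl hc
    obtain ⟨b, hb, rfl⟩ := this
    rw [whisker_diff_tip]
    refine mem_image_of_mem _ ⟨lt_of_le_of_ne hb.1 ?_, lt_of_le_of_ne hb.2 ?_⟩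
    · rintro rfl
      apply hcV
      rw [Function.comp, ← S.tip_eq]
      exact S.tip_mem_vertices h h' i
    · rintro rfl
      apply hcV
      rw [Function.comp, ← S.apex_eq]
      exact S.mem_vertices_add h' (by
        rw [S.sing_add h]; exact Or.inr (mem_iUnion.2 ⟨i, Or.inr (Or.inr rfl)⟩))

/-- The map of Reeb spaces induced by the inclusion of the regions. -/
theorem exists_reeb_map :
    ∃ π : (S.add m₀ m).Reeb → d.Reeb, Continuous π ∧ ∀ x ∈ S.K, π (h'.cls x) = h.cls x := by
  have hK := S.closure_add (m₀ := m₀) (m := m) h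
  have hsub : closure (S.add m₀ m).D ⊆ closure d.D := by
    rw [hK]; exact fun x hx => hx.1
  let g : (S.add m₀ m).manifold → d.Reeb := fun p => h.cls ((S.add m₀ m).proj p)
  have hg : Continuous g :=
    h.continuousOn_cls.comp_continuous
      (((S.add m₀ m).projL.continuous).comp continuous_subtype_val) fun p => hsub p.2.1
  have hrel : ∀ p q, reebMap (S.add m₀ m).heightOn p = reebMap (S.add m₀ m).heightOn q →
      g p = g q := fun p q hpq =>
    (h.cls_eq_iff (hsub p.2.1) (hsub q.2.1)).2
      (((h'.reebMap_eq_iff_sliceRel p q).1 hpq).mono hsub)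
  refine ⟨Quotient.lift g fun p q hpq => hrel p q (Quotient.sound hpq), hg.quotient_lift _, ?_⟩
  intro x hx
  rw [← hK] at hx
  rw [h'.cls_of_mem hx]
  change h.cls _ = _
  rw [h'.proj_point]

-- After removal of the whiskers, the map of Reeb spaces induced by the inclusion of regions is
-- bijective. It is injective by `sliceRel_of_not_wh`, and surjective since the lower end of every
-- old slice survives outside the whiskers. Compactness makes it a homeomorphism, and old singular
-- points remain singular.
include h' in
theorem graphCollapsesTo_add :
    GraphCollapsesTo (S.add m₀ m).vertices d.vertices := by
  have hK := S.closure_add (m₀ := m₀) (m := m) h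
  have := h'.t2Space_reeb
  have := h'.compactSpace_reeb
  have := h.t2Space_reeb
  have hun : ∀ i, S.whisker h h' i \ {h'.cls (S.tip i)} ∪ {h'.cls (S.tip i)} = S.whisker h h' i :=
    fun i => sdiff_union_of_subset (singleton_subset_iff.2
      ((S.mem_whisker h h' (S.tip_mem_K h i)).2 (S.tip_mem_wh i)))
  have hcol := reflTransGen_elementaryCollapse (S.tip_mem_vertices h h') (S.whisker_edge h h')
    (S.tip_mem_closure h h') (fun i => by rw [hun]; exact S.isOpen_whisker h h' i)
    (fun i j hij => by rw [hun, hun]; exact S.disjoint_whisker h h' hij)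
  simp only [hun] at hcol
  refine ⟨_, hcol, ?_⟩
  set A := (⋃ i, S.whisker h h' i)ᶜ with hA
  have hAcl : IsClosed A := (isOpen_iUnion fun i => S.isOpen_whisker h h' i).isClosed_compl
  have : CompactSpace A := isCompact_iff_compactSpace.1 hAcl.isCompact
  have hmemA : ∀ x ∈ S.K, h'.cls x ∈ A ↔ ∀ i, x ∉ S.wh i := fun x hx => by
    rw [hA, mem_compl_iff, mem_iUnion, not_exists]
    exact forall_congr' fun i => not_congr (S.mem_whisker h h' hx)
  have hrep : ∀ c : (S.add m₀ m).Reeb, ∃ x ∈ S.K, h'.cls x = c := fun c => by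
    obtain ⟨x, hx, hc⟩ := h'.exists_cls c
    rw [hK] at hx
    exact ⟨x, hx, hc⟩
  obtain ⟨π, hπ, hπc⟩ := S.exists_reeb_map h h'
  have hbij : Function.Bijective fun a : A => π a := by
    constructor
    · rintro ⟨a, ha⟩ ⟨b, hb⟩ hab
      obtain ⟨x, hx, rfl⟩ := hrep a
      obtain ⟨y, hy, rfl⟩ := hrep b
      have hab : π (h'.cls x) = π (h'.cls y) := hab
      rw [hπc x hx, hπc y hy, h.cls_eq_iff hx.1 hy.1] at hab
      exact Subtype.ext ((S.cls_eq_iff_add h h' hx hy).2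
        (S.sliceRel_of_not_wh h hx hy ((hmemA x hx).1 ha) ((hmemA y hy).1 hb) hab))
    · intro c
      obtain ⟨x, hx, rfl⟩ := h.exists_cls c
      obtain ⟨z, hz, hmax⟩ := exists_slice_end h.adm.isCompact_closure hx (-1)
      obtain ⟨hzK, hzw⟩ := S.slice_bottom h hz hmax
      refine ⟨⟨h'.cls z, (hmemA z hzK).2 hzw⟩, ?_⟩
      change π (h'.cls z) = _
      rw [hπc z hzK, h.cls_eq_iff hzK.1 hx]
      exact hz.symm
  let φ : A ≃ₜ d.Reeb :=
    Continuous.homeoOfEquivCompactToT2 (f := Equiv.ofBijective _ hbij)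
      (hπ.comp continuous_subtype_val)
  refine ⟨φ, fun y hy => ?_⟩
  rw [h.vertices_eq] at hy
  obtain ⟨x, hx, rfl⟩ := hy
  have hxK := S.sing_subset_K hx
  have hxA : h'.cls x ∈ A := (hmemA x hxK).2 fun i hi => lt_asymm (S.avoid i x hx) hi.1
  have e : φ ⟨h'.cls x, hxA⟩ = h.cls x := hπc x hxK
  rw [← e, Homeomorph.symm_apply_apply]
  exact S.mem_vertices_add h' (by rw [S.sing_add h]; exact Or.inl hx)

end Sites

end MomentData

/-! ### Choice of the centres on boundary arcs -/

theorem exists_injective_of_infinite {α : Type*} {n : ℕ} {A : Fin n → Set α}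
    (hA : ∀ i, (A i).Infinite) : ∃ f : Fin n → α, Function.Injective f ∧ ∀ i, f i ∈ A i := by
  induction n with
  | zero => exact ⟨Fin.elim0, fun i => i.elim0, fun i => i.elim0⟩
  | succ n ih =>
    obtain ⟨f, hf, hfA⟩ := ih fun i => hA i.castSucc
    obtain ⟨x, hx, hxf⟩ := ((hA (Fin.last n)).sdiff (finite_range f)).nonempty
    refine ⟨Fin.snoc f x, ?_, fun i => ?_⟩
    · rw [Fin.snoc_injective_iff]
      exact ⟨hf, hxf⟩
    · refine Fin.lastCases ?_ (fun j => ?_) i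
      · rwa [Fin.snoc_last]
      · rw [Fin.snoc_castSucc]; exact hfA j

namespace MomentData

variable {d : MomentData}

/-- A point on the upper boundary of the region, with a tangent in general position, around which
small circles can be added. -/
structure IsCentre (d : MomentData) (k : Fin d.l₁) (p : Plane) : Prop where
  zero : polyFun (d.f k) p = 0
  vert : fderiv ℝ (polyFun (d.f k)) p !₂[0, 1] < 0
  horiz : fderiv ℝ (polyFun (d.f k)) p !₂[1, 0] ≠ 0
  avoid : ∀ x ∈ d.sing, x 0 ≠ p 0

section

variable {i₀ : Fin d.l₂} (h : d.IsGood i₀)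
  (hdisj : ∀ i j, i ≠ j → Disjoint (curve (d.f i)) (curve (d.f j)))
  (hcurve : ∀ j, curve (d.f j) ⊆ closure d.D)

include h

theorem image_proj_preimage (E : Set d.Reeb) :
    (fun p : d.manifold => d.proj p) '' (reebMap d.heightOn ⁻¹' E) =
      {x | x ∈ closure d.D ∧ h.cls x ∈ E} := by
  ext x
  constructor
  · rintro ⟨p, hp, rfl⟩
    refine ⟨p.2.1, ?_⟩
    rw [h.cls_proj]
    exact hp
  · rintro ⟨hx, hE⟩
    refine ⟨h.point hx, ?_, h.proj_point hx⟩
    rw [mem_preimage, ← h.cls_of_mem hx]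
    exact hE

theorem isOpen_edge (e : d.Edge) : IsOpen (e : Set d.Reeb) := by
  have := h.t2Space_reeb
  exact (edge_structure (continuous_reebHeight IsGood.continuous_heightOn) h.isClosed_vertices
    (fun _ hc => h.isRegularFor hc) e.2).1

include hdisj

/-- The upper end of a slice without singular points. -/
theorem exists_top {x : Plane} (hx : x ∈ closure d.D) (hxV : h.cls x ∉ d.vertices) :
    ∃ z k, SliceRel (closure d.D) x z ∧ polyFun (d.f k) z = 0 ∧
      fderiv ℝ (polyFun (d.f k)) z !₂[0, 1] < 0 := by
  obtain ⟨z, hz, hmax⟩ := exists_slice_end h.adm.isCompact_closure hx 1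
  have hzD := not_mem_of_slice_end h.adm.isOpen subset_closure (Or.inl rfl) hz hmax
  have hnn := h.mem_closure.1 hz.right_mem
  obtain ⟨k, hk⟩ : ∃ k, polyFun (d.f k) z = 0 := by
    by_contra hcon
    push Not at hcon
    apply hzD
    rw [h.region]
    exact fun j => lt_of_le_of_ne (hnn j) (Ne.symm (hcon j))
  refine ⟨z, k, hz, hk, ?_⟩
  have hzs : z ∉ d.sing := fun hs => hxV (by
    rw [h.vertices_eq, (h.cls_eq_iff hx hz.right_mem).2 hz]
    exact mem_image_of_mem _ hs)
  refine lt_of_le_of_ne ?_ (fderiv_ne_zero_of_not_sing h.adm hz.right_mem hzs hk)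
  -- If the function of the curve grew upwards at `z`, the slice could be prolonged beyond its upper
  -- end.
  by_contra hcon
  push Not at hcon
  have hev : ∀ᶠ t in 𝓝[>] (0 : ℝ), ∀ j, 0 < polyFun (d.f j) (z + t • (!₂[0, 1] : Plane)) := by
    rw [Filter.eventually_all]
    intro j
    refine (h.circ j).eventually_pos (hnn j) ?_
    by_cases hj : j = k
    · rw [hj]; exact Or.inr hcon
    · exact Or.inl (lt_of_le_of_ne (hnn j) fun h0 => disjoint_left.1 (hdisj j k hj) h0.symm hk)
  obtain ⟨δ, hδ, hI⟩ := mem_nhdsGT_iff_exists_Ioo_subset.1 hev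
  have hδ : 0 < δ := hδ
  have hrel : SliceRel (closure d.D) z (z + (δ / 2) • (!₂[0, 1] : Plane)) := by
    refine ⟨by simp, fun w hw0 hw1 => ?_⟩
    have e : (z + (δ / 2) • (!₂[0, 1] : Plane)) 1 = z 1 + δ / 2 := by simp
    rw [e, uIcc_of_le (by linarith)] at hw1
    rcases hw1.1.eq_or_lt with h1 | h1
    · rw [plane_ext hw0 h1.symm]; exact hz.right_mem
    · have hw : w = z + (w 1 - z 1) • (!₂[0, 1] : Plane) := plane_ext (by simp [hw0]) (by simp)
      rw [h.mem_closure, hw]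
      exact fun j => (hI ⟨by linarith, by linarith [hw1.2]⟩ j).le
  have := hmax _ (hz.trans hrel)
  simp at this
  linarith

include hcurve

/-- To each edge a boundary arc is attached that contains points in general position over
infinitely many first coordinates. -/
theorem exists_boundaryArc (e : d.Edge) :
    ∃ L, d.IsBoundaryArc e L ∧
      (∀ x ∈ L, x ∈ closure d.D ∧ h.cls x ∈ (e : Set d.Reeb)) ∧
      {u : ℝ | ∃ p ∈ L, p 0 = u ∧ ∃ k, d.IsCentre k p}.Infinite := by
  have heo := isOpen_edge h e
  obtain ⟨c, hc⟩ : (e : Set d.Reeb).Nonempty := by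
    obtain ⟨x, hxV, hx⟩ := e.2
    exact ⟨x, by rw [hx]; exact mem_connectedComponentIn hxV⟩
  have hcV := subset_compl_of_mem_edgeSet e.2 hc
  obtain ⟨x, hx, rfl⟩ := h.exists_cls c
  obtain ⟨z, k, hz, hk, hv⟩ := exists_top h hdisj hx hcV
  have hzc : h.cls z = h.cls x := ((h.cls_eq_iff hx hz.right_mem).2 hz).symm
  set A := (fun p : d.manifold => d.proj p) '' (reebMap d.heightOn ⁻¹' (e : Set d.Reeb)) with hA
  have hAe : A = {x | x ∈ closure d.D ∧ h.cls x ∈ (e : Set d.Reeb)} := image_proj_preimage h _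
  set B := A ∩ ⋃ j, curve (d.f j) with hB
  have hzB : z ∈ B := by
    refine ⟨?_, mem_iUnion.2 ⟨k, hk⟩⟩
    rw [hAe]
    exact ⟨hz.right_mem, by rw [hzc]; exact hc⟩
  refine ⟨connectedComponentIn B z, ⟨z, hzB, rfl⟩, fun y hy => ?_, ?_⟩
  · have := (connectedComponentIn_subset _ _ hy).1
    rw [hAe] at this
    exact this
  obtain ⟨s, P, R, hR, hs, hf⟩ := h.circ k
  have hs0 : s ≠ 0 := by rcases hs with rfl | rfl <;> norm_num
  have hk' : (z 0 - P 0) ^ 2 + (z 1 - P 1) ^ 2 - R ^ 2 = 0 := by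
    rw [hf, circFun] at hk
    exact (mul_eq_zero.1 hk).resolve_left hs0
  have hv' : s * (z 1 - P 1) < 0 := by
    rw [hf, fderiv_circFun] at hv
    simp at hv
    linarith
  obtain ⟨τ, hτ, hzτ⟩ : ∃ τ : ℝ, τ * τ = 1 ∧ 0 < τ * (z 1 - P 1) := by
    rcases hs with rfl | rfl
    · exact ⟨-1, by norm_num, by linarith⟩
    · exact ⟨1, by norm_num, by linarith⟩
  have hst : s * τ < 0 := by
    have : s * (z 1 - P 1) = (s * τ) * (τ * (z 1 - P 1)) := by
      linear_combination (-(s * (z 1 - P 1))) * hτ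
    rw [this] at hv'
    by_contra hcon
    push Not at hcon
    linarith [mul_nonneg hcon hzτ.le]
  -- The half of the circle through `z`, as a graph over the first coordinate. Near `z` it stays
  -- over the open edge `e`, hence in the component of `z`.
  let γ : ℝ → Plane := fun u => !₂[u, P 1 + τ * √(R ^ 2 - (u - P 0) ^ 2)]
  have hγ : Continuous γ := by fun_prop
  have hγz : γ (z 0) = z := by
    refine plane_ext rfl ?_
    have : R ^ 2 - (z 0 - P 0) ^ 2 = (τ * (z 1 - P 1)) ^ 2 := by
      linear_combination -hk' - (z 1 - P 1) ^ 2 * hτ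
    simp only [γ, Fin.isValue, Matrix.cons_val_one, Matrix.cons_val_fin_one]
    rw [this, Real.sqrt_sq hzτ.le]
    linear_combination (z 1 - P 1) * hτ
  have hpos : 0 < R ^ 2 - (z 0 - P 0) ^ 2 := by
    have : z 1 - P 1 ≠ 0 := fun h0 => by rw [h0] at hzτ; simp at hzτ
    have := pow_pos (abs_pos.2 this) 2
    rw [sq_abs] at this
    linarith
  have hzero : ∀ u, 0 < R ^ 2 - (u - P 0) ^ 2 → polyFun (d.f k) (γ u) = 0 := by
    intro u hu
    rw [hf]
    simp only [γ, circFun, Fin.isValue, Matrix.cons_val_zero, Matrix.cons_val_one,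
      Matrix.cons_val_fin_one, add_sub_cancel_left, mul_pow]
    rw [Real.sq_sqrt hu.le]
    linear_combination s * (R ^ 2 - (u - P 0) ^ 2) * hτ
  have hU : IsOpen {u : ℝ | 0 < R ^ 2 - (u - P 0) ^ 2} := isOpen_lt continuous_const (by fun_prop)
  have hcont : ContinuousOn (h.cls ∘ γ) {u : ℝ | 0 < R ^ 2 - (u - P 0) ^ 2} :=
    h.continuousOn_cls.comp hγ.continuousOn fun u hu => hcurve k (hzero u hu)
  have hW : {u : ℝ | 0 < R ^ 2 - (u - P 0) ^ 2} ∩ (h.cls ∘ γ) ⁻¹' (e : Set d.Reeb) ∈ 𝓝 (z 0) := by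
    refine (hcont.isOpen_inter_preimage hU heo).mem_nhds ⟨hpos, ?_⟩
    change h.cls (γ (z 0)) ∈ (e : Set d.Reeb)
    rw [hγz, hzc]
    exact hc
  obtain ⟨δ, hδ, hball⟩ := Metric.mem_nhds_iff.1 hW
  rw [Real.ball_eq_Ioo] at hball
  set I := Ioo (z 0 - δ) (z 0 + δ) with hI
  have hIB : γ '' I ⊆ connectedComponentIn B z := by
    refine (isPreconnected_Ioo.image γ hγ.continuousOn).subset_connectedComponentIn
      ⟨z 0, ⟨by linarith, by linarith⟩, hγz⟩ ?_
    rintro _ ⟨u, hu, rfl⟩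
    have h1 := hball hu
    refine ⟨?_, mem_iUnion.2 ⟨k, hzero u h1.1⟩⟩
    rw [hAe]
    exact ⟨hcurve k (hzero u h1.1), h1.2⟩
  -- Only finitely many first coordinates are excluded: that of the centre of the circle, where the
  -- tangent is horizontal, and those of the singular points.
  have hinf : (I \ insert (P 0) ((fun y : Plane => y 0) '' d.sing)).Infinite :=
    (Ioo_infinite (by linarith)).sdiff ((h.finite_sing.image _).insert _)
  refine hinf.mono ?_
  rintro u ⟨hu, hus⟩
  rw [mem_insert_iff, not_or] at hus
  have h1 := (hball hu).1
  refine ⟨γ u, hIB (mem_image_of_mem _ hu), rfl, k, hzero u h1, ?_, ?_, ?_⟩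
  · rw [hf, fderiv_circFun]
    simp only [γ, Fin.isValue, Matrix.cons_val_zero, Matrix.cons_val_one, Matrix.cons_val_fin_one,
      add_sub_cancel_left, mul_zero, mul_one, zero_add]
    have := Real.sqrt_pos.2 h1
    nlinarith
  · rw [hf, fderiv_circFun]
    simp [γ, hs0, sub_eq_zero, hus.1]
  · intro y hy e
    exact hus.2 ⟨y, hy, e⟩

/-- Sites of arbitrarily small circles with prescribed numbers of centres on boundary arcs. -/
theorem exists_sites [Finite d.Edge] {L : d.Edge → Set Plane}
    (hL : ∀ e, {u : ℝ | ∃ p ∈ L e, p 0 = u ∧ ∃ k, d.IsCentre k p}.Infinite) {ε : ℝ} (hε : 0 < ε)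
    (l : d.Edge → ℕ) :
    ∃ (S : d.Sites (∑ᶠ e, l e)) (a : Fin (∑ᶠ e, l e) → d.Edge),
      (∀ i, S.p i ∈ L (a i)) ∧ (∀ i, S.r i < ε) ∧ ∀ e, {i | a i = e}.ncard = l e := by
  classical
  have := Fintype.ofFinite d.Edge
  have hcard : Fintype.card (Σ e, Fin (l e)) = ∑ᶠ e, l e := by
    rw [Fintype.card_sigma, finsum_eq_sum_of_fintype]
    simp
  let E := (Fintype.equivFinOfCardEq hcard).symm
  let a : Fin (∑ᶠ e, l e) → d.Edge := fun i => (E i).1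
  -- Distinct first coordinates for all centres, also for those on different arcs, so that the
  -- strips of small circles are disjoint.
  obtain ⟨u, hu, huL⟩ := exists_injective_of_infinite fun i => hL (a i)
  choose p hp hpu k hk using huL
  have hothers : ∀ i j, j ≠ k i → 0 < polyFun (d.f j) (p i) := fun i j hj =>
    lt_of_le_of_ne (h.mem_closure.1 (hcurve _ (hk i).zero) j)
      fun h0 => disjoint_left.1 (hdisj j (k i) hj) h0.symm (hk i).zero
  choose σ H hsite using fun i =>
    exists_isSite h.circ (hk i).zero (hothers i) (hk i).vert (hk i).horiz
  have hdouble : Filter.Tendsto (fun r : ℝ => 2 * r) (𝓝[>] 0) (𝓝[>] 0) := by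
    refine tendsto_nhdsWithin_iff.2 ⟨?_, ?_⟩
    · have : Filter.Tendsto (fun r : ℝ => 2 * r) (𝓝 0) (𝓝 (2 * 0)) :=
        (continuous_const_mul 2).tendsto 0
      rw [mul_zero] at this
      exact this.mono_left nhdsWithin_le_nhds
    · filter_upwards [self_mem_nhdsWithin] with r hr
      exact mul_pos two_pos (mem_Ioi.1 hr)
  have hsmall : ∀ c : ℝ, 0 < c → ∀ᶠ r in 𝓝[>] (0 : ℝ), r < c := fun c hc =>
    nhdsWithin_le_nhds (gt_mem_nhds hc)
  have e1 : ∀ᶠ r in 𝓝[>] (0 : ℝ), ∀ i, IsSite d (k i) (p i) (σ i) r (H i) :=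
    Filter.eventually_all.2 hsite
  have e2 : ∀ᶠ r in 𝓝[>] (0 : ℝ), ∀ i, IsSite d (k i) (p i) (σ i) (2 * r) (H i) :=
    Filter.eventually_all.2 fun i => hdouble.eventually (hsite i)
  have e3 : ∀ᶠ r in 𝓝[>] (0 : ℝ), ∀ i i', i ≠ i' → 2 * r + 2 * r < |p i 0 - p i' 0| := by
    refine Filter.eventually_all.2 fun i => Filter.eventually_all.2 fun i' => ?_
    by_cases hii : i = i'
    · exact Filter.Eventually.of_forall fun r hr => (hr hii).elim
    · have : 0 < |p i 0 - p i' 0| := by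
        rw [abs_pos, sub_ne_zero, hpu, hpu]
        exact fun e => hii (hu e)
      filter_upwards [hsmall _ (show 0 < |p i 0 - p i' 0| / 4 by linarith)] with r hr _
      linarith
  have e4 : ∀ᶠ r in 𝓝[>] (0 : ℝ), ∀ i, ∀ x ∈ d.sing, r < |x 0 - p i 0| := by
    refine Filter.eventually_all.2 fun i => (Filter.eventually_all_finite h.finite_sing).2 fun x hx => ?_
    exact hsmall _ (abs_pos.2 (sub_ne_zero.2 ((hk i).avoid x hx)))
  -- One radius serves all circles, as finitely many conditions hold for all small radii.
  obtain ⟨r, h1, h2, h3, h4, h5⟩ := (e1.and (e2.and (e3.and (e4.and (hsmall ε hε))))).exists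
  refine ⟨⟨k, p, σ, fun _ => r, H, h1, h2, h3, h4⟩, a, hp, fun _ => h5, fun e => ?_⟩
  have : {i | a i = e} = E.symm '' (Sigma.mk e '' univ) := by
    ext i
    constructor
    · rintro rfl
      exact ⟨E i, ⟨(E i).2, mem_univ _, rfl⟩, E.symm_apply_apply i⟩
    · rintro ⟨_, ⟨b, -, rfl⟩, rfl⟩
      simp [a]
  rw [this, ncard_image_of_injective _ E.symm.injective,
    ncard_image_of_injective _ sigma_mk_injective, ncard_univ, Nat.card_eq_fintype_card,
    Fintype.card_fin]

-- Points of an arc `L e` have classes in `e`, and different edges are disjoint. So a centre lies on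
-- the chosen arc of its own edge only, and the count on each arc is exact.
omit hdisj hcurve in
theorem Sites.isAddition [Finite d.Edge] {L : d.Edge → Set Plane} (hLarc : ∀ e, d.IsBoundaryArc e (L e))
    (hLcls : ∀ e, ∀ x ∈ L e, x ∈ closure d.D ∧ h.cls x ∈ (e : Set d.Reeb)) {ε : ℝ}
    {l : d.Edge → ℕ} (S : d.Sites (∑ᶠ e, l e)) {a : Fin (∑ᶠ e, l e) → d.Edge}
    (hp : ∀ i, S.p i ∈ L (a i)) (hr : ∀ i, S.r i < ε) (ha : ∀ e, {i | a i = e}.ncard = l e)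
    (m₀ m : ℕ) : d.IsAddition (S.add m₀ m) l ε := by
  have hnew : ∀ j : Fin (S.add m₀ m).l₁, d.l₁ ≤ j.val → ∃ i, j = S.new m₀ m i := by
    intro j hj
    rcases S.index_cases m₀ m j with ⟨k, rfl⟩ | hi
    · exact absurd k.2 (not_lt.2 hj)
    · exact hi
  have hge : ∀ i, d.l₁ ≤ (S.new m₀ m i).val := fun i => by rw [S.val_new]; omega
  have hcurve_new : ∀ i, curve ((S.add m₀ m).f (S.new m₀ m i)) = {x | S.φ i x = 0} := fun i => by
    rw [curve, S.polyFun_new]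
  refine ⟨rfl, rfl, ?_, ?_, ?_, ?_, ?_, ?_, ?_⟩
  · intro j hj
    exact S.f_old m₀ m ⟨j.val, hj⟩
  · let P : Fin (S.add m₀ m).l₁ → Plane := Fin.append (fun _ : Fin d.l₁ => (0 : Plane)) S.p
    have hP : ∀ i, P (S.new m₀ m i) = S.p i := fun i =>
      Fin.append_right (fun _ : Fin d.l₁ => (0 : Plane)) S.p i
    refine ⟨P, L, fun j hj => ?_, hLarc, fun e => ?_⟩
    · obtain ⟨i, rfl⟩ := hnew j hj
      exact ⟨S.r i, (S.site i).r_pos, hr i, by rw [S.f_new, hP]⟩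
    · have : {j : Fin (S.add m₀ m).l₁ | d.l₁ ≤ j.val ∧ P j ∈ L e} = S.new m₀ m '' {i | a i = e} := by
        ext j
        constructor
        · rintro ⟨hj, hjL⟩
          obtain ⟨i, rfl⟩ := hnew j hj
          rw [hP] at hjL
          refine ⟨i, ?_, rfl⟩
          exact Subtype.ext (eq_of_mem_edgeSet (a i).2 e.2 (hLcls _ _ (hp i)).2 (hLcls _ _ hjL).2)
        · rintro ⟨i, rfl, rfl⟩
          exact ⟨hge i, by rw [hP]; exact hp i⟩
      have hinj : Function.Injective (S.new m₀ m) := Fin.natAdd_injective _ _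
      rw [this, ncard_image_of_injective _ hinj, ha]
  · ext x
    constructor
    · rintro ⟨hx, hφ⟩
      refine ⟨hx, fun j hj => ?_⟩
      obtain ⟨i, rfl⟩ := hnew j hj
      rw [S.polyFun_new]
      exact hφ i
    · rintro ⟨hx, hφ⟩
      refine ⟨hx, fun i => ?_⟩
      rw [← S.polyFun_new m₀ m]
      exact hφ _ (hge i)
  · intro j
    rcases S.index_cases m₀ m j with ⟨k, rfl⟩ | ⟨i, rfl⟩
    · rw [S.c_old, if_pos (by rw [S.val_old]; exact k.2)]
      rfl
    · rw [S.c_new, if_neg (not_lt.2 (hge i))]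
      rfl
  · intro j j' hj hj' hne
    obtain ⟨i, rfl⟩ := hnew j hj
    obtain ⟨i', rfl⟩ := hnew j' hj'
    rw [disjoint_left, hcurve_new, hcurve_new]
    intro x hx hx'
    exact hne (congrArg _ (S.eq_of_phi (le_of_eq hx) (le_of_eq hx')))
  · intro j hj
    obtain ⟨i, rfl⟩ := hnew j hj
    rw [hcurve_new]
    refine ⟨S.k i, ⟨S.tip i, S.zero_tip i, S.phi_tip i⟩, ?_⟩
    rintro k ⟨x, hx, hx'⟩
    exact S.eq_k_of_zero hx' hx
  · intro j hj k hne
    obtain ⟨i, rfl⟩ := hnew j hj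
    rw [hcurve_new] at hne ⊢
    obtain ⟨x, hx, hx'⟩ := hne
    obtain rfl := S.eq_k_of_zero hx' hx
    have : curve (d.f (S.k i)) ∩ {x | S.φ i x = 0} = {S.tip i, S.foot i} := by
      ext y
      constructor
      · rintro ⟨h1, h2⟩
        exact S.eq_tip_or_foot h2 h1
      · rintro (rfl | rfl)
        · exact ⟨S.zero_tip i, S.phi_tip i⟩
        · exact ⟨S.zero_foot i, S.phi_foot i⟩
    rw [this, ncard_pair]
    intro e
    have h1 := (S.tip_pos i).2
    have h2 := (S.foot_neg i).2
    rw [e] at h1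
    linarith

end

end MomentData

end

/-! ### Proof of the theorem -/

theorem theorem2 (d₀ : MomentData) (m₀ : ℕ)
    -- the original situation: a plane region bounded by disjoint circles, and `l₂ = 1`
    (hd₀ : d₀.IsAdmissible) (hl₂ : d₀.l₂ = 1) (hμ : ∀ i, d₀.μ i = m₀)
    (hcircle : ∀ j, IsCirclePoly (d₀.f j))
    (hdisj : ∀ i j, i ≠ j → Disjoint (curve (d₀.f i)) (curve (d₀.f j)))
    (hbdry : closure d₀.D \ d₀.D = ⋃ j, curve (d₀.f j)) :
    IsFiniteGraph d₀.Reeb d₀.vertices ∧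
    ∀ ε : ℝ, 0 < ε →
    -- one choice of new data for each function `l` on the edges and each dimension `m`
    ∃ d : (d₀.Edge → ℕ) → ℕ → MomentData,
      (∀ (l : d₀.Edge → ℕ) (m : ℕ), m₀ + 2 < m →
        -- the new data
        (d l m).IsAdmissible ∧
        d₀.IsAddition (d l m) l ε ∧
        (l ≠ 0 → Function.Surjective (d l m).c) ∧
        (∀ i : Fin (d l m).l₂, i.val = 0 → (d l m).μ i = m₀) ∧
        (d l m).D ⊆ d₀.D ∧ (l ≠ 0 → (d l m).D ≠ d₀.D) ∧
        (∀ j, ((closure (d l m).D \ (d l m).D) ∩ curve ((d l m).f j)).Nonempty) ∧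
        -- the manifold and the map
        (d l m).dim = m ∧
        (d l m).manifold = (d l m).zeroSet ∧
        (d l m).IsNonsingular ∧
        IsCompact (d l m).manifold ∧
        IsConnected (d l m).manifold ∧
        -- the function
        IsMorseBott (d l m).manifold (d l m).tangent (d l m).height ∧
        -- its Reeb graph
        IsFiniteGraph (d l m).Reeb (d l m).vertices ∧
        GraphCollapsesTo (d l m).vertices d₀.vertices) ∧
      -- functions `l`, `l'` that differ at exactly one edge give non-isomorphic Reeb graphs
      ∀ (l l' : d₀.Edge → ℕ) (m m' : ℕ), m₀ + 2 < m → m₀ + 2 < m' →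
        (∃! e, l e ≠ l' e) →
        ¬ GraphIso (d l m).vertices (d l' m').vertices := by
  have hc : ∀ j, IsCircFun (polyFun (d₀.f j)) := fun j => (hcircle j).isCircFun
  let i₀ : Fin d₀.l₂ := ⟨0, by omega⟩
  have h : d₀.IsGood i₀ := MomentData.isGood_of_boundary hd₀ hc hdisj hbdry hl₂ i₀
  have hcurve := MomentData.curve_subset_closure hbdry
  refine ⟨h.isFiniteGraph, fun ε hε => ?_⟩
  have hfin : Finite d₀.Edge := h.isFiniteGraph.finite_edges.to_subtype
  choose L hLarc hLcls hLinf using MomentData.exists_boundaryArc h hdisj hcurve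
  -- The sites depend on `l` alone. The number `m` enters only through the dimension of the new
  -- spheres.
  choose S a hp hr ha using MomentData.exists_sites h hdisj hcurve hLinf hε
  have hne : ∀ l : d₀.Edge → ℕ, l ≠ 0 → Nonempty (Fin (∑ᶠ e, l e)) := by
    intro l hl
    obtain ⟨e, he⟩ := Function.ne_iff.1 hl
    have : ({i | a l i = e} : Set _).Nonempty := by
      rw [nonempty_iff_ne_empty]
      intro h0
      have := ha l e
      rw [h0, ncard_empty] at this
      exact he this.symm
    exact ⟨this.some⟩
  refine ⟨fun l m => (S l).add m₀ m, fun l m hm => ?_, ?_⟩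
  · have h' := (S l).isGood_add h hdisj hm
    refine ⟨h'.adm, MomentData.Sites.isAddition h hLarc hLcls (S l) (hp l) (hr l) (ha l) m₀ m,
      fun hl i => ?_, fun i hi => ?_, fun x hx => hx.1, fun hl => ?_,
      (S l).inter_curve_nonempty h hcurve, (S l).dim_add hm, ?_, h'.adm.isNonsingular h'.circ,
      h'.isCompact_manifold, h'.isConnected_manifold,
      h'.isMorseBott fun x _ => (S l).fderiv_vertical_ne_zero hdisj x, h'.isFiniteGraph,
      (S l).graphCollapsesTo_add h h'⟩
    · obtain ⟨i'⟩ := hne l hl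
      obtain ⟨j⟩ := MomentData.nonempty_index_of_boundary hd₀ hbdry
      change Fin 2 at i
      fin_cases i
      · exact ⟨_, (S l).c_old m₀ m j⟩
      · exact ⟨_, (S l).c_new m₀ m i'⟩
    · have : i = (0 : Fin 2) := Fin.ext hi
      rw [this]
      rfl
    · obtain ⟨i'⟩ := hne l hl
      exact (S l).D_add_ne h i'
    · exact (S l).manifold_eq_zeroSet (fun _ => h.mem_closure) ((S l).closure_add h)
        fun i j hij _ => MomentData.pos_of_neg_of_boundary hd₀ hc hdisj hbdry hij
  · rintro l l' m m' hm hm' ⟨e, he, huniq⟩ ⟨φ, hφ⟩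
    -- A homeomorphism that respects vertices equates the two vertex counts, and hence the two total
    -- numbers of circles. Cancelling the edges at which `l` and `l'` agree leaves equality at `e`,
    -- a contradiction.
    have h1 := (S l).ncard_vertices_add h hdisj hm
    have h2 := (S l').ncard_vertices_add h hdisj hm'
    rw [← hφ, ncard_image_of_injective _ φ.injective, h1] at h2
    have h3 : ∑ᶠ e, l e = ∑ᶠ e, l' e := by omega
    classical
    have := Fintype.ofFinite d₀.Edge
    rw [finsum_eq_sum_of_fintype l, finsum_eq_sum_of_fintype l',
      ← Finset.add_sum_erase _ l (Finset.mem_univ e),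
      ← Finset.add_sum_erase _ l' (Finset.mem_univ e)] at h3
    have h4 : ∑ x ∈ Finset.univ.erase e, l x = ∑ x ∈ Finset.univ.erase e, l' x :=
      Finset.sum_congr rfl fun x hx => not_not.1 fun hx' => Finset.ne_of_mem_erase hx (huniq x hx')
    omega
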